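/- Model. Algorithms are deterministic, uniform programs for a real RAM: each arithmetic operation ($+,-,\cdot,/$ on real numbers; $+,-,\cdot$ on natural numbers), memory access, comparison, control step and output of one number costs one time unit; there is no rounding operation, and no real constants are available other than those computed from natural numbers. A subroutine can be run in a fresh memory of its own; copying its input and its output is charged. Instances have vertex set $V=\{0,\dots,n-1\}$; numbers are given in memory, and a walk is output as the sequence of visited vertices. Tours. Let $V$ be a finite set, $n=|V|$, and let $c:V\times V\to\mathbb R_{\ge 0}$ satisfy the triangle inequality $c(x,z)\le c(x,y)+c(y,z)$ for all $x,y,z\in V$. A tour $T$ on $V$ is a closed walk, visiting $v_1,\dots,v_r,v_{r+1}=v_1$ in this order, that visits every vertex of $V$ at least once. With $v_{r+l}:=v_l$, put $$c(T)=\sum_{i=1}^r c(v_i,v_{i+1}),\qquad c^{(k)}(T)=\sum_{\Delta=1}^k\sum_{i=1}^r c(v_i,v_{i+\Delta}).$$ Hop-ATSP. An instance $\mathcal I=(V,c,k)$ consists of $V$, $c$ as above and $k\in\mathbb N$ with $k<|V|$; $\mathrm{OPT}(\mathcal I)$ is the minimum of $c^{(k)}(T)$ over all tours $T$ on $V$.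 The instance is well-scaled if $c$ takes only values in $\{0,1,\dots,2n^3\}$ and $\mathrm{OPT}(\mathcal I)\ge n^2$. Asymmetric A Priori TSP. An instance $\mathcal J=(V,c,p)$ consists of $V$, $c$ as above and $p:V\to[0,1]$. Let $A\sim p$ be the random subset of $V$ that contains each $v$ independently with probability $p(v)$, and let $T[A]$ be the closed walk obtained from $T$ by skipping all visits of vertices outside $A$. Then $\mathrm{OPT}(\mathcal J)$ is the minimum of $\mathbb E_{A\sim p}[c(T[A])]$ over all tours $T$ on $V$. Theorem. There are a constant $C$ and polynomials $q_1,q_2$ with natural-number coefficients such that the following holds. Let $\alpha:\mathbb N\to\mathbb R_{\ge 1}$ and $t:\mathbb N\to\mathbb N$ be monotonically increasing (not necessarily strictly). Suppose there is an algorithm that computes, for every well-scaled instance $\mathcal I=(V,c,k)$ of Hop-ATSP, in time $t(n)$ a tour $T$ with $c^{(k)}(T)\le\alpha(n)\cdot\mathrm{OPT}(\mathcal I)$, where $n=|V|$. Then there is an algorithm that computes, for every instance $\mathcal J=(V,c,p)$ of Asymmetric A Priori TSP, in time at most $n\cdot t(q_1(n))+q_2(n)$ a tour $T$ with $$\mathbb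 E_{A\sim p}\big[c(T[A])\big]\ \le\ C\cdot\alpha(5n^2)\cdot\mathrm{OPT}(\mathcal J),$$ where $n=|V|$. -/

import Mathlib

namespace HopReduction

/-! ### Computational model: structured programs for a real RAM

The memory consists of countably many arrays of natural numbers and countably many arrays of
real numbers, each with cells `0, 1, 2, …`, and a write-only output tape of natural numbers.
Which array an expression refers to is fixed in the program text; the cell index is computed.
Every arithmetic operation, memory access, comparison and control step costs one time unit.
Real numbers can be added, subtracted, multiplied, divided (with value `0` for division by `0`)
and compared exactly; there is no rounding operation and there are no real constants besides
those obtained from natural numbers. -/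

/-- A memory state: `nat a i` and `real a i` are the contents of cell `i` of the `a`-th array of
natural, respectively real, numbers; `out` lists what has been written to the output tape. -/
structure Mem where
  nat : ℕ → ℕ → ℕ
  real : ℕ → ℕ → ℝ
  out : List ℕ

/-- The memory in which a program starts on the input consisting of a list of natural numbers
and a list of real numbers: these fill the beginning of the `0`-th arrays, all other cells
contain `0`, and the output tape is empty. -/
noncomputable def Mem.input (ns : List ℕ) (rs : List ℝ) : Mem where
  nat := fun a i => if a = 0 then ns.getD i 0 else 0
  real := fun a i => if a = 0 then rs.getD i 0 else 0
  out := []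

/-- Overwrite cell `i` of the natural-number array `a`. -/
def Mem.setNat (s : Mem) (a i v : ℕ) : Mem :=
  { s with nat := Function.update s.nat a (Function.update (s.nat a) i v) }

/-- Overwrite cell `i` of the real array `a`. -/
def Mem.setReal (s : Mem) (a i : ℕ) (v : ℝ) : Mem :=
  { s with real := Function.update s.real a (Function.update (s.real a) i v) }

/-- Append a number to the output tape. -/
def Mem.emit (s : Mem) (v : ℕ) : Mem :=
  { s with out := s.out ++ [v] }

/-- Store a list in the natural-number array `a`: its length in cell `0` and its entries in
cells `1, …, l.length`. The other cells keep their contents. -/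
def Mem.storeList (s : Mem) (a : ℕ) (l : List ℕ) : Mem :=
  { s with
    nat := Function.update s.nat a
      (fun i => if i = 0 then l.length else l.getD (i - 1) (s.nat a i)) }

/-- Expressions for natural numbers; `sub` is truncated subtraction. -/
inductive NExp where
  | lit (m : ℕ)
  | get (a : ℕ) (i : NExp)
  | add (e₁ e₂ : NExp)
  | sub (e₁ e₂ : NExp)
  | mul (e₁ e₂ : NExp)

def NExp.eval (s : Mem) : NExp → ℕ
  | .lit m => m
  | .get a i => s.nat a (i.eval s)
  | .add e₁ e₂ => e₁.eval s + e₂.eval s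
  | .sub e₁ e₂ => e₁.eval s - e₂.eval s
  | .mul e₁ e₂ => e₁.eval s * e₂.eval s

/-- The number of steps for the evaluation of an expression. -/
def NExp.cost : NExp → ℕ
  | .lit _ => 1
  | .get _ i => i.cost + 1
  | .add e₁ e₂ => e₁.cost + e₂.cost + 1
  | .sub e₁ e₂ => e₁.cost + e₂.cost + 1
  | .mul e₁ e₂ => e₁.cost + e₂.cost + 1

/-- Expressions for real numbers. -/
inductive RExp where
  | ofNat (e : NExp)
  | get (a : ℕ) (i : NExp)
  | add (e₁ e₂ : RExp)
  | sub (e₁ e₂ : RExp)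
  | mul (e₁ e₂ : RExp)
  | div (e₁ e₂ : RExp)

noncomputable def RExp.eval (s : Mem) : RExp → ℝ
  | .ofNat e => (e.eval s : ℝ)
  | .get a i => s.real a (i.eval s)
  | .add e₁ e₂ => e₁.eval s + e₂.eval s
  | .sub e₁ e₂ => e₁.eval s - e₂.eval s
  | .mul e₁ e₂ => e₁.eval s * e₂.eval s
  | .div e₁ e₂ => e₁.eval s / e₂.eval s

def RExp.cost : RExp → ℕ
  | .ofNat e => e.cost + 1
  | .get _ i => i.cost + 1
  | .add e₁ e₂ => e₁.cost + e₂.cost + 1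
  | .sub e₁ e₂ => e₁.cost + e₂.cost + 1
  | .mul e₁ e₂ => e₁.cost + e₂.cost + 1
  | .div e₁ e₂ => e₁.cost + e₂.cost + 1

/-- Tests. -/
inductive BExp where
  | natLt (e₁ e₂ : NExp)
  | natEq (e₁ e₂ : NExp)
  | realLt (e₁ e₂ : RExp)
  | not (b : BExp)
  | and (b₁ b₂ : BExp)

def BExp.Holds (s : Mem) : BExp → Prop
  | .natLt e₁ e₂ => e₁.eval s < e₂.eval s
  | .natEq e₁ e₂ => e₁.eval s = e₂.eval s
  | .realLt e₁ e₂ => e₁.eval s < e₂.eval s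
  | .not b => ¬ b.Holds s
  | .and b₁ b₂ => b₁.Holds s ∧ b₂.Holds s

def BExp.cost : BExp → ℕ
  | .natLt e₁ e₂ => e₁.cost + e₂.cost + 1
  | .natEq e₁ e₂ => e₁.cost + e₂.cost + 1
  | .realLt e₁ e₂ => e₁.cost + e₂.cost + 1
  | .not b => b.cost + 1
  | .and b₁ b₂ => b₁.cost + b₂.cost + 1

/-- Programs. `setNat a i e` and `setReal a i e` are assignments to cell `i` of array `a`,
`emit e` writes to the output tape, `loop b c` is the loop "while `b` do `c`", and
`call c na nlen ra rlen dst` runs the program `c` as a subroutine in a memory of its own. The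
input of the subroutine consists of the first `nlen` cells of the natural-number array `na` and
the first `rlen` cells of the real array `ra`; its output is stored in the natural-number
array `dst`. -/
inductive Program where
  | skip
  | setNat (a : ℕ) (i e : NExp)
  | setReal (a : ℕ) (i : NExp) (e : RExp)
  | emit (e : NExp)
  | seq (c₁ c₂ : Program)
  | ite (b : BExp) (c₁ c₂ : Program)
  | loop (b : BExp) (c : Program)
  | call (c : Program) (na : ℕ) (nlen : NExp) (ra : ℕ) (rlen : NExp) (dst : ℕ)

/-- The input passed to a subroutine that is called in the state `s`. -/
noncomputable def Mem.frame (s : Mem) (na nlen ra rlen : ℕ) : Mem :=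
  Mem.input ((List.range nlen).map (s.nat na)) ((List.range rlen).map (s.real ra))

/-- `Exec c s s' τ`: started in the memory `s`, the program `c` terminates after exactly `τ`
steps in the memory `s'`. A subroutine call is charged for copying its input and its output. -/
inductive Exec : Program → Mem → Mem → ℕ → Prop
  | skip (s : Mem) : Exec .skip s s 1
  | setNat (s : Mem) (a : ℕ) (i e : NExp) :
      Exec (.setNat a i e) s (s.setNat a (i.eval s) (e.eval s)) (i.cost + e.cost + 1)
  | setReal (s : Mem) (a : ℕ) (i : NExp) (e : RExp) :
      Exec (.setReal a i e) s (s.setReal a (i.eval s) (e.eval s)) (i.cost + e.cost + 1)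
  | emit (s : Mem) (e : NExp) :
      Exec (.emit e) s (s.emit (e.eval s)) (e.cost + 1)
  | seq {c₁ c₂ : Program} {s s₁ s₂ : Mem} {τ₁ τ₂ : ℕ}
      (h₁ : Exec c₁ s s₁ τ₁) (h₂ : Exec c₂ s₁ s₂ τ₂) :
      Exec (.seq c₁ c₂) s s₂ (τ₁ + τ₂)
  | ite_true {b : BExp} {c₁ c₂ : Program} {s s' : Mem} {τ : ℕ}
      (hb : b.Holds s) (h : Exec c₁ s s' τ) :
      Exec (.ite b c₁ c₂) s s' (b.cost + 1 + τ)
  | ite_false {b : BExp} {c₁ c₂ : Program} {s s' : Mem} {τ : ℕ}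
      (hb : ¬ b.Holds s) (h : Exec c₂ s s' τ) :
      Exec (.ite b c₁ c₂) s s' (b.cost + 1 + τ)
  | loop_true {b : BExp} {c : Program} {s s₁ s₂ : Mem} {τ₁ τ₂ : ℕ}
      (hb : b.Holds s) (h₁ : Exec c s s₁ τ₁) (h₂ : Exec (.loop b c) s₁ s₂ τ₂) :
      Exec (.loop b c) s s₂ (b.cost + 1 + τ₁ + τ₂)
  | loop_false {b : BExp} {c : Program} {s : Mem} (hb : ¬ b.Holds s) :
      Exec (.loop b c) s s (b.cost + 1)
  | call {c : Program} {na : ℕ} {nlen : NExp} {ra : ℕ} {rlen : NExp} {dst : ℕ}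
      {s s' : Mem} {τ : ℕ}
      (h : Exec c (s.frame na (nlen.eval s) ra (rlen.eval s)) s' τ) :
      Exec (.call c na nlen ra rlen dst) s (s.storeList dst s'.out)
        (nlen.cost + rlen.cost + nlen.eval s + rlen.eval s + s'.out.length + 1 + τ)

/-! ### Tours and their costs

The vertex set is `Fin n`. A closed walk visiting `v₁, …, v_r, v₁` in this order is given by the
list `[v₁, …, v_r]`. -/

/-- A tour is a closed walk that visits every vertex at least once. -/
def IsTour {n : ℕ} (T : List (Fin n)) : Prop := ∀ v : Fin n, v ∈ T

/-- `∑ i, c (v_i, v_{i + Δ})`, where indices are taken cyclically. -/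
def shiftCost {n : ℕ} (c : Fin n → Fin n → ℝ) (T : List (Fin n)) (Δ : ℕ) : ℝ :=
  ∑ i : Fin T.length, c (T.get i) (T.get ⟨(i + Δ) % T.length, Nat.mod_lt _ i.pos⟩)

/-- The cost of a closed walk. -/
def tourCost {n : ℕ} (c : Fin n → Fin n → ℝ) (T : List (Fin n)) : ℝ :=
  shiftCost c T 1

/-- The `k`-hop cost of a closed walk. -/
def hopCost {n : ℕ} (c : Fin n → Fin n → ℝ) (k : ℕ) (T : List (Fin n)) : ℝ :=
  ∑ Δ ∈ Finset.Icc 1 k, shiftCost c T Δ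

/-- The closed walk that results from `T` by skipping all visits of vertices outside of `A`. -/
def shortcut {n : ℕ} (T : List (Fin n)) (A : Finset (Fin n)) : List (Fin n) :=
  T.filter (fun v => v ∈ A)

/-- The probability that `A` is the set of active vertices, if every vertex `v` is active
independently with probability `p v`. -/
def activeProb {n : ℕ} (p : Fin n → ℝ) (A : Finset (Fin n)) : ℝ :=
  (∏ v ∈ A, p v) * ∏ v ∈ Aᶜ, (1 - p v)

/-- The expected cost of `T` after short-cutting to the random set of active vertices. -/
def expectedCost {n : ℕ} (c : Fin n → Fin n → ℝ) (p : Fin n → ℝ) (T : List (Fin n)) : ℝ :=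
  ∑ A : Finset (Fin n), activeProb p A * tourCost c (shortcut T A)

/-- The cost matrix in row-major order. -/
def costList {n : ℕ} (c : Fin n → Fin n → ℝ) : List ℝ :=
  List.ofFn (fun x : Fin (n * n) => c x.divNat x.modNat)

/-! ### The two problems -/

/-- An instance of Hop-ATSP. -/
structure HopInstance where
  n : ℕ
  c : Fin n → Fin n → ℝ
  k : ℕ
  c_nonneg : ∀ x y, 0 ≤ c x y
  c_triangle : ∀ x y z, c x z ≤ c x y + c y z
  k_lt : k < n

/-- The optimum value, i.e. the minimum `k`-hop cost of a tour. -/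
noncomputable def HopInstance.opt (I : HopInstance) : ℝ :=
  sInf {x | ∃ T : List (Fin I.n), IsTour T ∧ x = hopCost I.c I.k T}

/-- Well-scaled instances: the costs are in `{0, 1, …, 2n³}` and the optimum is at least `n²`. -/
def HopInstance.WellScaled (I : HopInstance) : Prop :=
  (∀ x y, ∃ m : ℕ, m ≤ 2 * I.n ^ 3 ∧ I.c x y = m) ∧ (I.n : ℝ) ^ 2 ≤ I.opt

/-- The initial memory for an instance of Hop-ATSP. -/
noncomputable def HopInstance.input (I : HopInstance) : Mem :=
  Mem.input [I.n, I.k] (costList I.c)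

/-- An instance of Asymmetric A Priori TSP. -/
structure APrioriInstance where
  n : ℕ
  c : Fin n → Fin n → ℝ
  p : Fin n → ℝ
  c_nonneg : ∀ x y, 0 ≤ c x y
  c_triangle : ∀ x y z, c x z ≤ c x y + c y z
  p_nonneg : ∀ v, 0 ≤ p v
  p_le_one : ∀ v, p v ≤ 1

/-- The optimum value, i.e. the minimum expected cost of a tour after short-cutting. -/
noncomputable def APrioriInstance.opt (J : APrioriInstance) : ℝ :=
  sInf {x | ∃ T : List (Fin J.n), IsTour T ∧ x = expectedCost J.c J.p T}

/-- The initial memory for an instance of Asymmetric A Priori TSP. -/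
noncomputable def APrioriInstance.input (J : APrioriInstance) : Mem :=
  Mem.input [J.n] (costList J.c ++ List.ofFn J.p)

/-- Started in the memory `s`, the program `P` terminates within `τ` steps, having written the
closed walk `T` to the output tape. -/
def ComputesWithin (P : Program) (s : Mem) (τ : ℕ) {n : ℕ} (T : List (Fin n)) : Prop :=
  ∃ (s' : Mem) (τ' : ℕ), Exec P s s' τ' ∧ τ' ≤ τ ∧ s'.out = T.map Fin.val

/-- On every well-scaled instance of Hop-ATSP with `n` vertices, `P` computes in time `t n` a
tour whose `k`-hop cost is at most `α n` times the optimum. -/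
def ApproximatesWellScaledHop (P : Program) (α : ℕ → ℝ) (t : ℕ → ℕ) : Prop :=
  ∀ I : HopInstance, I.WellScaled →
    ∃ T : List (Fin I.n), ComputesWithin P I.input (t I.n) T ∧ IsTour T ∧
      hopCost I.c I.k T ≤ α I.n * I.opt

/-- On every instance of Asymmetric A Priori TSP with `n` vertices, `Q` computes in time `t n` a
tour whose expected cost after short-cutting is at most `β n` times the optimum. -/
def ApproximatesAPriori (Q : Program) (β : ℕ → ℝ) (t : ℕ → ℕ) : Prop :=
  ∀ J : APrioriInstance,
    ∃ T : List (Fin J.n), ComputesWithin Q J.input (t J.n) T ∧ IsTour T ∧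
      expectedCost J.c J.p T ≤ β J.n * J.opt

end HopReduction

/-!
An instance `(V, c, p)` of the A Priori TSP is reduced to a single Hop-ATSP instance. Every vertex
`v` gets `⌊2n p(v)⌋` copies, each of which is active with probability `q = 1 / (2n)`. At least one
copy of `v` is active with a probability between `p(v) / 4` and `p(v)` if there is a copy at all,
and such a loss in the probabilities costs a factor of at most `16`, because each edge of a
short-cut tour depends on two visits (`expect_closed_thinning`). For uniform probabilities `q`, the
expected cost of a tour is `q²` times the sum of its shift costs with the geometric weights
`(1 - q) ^ d` (`expect_closed_uniform`). Shift costs are subadditive, so this sum agrees with the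
`2n`-hop cost up to a constant factor (`expect_closed_uniform_le`, `le_expect_closed_uniform`), and
a good hop tour of the copies has small expected cost (`expect_le_of_hop_tour`).

The hop instance becomes well-scaled if the costs are scaled such that the largest distance of two
copies is `N²`, where `N` is the number of copies, and rounded up: every tour has to travel between
the two copies of largest distance, which bounds the optimum from below and makes rounding errors
negligible (`scaledInstance_wellScaled`, `hopCost_le_of_scaled`).

A tour of the copies is turned into a tour of the vertices by the method of conditional
expectations. Two positions of the same vertex are replaced by a single one that is active if one
of them was; the expected cost does not increase for at least one of the two choices of the
remaining position (`expect_merge_le`). Which one it is can be computed, since the expected cost is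
an explicit sum over pairs of positions (`expect_closed_eq_pairSum`).

The vertices without copies are appended in any order. With constant probability none of them is
active, so a detour to an active one, which costs no more than the optimum tour of the active
vertices, is affordable (`expectedCost_append_le`). The same argument shows that every tour without
repetitions is good if there are at most `2n` copies. Self-loops have to be treated separately: they
only matter if a single vertex is active, and then every tour pays for them
(`expectedCost_le_offDiag_add`).

For the running time, programs are analysed by a small Hoare logic with time bounds (`Runs`), in
which the memory that a program leaves alone is read off from its text (`Exec.frame`). Apart from
the call, whose output is copied and scanned once, the time is polynomial in `n`; the part that
depends on the subroutine is at most `55 t(2n²)`. The subroutine is only called if `n ≥ 64`, since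
for smaller `n` every tour without repetitions is a `63`-approximation.
-/

namespace HopReduction

/-! ### Costs of closed walks -/

section Walks

variable {X Y : Type*}

/-- The cost of walking from `a` through the vertices of a list to `b`. -/
def via (c : X → X → ℝ) : X → List X → X → ℝ
  | a, [], b => c a b
  | a, x :: l, b => c a x + via c x l b

/-- The cost of the closed walk that visits the vertices of a list in cyclic order. -/
def closed (c : X → X → ℝ) : List X → ℝ
  | [] => 0
  | a :: l => via c a l a

theorem via_nonneg {c : X → X → ℝ} (h0 : ∀ x y, 0 ≤ c x y) (a : X) (l : List X) (b : X) :
    0 ≤ via c a l b := by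
  induction l generalizing a with
  | nil => exact h0 a b
  | cons x l ih => exact add_nonneg (h0 _ _) (ih x)

theorem closed_nonneg {c : X → X → ℝ} (h0 : ∀ x y, 0 ≤ c x y) (l : List X) : 0 ≤ closed c l := by
  cases l with
  | nil => exact le_rfl
  | cons a l => exact via_nonneg h0 a l a

theorem via_append (c : X → X → ℝ) (a : X) (l : List X) (x : X) (l' : List X) (b : X) :
    via c a (l ++ x :: l') b = via c a l x + via c x l' b := by
  induction l generalizing a with
  | nil => rfl
  | cons y l ih => simp only [List.cons_append, via, ih]; ring

theorem via_skip {c : X → X → ℝ} (h3 : ∀ x y z, c x z ≤ c x y + c y z) (a x : X) (l : List X)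
    (b : X) : via c a l b ≤ c a x + via c x l b := by
  cases l with
  | nil => exact h3 a x b
  | cons y l => simp only [via]; linarith [h3 a x y]

theorem via_sublist {c : X → X → ℝ} (h3 : ∀ x y z, c x z ≤ c x y + c y z) {l' l : List X}
    (h : l'.Sublist l) (a b : X) : via c a l' b ≤ via c a l b := by
  induction h generalizing a with
  | slnil => exact le_rfl
  | cons x _ ih => exact (via_skip h3 a x _ b).trans (by simpa [via] using ih x)
  | cons_cons x _ ih => simpa [via] using ih x

/-- Skipping visits does not make a closed walk more expensive. -/
theorem closed_sublist {c : X → X → ℝ} (h0 : ∀ x y, 0 ≤ c x y)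
    (h3 : ∀ x y z, c x z ≤ c x y + c y z) {l' l : List X}
    (h : l'.Sublist l) : closed c l' ≤ closed c l := by
  induction h with
  | slnil => exact le_rfl
  | @cons l' l x h ih =>
    refine ih.trans ?_
    cases l with
    | nil => exact closed_nonneg h0 [x]
    | cons y l =>
      have h1 : via c y l y ≤ via c y (l ++ [x]) y := via_sublist h3 (by simp) y y
      rw [via_append] at h1
      simp only [closed, via] at h1 ⊢
      linarith
  | @cons_cons l' l x h ih => exact via_sublist h3 h x x

theorem closed_map (c : X → X → ℝ) (f : Y → X) (l : List Y) :
    closed c (l.map f) = closed (fun x y => c (f x) (f y)) l := by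
  have h : ∀ (l : List Y) (a b : Y),
      via c (f a) (l.map f) (f b) = via (fun x y => c (f x) (f y)) a l b := by
    intro l
    induction l with
    | nil => intros; rfl
    | cons x l ih => intro a b; simp [via, ih]
  cases l with
  | nil => rfl
  | cons a l => exact h l a a

/-- A functional on lists that does not see immediate repetitions. -/
def StutterInvariant (F : List X → ℝ) : Prop :=
  ∀ l₁ x l₂, F (l₁ ++ x :: x :: l₂) = F (l₁ ++ x :: l₂)

theorem StutterInvariant.cons {F : List X → ℝ} (h : StutterInvariant F) (x : X) :
    StutterInvariant (fun l => F (x :: l)) := fun l₁ y l₂ => h (x :: l₁) y l₂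

theorem closed_stutterInvariant {c : X → X → ℝ} (hd : ∀ x, c x x = 0) :
    StutterInvariant (closed c) := by
  intro l₁ x l₂
  cases l₁ with
  | nil => simp [closed, via, hd]
  | cons a l => simp [closed, via_append, via, hd]

theorem via_eq_sum (g : X → X → ℝ) (b : X) (l : List X) (a : X) :
    via g a l b = ∑ i ∈ Finset.range (l.length + 1), g ((a :: l).getD i b) (l.getD i b) := by
  induction l generalizing a with
  | nil => simp [via]
  | cons x l ih =>
    rw [List.length_cons, Finset.sum_range_succ', via, ih]
    simp [add_comm]

/-- The cyclic sum over all pairs of visits at distance `Δ`. -/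
theorem shiftCost_eq_sum {n : ℕ} (c : Fin n → Fin n → ℝ) (T : List (Fin n)) (Δ : ℕ) (d : Fin n) :
    shiftCost c T Δ = ∑ i ∈ Finset.range T.length,
      c (T.getD (i % T.length) d) (T.getD ((i + Δ) % T.length) d) := by
  rw [shiftCost, ← Fin.sum_univ_eq_sum_range (fun i => c (T.getD (i % T.length) d)
    (T.getD ((i + Δ) % T.length) d))]
  refine Finset.sum_congr rfl fun i _ => ?_
  have h1 : (i : ℕ) % T.length = i := Nat.mod_eq_of_lt i.2
  have h2 : ((i : ℕ) + Δ) % T.length < T.length := Nat.mod_lt _ i.pos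
  rw [h1, List.getD_eq_getElem _ _ i.2, List.getD_eq_getElem _ _ h2]
  rfl

theorem tourCost_eq_closed {n : ℕ} (c : Fin n → Fin n → ℝ) (T : List (Fin n)) :
    tourCost c T = closed c T := by
  cases T with
  | nil => simp [tourCost, shiftCost, closed]
  | cons a l =>
    rw [tourCost, shiftCost_eq_sum c _ 1 a, closed, via_eq_sum, List.length_cons]
    refine Finset.sum_congr rfl fun i hi => ?_
    have hi' := Finset.mem_range.1 hi
    rw [Nat.mod_eq_of_lt hi']
    congr 1
    rcases Nat.lt_or_ge i l.length with h | h
    · rw [Nat.mod_eq_of_lt (by omega)]; simp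
    · have : i = l.length := by omega
      subst this; simp

/-- A closed walk through two different vertices costs at least as much as going to and fro. -/
theorem go_and_return_le_closed {c : X → X → ℝ} (h0 : ∀ x y, 0 ≤ c x y)
    (h3 : ∀ x y z, c x z ≤ c x y + c y z) {l : List X} {a b : X} (hab : a ≠ b)
    (ha : a ∈ l) (hb : b ∈ l) : c a b + c b a ≤ closed c l := by
  obtain ⟨l₁, l₂, rfl⟩ := List.append_of_mem ha
  rcases List.mem_append.1 hb with h | h
  · refine le_trans (le_of_eq ?_) (closed_sublist h0 h3 (l' := [b, a]) ?_)
    · simp [closed, via, add_comm]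
    · exact (List.singleton_sublist.2 h).append (List.singleton_sublist.2 (by simp))
  · have h' : b ∈ l₂ := by
      rcases List.mem_cons.1 h with h | h
      · exact absurd h.symm hab
      · exact h
    refine le_trans (le_of_eq ?_) (closed_sublist h0 h3 (l' := [a, b]) ?_)
    · simp [closed, via]
    · exact ((List.singleton_sublist.2 h').cons_cons a).trans (List.sublist_append_right _ _)

theorem edge_le_closed {c : X → X → ℝ} (h0 : ∀ x y, 0 ≤ c x y)
    (h3 : ∀ x y z, c x z ≤ c x y + c y z) {l : List X} {a b : X}
    (ha : a ∈ l) (hb : b ∈ l) : c a b ≤ closed c l := by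
  by_cases hab : a = b
  · subst hab
    simpa [closed, via] using closed_sublist h0 h3 (List.singleton_sublist.2 ha)
  · linarith [go_and_return_le_closed h0 h3 hab ha hb, h0 b a]

theorem closed_le_length_mul {c : X → X → ℝ} {l : List X} {B : ℝ}
    (h : ∀ x ∈ l, ∀ y ∈ l, c x y ≤ B) : closed c l ≤ l.length * B := by
  have key : ∀ (l : List X) (a b : X), (∀ x ∈ b :: a :: l, ∀ y ∈ b :: a :: l, c x y ≤ B) →
      via c a l b ≤ (l.length + 1) * B := by
    intro l
    induction l with
    | nil => intro a b h; simpa [via] using h a (by simp) b (by simp)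
    | cons x l ih =>
      intro a b h
      have h1 := ih x b (fun y hy z hz => h y (by simp at hy ⊢; tauto) z (by simp at hz ⊢; tauto))
      have h2 := h a (by simp) x (by simp)
      simp only [via, List.length_cons]; push_cast; linarith
  cases l with
  | nil => simp [closed]
  | cons a l =>
    simpa [closed] using key l a a (fun x hx y hy => h x (by simpa using hx) y (by simpa using hy))

/-- Visiting the vertices of `l` one after the other is at most as expensive as visiting each of
them on a separate excursion from `a`. -/
theorem via_le_excursions {c : X → X → ℝ} (h3 : ∀ x y z, c x z ≤ c x y + c y z) {a : X}
    (ha : c a a = 0) (l : List X) :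
    via c a l a ≤ (l.map fun u => c a u + c u a).sum := by
  induction l with
  | nil => simp [via, ha]
  | cons u l ih =>
    simp only [via, List.map_cons, List.sum_cons]
    linarith [via_skip h3 u a l a]

theorem closed_append_le {c : X → X → ℝ} (h3 : ∀ x y z, c x z ≤ c x y + c y z) {a : X}
    (ha : c a a = 0) (h l : List X) :
    closed c (a :: h ++ l) ≤ closed c (a :: h) + (l.map fun u => c a u + c u a).sum := by
  have h1 : via c a (h ++ l) a ≤ via c a (h ++ a :: l) a := via_sublist h3 (by simp) a a
  rw [via_append] at h1
  simp only [closed, List.cons_append]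
  linarith [via_le_excursions h3 ha l]

end Walks

/-! ### Expectations over random sublists -/

section RandomSublist

variable {X : Type*}

/-- The expectation of `F` at the random sublist that contains each entry `(x, w)` of the list,
independently, with probability `w`. -/
def expect : List (X × ℝ) → (List X → ℝ) → ℝ
  | [], F => F []
  | e :: L, F => e.2 * expect L (fun l => F (e.1 :: l)) + (1 - e.2) * expect L F

/-- All weights of the list are probabilities. -/
def IsProb (L : List (X × ℝ)) : Prop := ∀ e ∈ L, 0 ≤ e.2 ∧ e.2 ≤ 1

/-- A functional on lists that does not increase when entries are skipped. -/
def SublistMono (F : List X → ℝ) : Prop := ∀ l' l, l'.Sublist l → F l' ≤ F l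

theorem SublistMono.cons {F : List X → ℝ} (h : SublistMono F) (x : X) :
    SublistMono (fun l => F (x :: l)) := fun _ _ hl => h _ _ (hl.cons_cons x)

theorem IsProb.tail {e : X × ℝ} {L : List (X × ℝ)} (h : IsProb (e :: L)) : IsProb L :=
  fun f hf => h f (List.mem_cons_of_mem _ hf)

theorem expect_mono {L : List (X × ℝ)} (hL : IsProb L) {F G : List X → ℝ} (h : ∀ l, F l ≤ G l) :
    expect L F ≤ expect L G := by
  induction L generalizing F G with
  | nil => exact h []
  | cons e L ih =>
    have he := hL e (by simp)
    exact add_le_add (mul_le_mul_of_nonneg_left (ih hL.tail fun l => h _) he.1)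
      (mul_le_mul_of_nonneg_left (ih hL.tail h) (by linarith))

theorem expect_const (L : List (X × ℝ)) (a : ℝ) : expect L (fun _ => a) = a := by
  induction L with
  | nil => rfl
  | cons e L ih => simp only [expect, ih]; ring

theorem expect_add (L : List (X × ℝ)) (F G : List X → ℝ) :
    expect L (fun l => F l + G l) = expect L F + expect L G := by
  induction L generalizing F G with
  | nil => rfl
  | cons e L ih => simp only [expect, ih]; ring

theorem expect_le_cons {e : X × ℝ} {L : List (X × ℝ)} (hL : IsProb (e :: L)) {F : List X → ℝ}
    (hF : SublistMono F) : expect L F ≤ expect (e :: L) F := by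
  have he := hL e (by simp)
  have h := expect_mono hL.tail (F := F) (G := fun l => F (e.1 :: l))
    fun l => hF _ _ (List.sublist_cons_self _ _)
  simp only [expect]
  nlinarith

theorem expect_sublist {L' L : List (X × ℝ)} (h : L'.Sublist L) (hL : IsProb L) {F : List X → ℝ}
    (hF : SublistMono F) : expect L' F ≤ expect L F := by
  induction h generalizing F with
  | slnil => exact le_rfl
  | cons e _ ih => exact (ih hL.tail hF).trans (expect_le_cons hL hF)
  | cons_cons e _ ih =>
    have he := hL e (by simp)
    exact add_le_add (mul_le_mul_of_nonneg_left (ih hL.tail (hF.cons _)) he.1)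
      (mul_le_mul_of_nonneg_left (ih hL.tail hF) (by linarith))

/-- Monotonicity in the weights. -/
theorem expect_weight_mono {ι : Type*} (l : List ι) (x : ι → X) {w w' : ι → ℝ}
    (h0 : ∀ i ∈ l, 0 ≤ w i) (h : ∀ i ∈ l, w i ≤ w' i) (h1 : ∀ i ∈ l, w' i ≤ 1)
    {F : List X → ℝ} (hF : SublistMono F) :
    expect (l.map fun i => (x i, w i)) F ≤ expect (l.map fun i => (x i, w' i)) F := by
  induction l generalizing F with
  | nil => exact le_rfl
  | cons i l ih =>
    have a0 := h0 i (by simp)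
    have a1 := h i (by simp)
    have a2 := h1 i (by simp)
    have i1 := ih (fun j hj => h0 j (by simp [hj])) (fun j hj => h j (by simp [hj]))
      (fun j hj => h1 j (by simp [hj])) hF
    have i2 := ih (fun j hj => h0 j (by simp [hj])) (fun j hj => h j (by simp [hj]))
      (fun j hj => h1 j (by simp [hj])) (hF.cons (x i))
    have hP : IsProb (l.map fun i => (x i, w' i)) := by
      intro e he
      obtain ⟨j, hj, rfl⟩ := List.mem_map.1 he
      exact ⟨(h0 j (by simp [hj])).trans (h j (by simp [hj])), h1 j (by simp [hj])⟩
    have i3 := expect_mono hP (F := F) (G := fun l => F (x i :: l))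
      fun l => hF _ _ (List.sublist_cons_self _ _)
    simp only [List.map_cons, expect]
    nlinarith

/-- Entries of weight `0` can be dropped. -/
theorem expect_filter {ι : Type*} (l : List ι) (x : ι → X) (w : ι → ℝ) (P : ι → Prop)
    [DecidablePred P] (h : ∀ i ∈ l, ¬ P i → w i = 0) (F : List X → ℝ) :
    expect (l.map fun i => (x i, w i)) F
      = expect ((l.filter fun i => P i).map fun i => (x i, w i)) F := by
  induction l generalizing F with
  | nil => rfl
  | cons i l ih =>
    have ih' := ih (fun j hj => h j (by simp [hj]))
    by_cases hi : P i
    · simp [hi, expect, ih']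
    · simp [hi, expect, ih', h i (by simp) hi]

/-- Independent copies of `x`, each of weight `q`, act like a single copy of `x` that is present
if at least one of the copies is. -/
theorem expect_replicate_append {F : List X → ℝ} (hF : StutterInvariant F) (x : X) (q : ℝ) (m : ℕ)
    (L : List (X × ℝ)) :
    expect (List.replicate m (x, q) ++ L) F
      = (1 - (1 - q) ^ m) * expect L (fun l => F (x :: l)) + (1 - q) ^ m * expect L F := by
  induction m generalizing F with
  | zero => simp
  | succ m ih =>
    rw [List.replicate_succ, List.cons_append, expect, ih hF, ih (hF.cons x)]
    have : (fun l => F (x :: x :: l)) = fun l => F (x :: l) := by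
      funext l; exact hF [] x l
    rw [this]; ring

theorem expect_flatMap_replicate {F : List X → ℝ} (hF : StutterInvariant F) (q : ℝ) (m : X → ℕ)
    (l : List X) :
    expect (l.flatMap fun x => List.replicate (m x) (x, q)) F
      = expect (l.map fun x => (x, 1 - (1 - q) ^ m x)) F := by
  induction l generalizing F with
  | nil => rfl
  | cons x l ih =>
    rw [List.flatMap_cons, expect_replicate_append hF, ih hF, ih (hF.cons x)]
    simp only [List.map_cons, expect]; ring

/-- The expectation is an affine function of each weight. -/
theorem expect_update_affine (x : ℕ → X) (w : ℕ → ℝ) {N i : ℕ} (hi : i < N) (t : ℝ)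
    (F : List X → ℝ) :
    expect ((List.range N).map fun k => (x k, Function.update w i t k)) F
      = t * expect ((List.range N).map fun k => (x k, Function.update w i 1 k)) F
        + (1 - t) * expect ((List.range N).map fun k => (x k, Function.update w i 0 k)) F := by
  have key : ∀ (L₁ L₂ : List (X × ℝ)) (y : X) (F : List X → ℝ),
      expect (L₁ ++ (y, t) :: L₂) F
        = t * expect (L₁ ++ (y, 1) :: L₂) F + (1 - t) * expect (L₁ ++ (y, 0) :: L₂) F := by
    intro L₁ L₂ y
    induction L₁ with
    | nil => intro F; simp only [List.nil_append, expect]; ring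
    | cons e L ih => intro F; simp only [List.cons_append, expect, ih]; ring
  have split : ∀ s : ℝ, (List.range N).map (fun k => (x k, Function.update w i s k))
      = (List.range i).map (fun k => (x k, w k))
        ++ (x i, s) :: (List.range' (i + 1) (N - (i + 1))).map (fun k => (x k, w k)) := by
    intro s
    have hN : List.range N
        = List.range i ++ i :: List.range' (i + 1) (N - (i + 1)) := by
      have h := List.range'_append_1 (s := 0) (m := i) (n := N - (i + 1) + 1)
      rw [List.range'_succ, zero_add, show i + (N - (i + 1) + 1) = N by omega] at h
      rw [List.range_eq_range', List.range_eq_range', ← h]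
    rw [hN, List.map_append, List.map_cons]
    congr 1
    · refine List.map_congr_left fun k hk => ?_
      rw [Function.update_of_ne (by have := List.mem_range.1 hk; omega)]
    · congr 1
      · simp
      · refine List.map_congr_left fun k hk => ?_
        rw [Function.update_of_ne (by have := List.mem_range'_1.1 hk; omega)]
  rw [split, split, split, key]

/-- Two positions of weights `a` and `b` are merged into one position of weight `a + b - ab`:
at least one of the two ways to do this does not increase the expectation. Drawing both positions
independently and keeping the first one if both are present yields a mixture of the two ways. -/
theorem expect_merge_le {x : ℕ → X} {w : ℕ → ℝ} {N i j : ℕ} (hi : i < N) (hj : j < N)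
    (hij : i ≠ j) (hw : ∀ k < N, 0 ≤ w k ∧ w k ≤ 1) {F : List X → ℝ} (hF : SublistMono F) :
    min (expect ((List.range N).map fun k => (x k,
          Function.update (Function.update w i (w i + w j - w i * w j)) j 0 k)) F)
        (expect ((List.range N).map fun k => (x k,
          Function.update (Function.update w i 0) j (w i + w j - w i * w j) k)) F)
      ≤ expect ((List.range N).map fun k => (x k, w k)) F := by
  set R : ℝ → ℝ → ℝ := fun α β => expect ((List.range N).map fun k => (x k,
    Function.update (Function.update w i α) j β k)) F with hR
  have e2 : ∀ α β, R α β = β * R α 1 + (1 - β) * R α 0 := fun α β =>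
    expect_update_affine x _ hj β F
  have e1 : ∀ α β, R α β = α * R 1 β + (1 - α) * R 0 β := by
    intro α β
    simp only [hR, Function.update_comm hij]
    exact expect_update_affine x _ hi α F
  have hw0 : expect ((List.range N).map fun k => (x k, w k)) F = R (w i) (w j) := by
    simp only [hR]
    rw [Function.update_eq_self_iff.2 rfl, Function.update_eq_self_iff.2 (by simp)]
  have hmono : R 1 0 ≤ R 1 1 := by
    have hb : ∀ β : ℝ, 0 ≤ β → β ≤ 1 → ∀ k < N,
        0 ≤ Function.update (Function.update w i 1) j β k ∧
          Function.update (Function.update w i 1) j β k ≤ 1 := by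
      intro β h0 h1 k hk
      by_cases hkj : k = j
      · subst hkj; simp [h0, h1]
      · by_cases hki : k = i
        · subst hki; simp [hkj]
        · simpa [hkj, hki] using hw k hk
    refine expect_weight_mono (List.range N) x (fun k hk => (hb 0 le_rfl zero_le_one k
      (List.mem_range.1 hk)).1) (fun k hk => ?_) (fun k hk => (hb 1 zero_le_one le_rfl k
      (List.mem_range.1 hk)).2) hF
    by_cases hkj : k = j
    · subst hkj; simp
    · simp [hkj]
  rw [hw0]
  change min (R (w i + w j - w i * w j) 0) (R 0 (w i + w j - w i * w j)) ≤ R (w i) (w j)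
  obtain ⟨a0, a1⟩ := hw i hi
  obtain ⟨b0, b1⟩ := hw j hj
  set a := w i
  set b := w j
  have h1 : R (a + b - a * b) 0 = (a + b - a * b) * R 1 0 + (1 - (a + b - a * b)) * R 0 0 := e1 _ _
  have h2 : R 0 (a + b - a * b) = (a + b - a * b) * R 0 1 + (1 - (a + b - a * b)) * R 0 0 := e2 _ _
  have h3 : R a b = a * (b * R 1 1 + (1 - b) * R 1 0)
      + (1 - a) * (b * R 0 1 + (1 - b) * R 0 0) := by
    rw [e1, e2 1 b, e2 0 b]
  have hs : 0 ≤ a + b - a * b := by nlinarith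
  have hlow : a * R 1 0 + (1 - a) * b * R 0 1 + (1 - a) * (1 - b) * R 0 0 ≤ R a b := by
    rw [h3]; nlinarith [mul_nonneg a0 b0]
  rcases hs.eq_or_lt with hs | hs
  · have ha : a = 0 := by nlinarith
    have hb : b = 0 := by rw [ha] at hs; linarith
    rw [h1, ha, hb]; refine (min_le_left _ _).trans ?_
    rw [ha, hb] at hlow; linarith
  · rcases le_total (R 1 0) (R 0 1) with h | h
    · refine (min_le_left _ _).trans ?_
      rw [h1]
      have : (1 - a) * b * R 1 0 ≤ (1 - a) * b * R 0 1 :=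
        mul_le_mul_of_nonneg_left h (mul_nonneg (by linarith) b0)
      linarith
    · refine (min_le_right _ _).trans ?_
      rw [h2]
      have : a * R 0 1 ≤ a * R 1 0 := mul_le_mul_of_nonneg_left h a0
      linarith

/-! ### Expected cost as a sum over pairs -/

/-- The expected cost of the edge from `a` to the first vertex of a random sublist, or to `b` if
the random sublist is empty. -/
def expectFirst (c : X → X → ℝ) (a : X) : List (X × ℝ) → X → ℝ
  | [], b => c a b
  | e :: L, b => e.2 * c a e.1 + (1 - e.2) * expectFirst c a L b

/-- The sum over the entries `(x, w)` of `L` of `w` times the expected cost of the edge that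
leaves `x`, if the walk is closed cyclically through `pre`. -/
def cyclicSum (c : X → X → ℝ) : List (X × ℝ) → List (X × ℝ) → ℝ
  | _, [] => 0
  | pre, e :: L => e.2 * expectFirst c e.1 (L ++ pre) e.1 + cyclicSum c (pre ++ [e]) L

/-- The same sum if the walk ends in the vertex `b`. -/
def openSum (c : X → X → ℝ) : List (X × ℝ) → X → ℝ
  | [], _ => 0
  | e :: L, b => e.2 * expectFirst c e.1 L b + openSum c L b

theorem expect_via (c : X → X → ℝ) (L : List (X × ℝ)) (a b : X) :
    expect L (fun l => via c a l b) = expectFirst c a L b + openSum c L b := by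
  induction L generalizing a with
  | nil => simp [expect, via, expectFirst, openSum]
  | cons e L ih =>
    simp only [expect, via, expect_add, expect_const, ih, expectFirst, openSum]; ring

theorem expectFirst_append_cons (c : X → X → ℝ) (a b : X) (L L' : List (X × ℝ)) (e : X × ℝ) :
    expectFirst c a (L ++ e :: L') b
      = e.2 * expectFirst c a L e.1 + (1 - e.2) * expectFirst c a (L ++ L') b := by
  induction L with
  | nil => simp [expectFirst]
  | cons f L ih => simp only [List.cons_append, expectFirst, ih]; ring

theorem cyclicSum_cons_left (c : X → X → ℝ) (e : X × ℝ) (pre L : List (X × ℝ)) :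
    cyclicSum c (e :: pre) L = e.2 * openSum c L e.1 + (1 - e.2) * cyclicSum c pre L := by
  induction L generalizing pre with
  | nil => simp [cyclicSum, openSum]
  | cons f L ih =>
    have h := ih (pre ++ [f])
    simp only [cyclicSum, openSum, List.cons_append, expectFirst_append_cons] at h ⊢
    rw [h]; ring

theorem expect_closed (c : X → X → ℝ) (L : List (X × ℝ)) :
    expect L (closed c) = cyclicSum c [] L := by
  induction L with
  | nil => rfl
  | cons e L ih =>
    have h := cyclicSum_cons_left c e [] L
    simp only [expect, closed, expect_via, ih, cyclicSum, List.append_nil, List.nil_append,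
      h]
    ring

theorem expect_closed_map {Y : Type*} (c : X → X → ℝ) (f : Y → X) (l : List Y) (q : ℝ) :
    expect (l.map fun y => (y, q)) (closed fun y z => c (f y) (f z))
      = expect (l.map fun y => (f y, q)) (closed c) := by
  have h : ∀ (l : List Y) (F : List X → ℝ),
      expect (l.map fun y => (y, q)) (fun l => F (l.map f))
        = expect (l.map fun y => (f y, q)) F := by
    intro l
    induction l with
    | nil => intro F; rfl
    | cons y l ih =>
      intro F
      simp only [List.map_cons, expect]
      rw [← ih, ← ih]
  rw [← h]
  congr 1
  funext l
  exact (closed_map c f l).symm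

/-- If all probabilities are decreased by a factor of at most `4`, then the expected cost decreases
by a factor of at most `16`, since every edge depends on the presence of two visits. -/
theorem expect_closed_thinning {c : X → X → ℝ} (h0 : ∀ x y, 0 ≤ c x y) (l : List X)
    {p p' : X → ℝ} (hp' : ∀ x, 0 ≤ p' x) (hle : ∀ x, p' x ≤ p x) (hp : ∀ x, p x ≤ 1)
    (h4 : ∀ x, p x ≤ 4 * p' x) :
    expect (l.map fun x => (x, p x)) (closed c)
      ≤ 16 * expect (l.map fun x => (x, p' x)) (closed c) := by
  have hn : ∀ (l : List X) (a b : X), 0 ≤ expectFirst c a (l.map fun x => (x, p x)) b := by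
    intro l a b
    induction l with
    | nil => exact h0 a b
    | cons x l ih =>
      exact add_nonneg (mul_nonneg ((hp' x).trans (hle x)) (h0 _ _))
        (mul_nonneg (by linarith [hp x]) ih)
  have hf : ∀ (l : List X) (a b : X), 0 ≤ expectFirst c a (l.map fun x => (x, p' x)) b ∧
      expectFirst c a (l.map fun x => (x, p x)) b
        ≤ 4 * expectFirst c a (l.map fun x => (x, p' x)) b := by
    intro l a b
    induction l with
    | nil => simp only [List.map_nil, expectFirst]; constructor <;> linarith [h0 a b]
    | cons x l ih =>
      simp only [List.map_cons, expectFirst]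
      have e1 := hp' x
      have e2 := hle x
      have e3 := hp x
      have e4 := h4 x
      refine ⟨add_nonneg (mul_nonneg e1 (h0 _ _)) (mul_nonneg (by linarith) ih.1), ?_⟩
      have g1 : p x * c a x ≤ 4 * p' x * c a x := mul_le_mul_of_nonneg_right e4 (h0 _ _)
      have g2 : (1 - p x) * expectFirst c a (l.map fun x => (x, p x)) b
          ≤ (1 - p' x) * (4 * expectFirst c a (l.map fun x => (x, p' x)) b) :=
        mul_le_mul (by linarith) ih.2 (hn l a b) (by linarith)
      linarith
  have hz : ∀ (l pre : List X), cyclicSum c (pre.map fun x => (x, p x)) (l.map fun x => (x, p x))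
      ≤ 16 * cyclicSum c (pre.map fun x => (x, p' x)) (l.map fun x => (x, p' x)) := by
    intro l
    induction l with
    | nil => intro pre; simp [cyclicSum]
    | cons x l ih =>
      intro pre
      have h1 := ih (pre ++ [x])
      have h2 := hf (l ++ pre) x x
      simp only [List.map_append, List.map_cons, List.map_nil, cyclicSum] at h1 h2 ⊢
      have h3 := mul_le_mul (h4 x) h2.2 (by simpa using hn (l ++ pre) x x) (by linarith [hp' x])
      linarith
  rw [expect_closed, expect_closed]
  exact hz l []

end RandomSublist

section PairSum

variable {X : Type*}

theorem expectFirst_range (c : X → X → ℝ) (a b : X) (m : ℕ) (y : ℕ → X) (u : ℕ → ℝ) :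
    expectFirst c a ((List.range m).map fun d => (y d, u d)) b
      = ∑ d ∈ Finset.range m, (∏ l ∈ Finset.range d, (1 - u l)) * u d * c a (y d)
        + (∏ l ∈ Finset.range m, (1 - u l)) * c a b := by
  induction m generalizing y u with
  | zero => simp [expectFirst]
  | succ m ih =>
    rw [List.range_succ_eq_map, List.map_cons, List.map_map, expectFirst]
    have h := ih (fun d => y (d + 1)) (fun d => u (d + 1))
    have e : ((fun d => (y d, u d)) ∘ Nat.succ) = fun d => (y (d + 1), u (d + 1)) := rfl
    rw [e, h, Finset.sum_range_succ', Finset.prod_range_succ']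
    simp only [Finset.prod_range_succ', Finset.prod_range_zero, one_mul, mul_add, Finset.mul_sum]
    have h2 : ∀ d, (1 - u 0)
          * ((∏ l ∈ Finset.range d, (1 - u (l + 1))) * u (d + 1) * c a (y (d + 1)))
        = (∏ l ∈ Finset.range d, (1 - u (l + 1))) * (1 - u 0) * u (d + 1) * c a (y (d + 1)) :=
      fun d => by ring
    simp only [h2]; ring

/-- The expected cost of the random closed walk that visits `x 0, …, x (N - 1)` with
probabilities `w 0, …, w (N - 1)`, as a sum over all pairs of consecutive visits. -/
noncomputable def pairSum (c : X → X → ℝ) (x : ℕ → X) (w : ℕ → ℝ) (N : ℕ) : ℝ :=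
  ∑ i ∈ Finset.range N, ∑ d ∈ Finset.range (N - 1),
    (w i * ∏ l ∈ Finset.range d, (1 - w ((i + 1 + l) % N))) * w ((i + 1 + d) % N)
      * c (x i) (x ((i + 1 + d) % N))

theorem expect_closed_eq_pairSum {c : X → X → ℝ} (hd : ∀ x, c x x = 0) (x : ℕ → X) (w : ℕ → ℝ)
    (N : ℕ) :
    expect ((List.range N).map fun i => (x i, w i)) (closed c) = pairSum c x w N := by
  set f : ℕ → X × ℝ := fun i => (x i, w i) with hf
  have hrot : ∀ k < N, (List.range' (k + 1) (N - (k + 1))).map f ++ (List.range k).map f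
      = (List.range (N - 1)).map fun d => f ((k + 1 + d) % N) := by
    intro k hk
    refine List.ext_getElem (by simp; omega) fun d h1 h2 => ?_
    simp only [List.length_map, List.length_range] at h2
    rcases Nat.lt_or_ge d (N - (k + 1)) with h | h
    · rw [List.getElem_append_left (by simpa using h)]
      simp [Nat.mod_eq_of_lt (show k + 1 + d < N by omega)]
    · rw [List.getElem_append_right (by simpa using h)]
      have : (k + 1 + d) % N = d - (N - (k + 1)) := by
        rw [Nat.mod_eq_sub_mod (by omega), Nat.mod_eq_of_lt (by omega)]; omega
      simp [this]
  have hz : ∀ m i, i + m = N → cyclicSum c ((List.range i).map f) ((List.range' i m).map f)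
      = ∑ k ∈ Finset.Ico i N, ∑ d ∈ Finset.range (N - 1),
        (w k * ∏ l ∈ Finset.range d, (1 - w ((k + 1 + l) % N))) * w ((k + 1 + d) % N)
          * c (x k) (x ((k + 1 + d) % N)) := by
    intro m
    induction m with
    | zero => intro i hi; simp [cyclicSum, show i = N by omega]
    | succ m ih =>
      intro i hi
      rw [List.range'_succ, List.map_cons, cyclicSum]
      have h1 : (List.range i).map f ++ [f i] = (List.range (i + 1)).map f := by
        simp [List.range_succ]
      rw [h1, ih (i + 1) (by omega), Finset.sum_eq_sum_Ico_succ_bot (show i < N by omega)]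
      congr 1
      have h2 := hrot i (by omega)
      rw [show N - (i + 1) = m by omega] at h2
      rw [h2, expectFirst_range c _ _ (N - 1) (fun d => x ((i + 1 + d) % N))
        (fun d => w ((i + 1 + d) % N)), hd, mul_zero, add_zero, Finset.mul_sum]
      refine Finset.sum_congr rfl fun d _ => ?_
      simp only [hf]; ring
  have h := hz N 0 (by omega)
  rw [← Finset.range_eq_Ico, ← List.range_eq_range'] at h
  rw [expect_closed, pairSum]
  exact h

end PairSum

/-! ### Uniform probabilities and the hop cost -/

section Uniform

variable {n : ℕ}

theorem shiftCost_nonneg {c : Fin n → Fin n → ℝ} (h0 : ∀ x y, 0 ≤ c x y) (T : List (Fin n))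
    (Δ : ℕ) : 0 ≤ shiftCost c T Δ := Finset.sum_nonneg fun _ _ => h0 _ _

theorem hopCost_nonneg {c : Fin n → Fin n → ℝ} (h0 : ∀ x y, 0 ≤ c x y) (k : ℕ)
    (T : List (Fin n)) : 0 ≤ hopCost c k T := Finset.sum_nonneg fun _ _ => shiftCost_nonneg h0 _ _

theorem sum_range_add_of_periodic {N : ℕ} {g : ℕ → ℝ} (hg : ∀ i, g (i + N) = g i) (a : ℕ) :
    ∑ i ∈ Finset.range N, g (i + a) = ∑ i ∈ Finset.range N, g i := by
  induction a with
  | zero => rfl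
  | succ a ih =>
    rw [← ih]
    have h1 := Finset.sum_range_succ (fun i => g (i + a)) N
    have h2 := Finset.sum_range_succ' (fun i => g (i + a)) N
    have h3 : g (N + a) = g (0 + a) := by rw [add_comm N a, hg, zero_add]
    have h4 : ∀ i, g (i + (a + 1)) = g (i + 1 + a) := fun i => by ring_nf
    simp only [h4]
    linarith

/-- The shift costs are subadditive in the length of the shift. -/
theorem shiftCost_add_le {c : Fin n → Fin n → ℝ} (h3 : ∀ x y z, c x z ≤ c x y + c y z)
    (T : List (Fin n)) (a b : ℕ) : shiftCost c T (a + b) ≤ shiftCost c T a + shiftCost c T b := by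
  cases T with
  | nil => simp [shiftCost]
  | cons d l =>
    set T := d :: l
    set N := T.length
    rw [shiftCost_eq_sum c T _ d, shiftCost_eq_sum c T a d, shiftCost_eq_sum c T b d]
    rw [← sum_range_add_of_periodic (g := fun i => c (T.getD (i % N) d) (T.getD ((i + b) % N) d))
      (fun i => by rw [add_right_comm i N b, Nat.add_mod_right, Nat.add_mod_right]) a,
      ← Finset.sum_add_distrib]
    refine Finset.sum_le_sum fun i _ => ?_
    rw [← add_assoc]
    exact h3 _ _ _

theorem hopCost_eq_sum_range (c : Fin n → Fin n → ℝ) (k : ℕ) (T : List (Fin n)) :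
    hopCost c k T = ∑ d ∈ Finset.range k, shiftCost c T (d + 1) := by
  rw [hopCost, Finset.range_eq_Ico, Finset.sum_Ico_add' (fun d => shiftCost c T d) 0 k 1]
  rfl

/-- The `k`-th shift cost is at most twice the average of the first `k` shift costs. -/
theorem mul_shiftCost_le {c : Fin n → Fin n → ℝ} (h0 : ∀ x y, 0 ≤ c x y)
    (h3 : ∀ x y z, c x z ≤ c x y + c y z) (k : ℕ) (T : List (Fin n)) :
    k * shiftCost c T k ≤ 2 * hopCost c k T := by
  cases k with
  | zero => simp [hopCost]
  | succ k =>
    rw [hopCost_eq_sum_range, Finset.sum_range_succ]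
    have h1 : ∑ d ∈ Finset.range k, shiftCost c T (k + 1)
        ≤ ∑ d ∈ Finset.range k, (shiftCost c T (d + 1) + shiftCost c T (k - 1 - d + 1)) := by
      refine Finset.sum_le_sum fun d hd => ?_
      have := Finset.mem_range.1 hd
      rw [show k + 1 = (d + 1) + (k - 1 - d + 1) by omega]
      exact shiftCost_add_le h3 _ _ _
    rw [Finset.sum_add_distrib, Finset.sum_range_reflect (fun d => shiftCost c T (d + 1)) k,
      Finset.sum_const, Finset.card_range, nsmul_eq_mul] at h1
    push_cast
    linarith [shiftCost_nonneg h0 T (k + 1)]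

/-- A geometric sum of shift costs is bounded by the hop cost, if the weights decrease by a factor
of two over every `k` steps. -/
theorem geom_sum_shiftCost_le {c : Fin n → Fin n → ℝ} (h0 : ∀ x y, 0 ≤ c x y)
    (h3 : ∀ x y z, c x z ≤ c x y + c y z) {k : ℕ} {q : ℝ} (hq0 : 0 ≤ 1 - q)
    (hq1 : 0 < q) (hkq : k * q = 1) (hk : (1 - q) ^ k ≤ 1 / 2) (T : List (Fin n)) (R : ℕ) :
    ∑ d ∈ Finset.range R, (1 - q) ^ d * shiftCost c T (d + 1) ≤ 4 * hopCost c k T := by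
  set y := 1 - q with hy
  set S := ∑ d ∈ Finset.range R, y ^ d * shiftCost c T (d + 1) with hS
  have hterm : ∀ d, 0 ≤ y ^ d * shiftCost c T (d + 1) := fun d =>
    mul_nonneg (pow_nonneg hq0 d) (shiftCost_nonneg h0 _ _)
  have hy1 : y ≤ 1 := by linarith
  have hgeom : ∑ d ∈ Finset.range R, y ^ d ≤ k := by
    have := geom_sum_mul y R
    have h2 : 0 ≤ y ^ R := pow_nonneg hq0 R
    have h3 : (∑ d ∈ Finset.range R, y ^ d) * q ≤ k * q := by rw [hkq]; rw [hy] at *; linarith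
    exact le_of_mul_le_mul_right h3 hq1
  have hmul := mul_shiftCost_le h0 h3 k T
  have h1 : ∑ d ∈ Finset.range (k + R), y ^ d * shiftCost c T (d + 1)
      ≤ hopCost c k T + y ^ k * (S + k * shiftCost c T k) := by
    rw [Finset.sum_range_add, hopCost_eq_sum_range]
    refine add_le_add (Finset.sum_le_sum fun d _ => ?_) ?_
    · exact mul_le_of_le_one_left (shiftCost_nonneg h0 _ _) (pow_le_one₀ hq0 hy1)
    · calc ∑ d ∈ Finset.range R, y ^ (k + d) * shiftCost c T (k + d + 1)
          ≤ ∑ d ∈ Finset.range R,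
            y ^ k * (y ^ d * shiftCost c T (d + 1) + y ^ d * shiftCost c T k) := by
            refine Finset.sum_le_sum fun d _ => ?_
            rw [pow_add, mul_assoc, ← mul_add (y ^ d)]
            refine mul_le_mul_of_nonneg_left (mul_le_mul_of_nonneg_left ?_ (pow_nonneg hq0 d))
              (pow_nonneg hq0 k)
            rw [show k + d + 1 = d + 1 + k by ring]
            exact shiftCost_add_le h3 _ _ _
        _ = y ^ k * (S + (∑ d ∈ Finset.range R, y ^ d) * shiftCost c T k) := by
            rw [← Finset.mul_sum, Finset.sum_add_distrib, Finset.sum_mul]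
        _ ≤ _ := mul_le_mul_of_nonneg_left (by
            have := mul_le_mul_of_nonneg_right hgeom (shiftCost_nonneg h0 T k)
            linarith) (pow_nonneg hq0 k)
  have h2 : S ≤ ∑ d ∈ Finset.range (k + R), y ^ d * shiftCost c T (d + 1) :=
    Finset.sum_le_sum_of_subset_of_nonneg (Finset.range_mono (by omega)) fun d _ _ => hterm d
  have hSn : 0 ≤ S + k * shiftCost c T k := add_nonneg (Finset.sum_nonneg fun d _ => hterm d)
    (mul_nonneg (Nat.cast_nonneg k) (shiftCost_nonneg h0 _ _))
  have h4 := mul_le_mul_of_nonneg_right hk hSn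
  linarith

/-- For uniform probabilities the expected cost is a geometric sum of shift costs. -/
theorem expect_closed_uniform {c : Fin n → Fin n → ℝ} (hd : ∀ x, c x x = 0) (T : List (Fin n))
    (q : ℝ) :
    expect (T.map fun x => (x, q)) (closed c)
      = q ^ 2 * ∑ d ∈ Finset.range (T.length - 1), (1 - q) ^ d * shiftCost c T (d + 1) := by
  cases T with
  | nil => simp [expect, closed]
  | cons a l =>
    set T := a :: l with hT
    have h1 : T.map (fun x => (x, q)) = (List.range T.length).map fun i => (T.getD i a, q) := by
      refine List.ext_getElem (by simp) fun i h1 h2 => ?_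
      simp only [List.length_map] at h1
      simp [List.getElem?_eq_getElem h1]
    rw [h1, expect_closed_eq_pairSum hd (fun i => T.getD i a) (fun _ => q), pairSum,
      Finset.sum_comm, Finset.mul_sum]
    refine Finset.sum_congr rfl fun d _ => ?_
    rw [shiftCost_eq_sum c T _ a, Finset.mul_sum, Finset.mul_sum]
    refine Finset.sum_congr rfl fun i hi => ?_
    rw [Nat.mod_eq_of_lt (Finset.mem_range.1 hi)]
    simp only [Finset.prod_const, Finset.card_range]
    rw [show i + 1 + d = i + (d + 1) by ring]
    ring

theorem expect_closed_uniform_le {c : Fin n → Fin n → ℝ} (h0 : ∀ x y, 0 ≤ c x y)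
    (h3 : ∀ x y z, c x z ≤ c x y + c y z) (hd : ∀ x, c x x = 0) {k : ℕ} {q : ℝ}
    (hq0 : 0 ≤ 1 - q) (hq1 : 0 < q) (hkq : k * q = 1) (hk : (1 - q) ^ k ≤ 1 / 2)
    (T : List (Fin n)) :
    expect (T.map fun x => (x, q)) (closed c) ≤ 4 * q ^ 2 * hopCost c k T := by
  rw [expect_closed_uniform hd]
  have := geom_sum_shiftCost_le h0 h3 hq0 hq1 hkq hk T (T.length - 1)
  nlinarith [sq_nonneg q]

/-- The first `k` geometric weights are at least `1 / 4`, and all of the first `k` shifts occur in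
the expected cost since the tour has more than `k` visits. -/
theorem le_expect_closed_uniform {c : Fin n → Fin n → ℝ} (h0 : ∀ x y, 0 ≤ c x y)
    (hd : ∀ x, c x x = 0) {k : ℕ} {q : ℝ}
    (hq0 : 0 ≤ 1 - q) (hq1 : 0 ≤ q) (hk : 1 / 4 ≤ (1 - q) ^ k) {T : List (Fin n)}
    (hT : k < T.length) :
    q ^ 2 * hopCost c k T ≤ 4 * expect (T.map fun x => (x, q)) (closed c) := by
  rw [expect_closed_uniform hd, hopCost_eq_sum_range]
  have h1 : ∑ d ∈ Finset.range k, (1 - q) ^ d * shiftCost c T (d + 1)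
      ≤ ∑ d ∈ Finset.range (T.length - 1), (1 - q) ^ d * shiftCost c T (d + 1) :=
    Finset.sum_le_sum_of_subset_of_nonneg (Finset.range_mono (by omega)) fun d _ _ =>
      mul_nonneg (pow_nonneg hq0 d) (shiftCost_nonneg h0 _ _)
  have h2 : ∑ d ∈ Finset.range k, 1 / 4 * shiftCost c T (d + 1)
      ≤ ∑ d ∈ Finset.range k, (1 - q) ^ d * shiftCost c T (d + 1) := by
    refine Finset.sum_le_sum fun d hd => mul_le_mul_of_nonneg_right (hk.trans ?_)
      (shiftCost_nonneg h0 _ _)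
    exact pow_le_pow_of_le_one hq0 (by linarith) (Finset.mem_range.1 hd).le
  rw [← Finset.mul_sum] at h2
  nlinarith [sq_nonneg q]

end Uniform

/-! ### Random sets of active vertices -/

section Active

variable {n : ℕ}

theorem activeProb_nonneg {p : Fin n → ℝ} (h0 : ∀ v, 0 ≤ p v) (h1 : ∀ v, p v ≤ 1)
    (A : Finset (Fin n)) : 0 ≤ activeProb p A :=
  mul_nonneg (Finset.prod_nonneg fun v _ => h0 v)
    (Finset.prod_nonneg fun v _ => by linarith [h1 v])

/-- Conditioning on whether the vertex `u` is active. -/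
theorem sum_activeProb_split (p : Fin n → ℝ) (u : Fin n) (G : Finset (Fin n) → ℝ) :
    ∑ A, activeProb p A * G A
      = p u * ∑ A, activeProb p A * G (insert u A)
        + (1 - p u) * ∑ A, activeProb p A * G (A.erase u) := by
  set R : Finset (Fin n) → ℝ := fun A =>
    (∏ v ∈ A, p v) * ∏ v ∈ (insert u A)ᶜ, (1 - p v) with hR
  have hsplit : ∀ H : Finset (Fin n) → ℝ, ∑ A, H A
      = ∑ A ∈ (Finset.univ.erase u).powerset, (H A + H (insert u A)) := by
    intro H
    rw [Finset.sum_add_distrib, ← Finset.sum_powerset_insert (Finset.notMem_erase u _)]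
    congr 1
    rw [Finset.insert_erase (Finset.mem_univ u)]
    simp
  have hw0 : ∀ A ∈ (Finset.univ.erase u).powerset, activeProb p A = (1 - p u) * R A := by
    intro A hA
    have hu : u ∉ A := fun h => by simpa using Finset.mem_powerset.1 hA h
    have : Aᶜ = insert u (insert u A)ᶜ := by
      ext v; simp only [Finset.mem_compl, Finset.mem_insert]
      by_cases hv : v = u <;> simp [hv, hu]
    rw [activeProb, this, Finset.prod_insert (by simp)]
    simp only [hR]; ring
  have hw1 : ∀ A ∈ (Finset.univ.erase u).powerset, activeProb p (insert u A) = p u * R A := by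
    intro A hA
    have hu : u ∉ A := fun h => by simpa using Finset.mem_powerset.1 hA h
    rw [activeProb, Finset.prod_insert hu]
    simp only [hR]; ring
  rw [hsplit, hsplit (fun A => activeProb p A * G (insert u A)),
    hsplit (fun A => activeProb p A * G (A.erase u)), Finset.mul_sum, Finset.mul_sum,
    ← Finset.sum_add_distrib]
  refine Finset.sum_congr rfl fun A hA => ?_
  have hu : u ∉ A := fun h => by simpa using Finset.mem_powerset.1 hA h
  rw [hw0 A hA, hw1 A hA]
  simp only [Finset.insert_idem, Finset.erase_insert hu, Finset.erase_eq_of_notMem hu]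
  ring

theorem sum_activeProb (p : Fin n → ℝ) : ∑ A, activeProb p A = 1 := by
  have := Finset.prod_add p (fun v => 1 - p v) Finset.univ
  simp only [add_sub_cancel, Finset.prod_const_one] at this
  rw [this]
  simp [activeProb, Finset.compl_eq_univ_sdiff]

/-- For a tour without repetitions, short-cutting to the active vertices amounts to drawing a random
sublist. -/
theorem sum_activeProb_filter (p : Fin n → ℝ) {T : List (Fin n)} (hT : T.Nodup)
    (F : List (Fin n) → ℝ) :
    ∑ A, activeProb p A * F (shortcut T A) = expect (T.map fun v => (v, p v)) F := by
  induction T generalizing F with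
  | nil => simp [shortcut, expect, ← Finset.sum_mul, sum_activeProb]
  | cons u T ih =>
    obtain ⟨hu, hT⟩ := List.nodup_cons.1 hT
    rw [sum_activeProb_split p u, List.map_cons, expect, ← ih hT, ← ih hT]
    have h1 : ∀ A, shortcut (u :: T) (insert u A) = u :: shortcut T A := by
      intro A
      rw [shortcut, List.filter_cons_of_pos (by simp)]
      congr 1
      refine List.filter_congr fun v hv => ?_
      have : v ≠ u := fun h => hu (h ▸ hv)
      simp [this]
    have h2 : ∀ A, shortcut (u :: T) (A.erase u) = shortcut T A := by
      intro A
      rw [shortcut, List.filter_cons_of_neg (by simp)]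
      refine List.filter_congr fun v hv => ?_
      have : v ≠ u := fun h => hu (h ▸ hv)
      simp [this]
    simp only [h1, h2]

theorem expectedCost_eq_expect (c : Fin n → Fin n → ℝ) (p : Fin n → ℝ) {T : List (Fin n)}
    (hT : T.Nodup) : expectedCost c p T = expect (T.map fun v => (v, p v)) (closed c) := by
  simp only [expectedCost, tourCost_eq_closed]
  exact sum_activeProb_filter p hT (closed c)

theorem expectedCost_nonneg {c : Fin n → Fin n → ℝ} (hc : ∀ x y, 0 ≤ c x y) {p : Fin n → ℝ}
    (h0 : ∀ v, 0 ≤ p v) (h1 : ∀ v, p v ≤ 1) (T : List (Fin n)) : 0 ≤ expectedCost c p T :=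
  Finset.sum_nonneg fun A _ => mul_nonneg (activeProb_nonneg h0 h1 A)
    (by rw [tourCost_eq_closed]; exact closed_nonneg hc _)

theorem expectedCost_mono {c c' : Fin n → Fin n → ℝ} {p : Fin n → ℝ}
    (h0 : ∀ v, 0 ≤ p v) (h1 : ∀ v, p v ≤ 1) {T T' : List (Fin n)}
    (h : ∀ A, closed c (shortcut T A) ≤ closed c' (shortcut T' A)) :
    expectedCost c p T ≤ expectedCost c' p T' :=
  Finset.sum_le_sum fun A _ => mul_le_mul_of_nonneg_left
    (by simpa only [tourCost_eq_closed] using h A) (activeProb_nonneg h0 h1 A)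

/-! ### Vertices of small total probability -/

/-- The sum of `G` over all subsets of `A` that arise by removing elements of the list `L`. -/
def subsetSum (G : Finset (Fin n) → ℝ) : List (Fin n) → Finset (Fin n) → ℝ
  | [], A => G A
  | u :: L, A => subsetSum G L A + if u ∈ A then subsetSum G L (A.erase u) else 0

theorem subsetSum_nonneg {G : Finset (Fin n) → ℝ} (hG : ∀ A, 0 ≤ G A) (L : List (Fin n))
    (A : Finset (Fin n)) : 0 ≤ subsetSum G L A := by
  induction L generalizing A with
  | nil => exact hG A
  | cons u L ih =>
    rw [subsetSum]
    split_ifs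
    · exact add_nonneg (ih _) (ih _)
    · simpa using ih A

/-- In expectation, the sum over all subsets is hardly larger than the single value at the random
set itself, if it is likely that no element of `L` is active. -/
theorem sum_activeProb_subsetSum_le {p : Fin n → ℝ} (h0 : ∀ v, 0 ≤ p v) (h1 : ∀ v, p v ≤ 1)
    {G : Finset (Fin n) → ℝ} (hG : ∀ A, 0 ≤ G A) (L : List (Fin n)) :
    (L.map fun v => 1 - p v).prod * ∑ A, activeProb p A * subsetSum G L A
      ≤ ∑ A, activeProb p A * G A := by
  induction L with
  | nil => simp [subsetSum]
  | cons u L ih =>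
    refine le_trans ?_ ih
    have hprod : 0 ≤ (L.map fun v => 1 - p v).prod := by
      refine List.prod_nonneg fun x hx => ?_
      obtain ⟨v, _, rfl⟩ := List.mem_map.1 hx
      linarith [h1 v]
    rw [List.map_cons, List.prod_cons, mul_comm (1 - p u), mul_assoc]
    refine mul_le_mul_of_nonneg_left ?_ hprod
    set g := subsetSum G L with hg
    have hgn : ∀ A, 0 ≤ g A := subsetSum_nonneg hG L
    have e1 := sum_activeProb_split p u g
    have e2 := sum_activeProb_split p u (fun A => if u ∈ A then g (A.erase u) else 0)
    have e3 : ∀ A : Finset (Fin n), g ((insert u A).erase u) = g (A.erase u) := by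
      intro A; congr 1; ext v; simp only [Finset.mem_erase, Finset.mem_insert]; tauto
    simp only [Finset.mem_insert_self, if_true, e3, Finset.mem_erase, ne_eq, not_true_eq_false,
      false_and, if_false, mul_zero, Finset.sum_const_zero, add_zero] at e2
    have e4 : ∑ A, activeProb p A * subsetSum G (u :: L) A
        = ∑ A, activeProb p A * g A
          + ∑ A, activeProb p A * (if u ∈ A then g (A.erase u) else 0) := by
      rw [← Finset.sum_add_distrib]
      exact Finset.sum_congr rfl fun A _ => by rw [subsetSum, mul_add]
    rw [e4, e2]
    have hE : 0 ≤ ∑ A, activeProb p A * g (insert u A) :=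
      Finset.sum_nonneg fun A _ => mul_nonneg (activeProb_nonneg h0 h1 A) (hgn _)
    have := mul_nonneg (h0 u) hE
    have := mul_nonneg (h0 u) this
    nlinarith [h0 u, h1 u]

theorem le_subsetSum {G : Finset (Fin n) → ℝ} (hG : ∀ A, 0 ≤ G A) (L : List (Fin n))
    (A : Finset (Fin n)) : G (A \ L.toFinset) ≤ subsetSum G L A := by
  induction L generalizing A with
  | nil => simp [subsetSum]
  | cons u L ih =>
    rw [subsetSum]
    by_cases hu : u ∈ A
    · rw [if_pos hu]
      have h : A \ (u :: L).toFinset = A.erase u \ L.toFinset := by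
        ext v; simp only [List.toFinset_cons, Finset.mem_sdiff, Finset.mem_insert, Finset.mem_erase]
        tauto
      rw [h]
      linarith [ih (A.erase u), subsetSum_nonneg hG L A]
    · have h : A \ (u :: L).toFinset = A \ L.toFinset := by
        ext v; simp only [List.toFinset_cons, Finset.mem_sdiff, Finset.mem_insert]
        constructor
        · tauto
        · rintro ⟨h1, h2⟩; exact ⟨h1, fun h => h.elim (fun h => hu (h ▸ h1)) h2⟩
      rw [if_neg hu, h]
      linarith [ih A]

/-- The subsets with exactly one element of `L` contribute to the sum. -/
theorem sum_singletons_le_subsetSum {G : Finset (Fin n) → ℝ} (hG : ∀ A, 0 ≤ G A)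
    {L : List (Fin n)} (hL : L.Nodup) (A : Finset (Fin n)) :
    ((L.filter fun v => v ∈ A).map fun u => G (insert u (A \ L.toFinset))).sum
      ≤ subsetSum G L A := by
  induction L generalizing A with
  | nil => simpa [subsetSum] using hG A
  | cons u L ih =>
    obtain ⟨huL, hL⟩ := List.nodup_cons.1 hL
    rw [subsetSum]
    by_cases hu : u ∈ A
    · have h1 : insert u (A \ (u :: L).toFinset) = A \ L.toFinset := by
        ext v
        simp only [List.toFinset_cons, Finset.mem_sdiff, Finset.mem_insert, List.mem_toFinset]
        by_cases hv : v = u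
        · subst hv; simp [hu, huL]
        · simp [hv]
      have h2 : A \ (u :: L).toFinset = A.erase u \ L.toFinset := by
        ext v; simp only [List.toFinset_cons, Finset.mem_sdiff, Finset.mem_insert, Finset.mem_erase]
        tauto
      have h3 : L.filter (fun v => v ∈ A) = L.filter (fun v => v ∈ A.erase u) := by
        refine List.filter_congr fun v hv => ?_
        have : v ≠ u := fun h => huL (h ▸ hv)
        simp [this]
      rw [if_pos hu, List.filter_cons_of_pos (by simpa using hu), List.map_cons, List.sum_cons, h1,
        h2, h3]
      exact add_le_add (le_subsetSum hG L A) (ih hL _)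
    · have h : A \ (u :: L).toFinset = A \ L.toFinset := by
        ext v; simp only [List.toFinset_cons, Finset.mem_sdiff, Finset.mem_insert]
        constructor
        · tauto
        · rintro ⟨h1, h2⟩; exact ⟨h1, fun h => h.elim (fun h => hu (h ▸ h1)) h2⟩
      rw [if_neg hu, List.filter_cons_of_neg (by simpa using hu), h, add_zero]
      exact ih hL A

/-- The subsets with exactly two elements, one of which is the first active element of `L`,
contribute to the sum. -/
theorem sum_pairs_le_subsetSum {G : Finset (Fin n) → ℝ} (hG : ∀ A, 0 ≤ G A)
    {L : List (Fin n)} (hL : L.Nodup) {A : Finset (Fin n)} (hA : A ⊆ L.toFinset) {a : Fin n}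
    {l : List (Fin n)} (hl : L.filter (fun v => v ∈ A) = a :: l) :
    (l.map fun u => G {u, a}).sum ≤ subsetSum G L A := by
  induction L with
  | nil => simp at hl
  | cons u L ih =>
    obtain ⟨huL, hL⟩ := List.nodup_cons.1 hL
    rw [subsetSum]
    by_cases hu : u ∈ A
    · rw [List.filter_cons_of_pos (by simpa using hu), List.cons.injEq] at hl
      obtain ⟨rfl, rfl⟩ := hl
      have h1 : A \ L.toFinset = {u} := by
        ext v
        have := @hA v
        simp only [List.toFinset_cons, Finset.mem_insert] at this
        simp only [Finset.mem_sdiff, Finset.mem_singleton]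
        constructor
        · tauto
        · rintro rfl; exact ⟨hu, by simpa using huL⟩
      have h2 := sum_singletons_le_subsetSum hG hL A
      rw [h1] at h2
      rw [if_pos hu]
      linarith [subsetSum_nonneg hG L (A.erase u)]
    · rw [List.filter_cons_of_neg (by simpa using hu)] at hl
      have hA' : A ⊆ L.toFinset := by
        intro v hv
        have := hA hv
        rw [List.toFinset_cons, Finset.mem_insert] at this
        exact this.resolve_left fun h => hu (h ▸ hv)
      rw [if_neg hu]
      linarith [ih hL hA' hl]

/-- Vertices of small total probability can be appended to a tour of the other vertices in any
order: if one of them is active, then the detour is no more expensive than an optimum tour. -/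
theorem expectedCost_append_le {c : Fin n → Fin n → ℝ} (hc : ∀ x y, 0 ≤ c x y)
    (h3 : ∀ x y z, c x z ≤ c x y + c y z) (hd : ∀ x, c x x = 0) {p : Fin n → ℝ}
    (h0 : ∀ v, 0 ≤ p v) (h1 : ∀ v, p v ≤ 1) {TH TL T : List (Fin n)}
    (hnd : (TH ++ TL).Nodup) (hall : IsTour (TH ++ TL)) (hT : IsTour T) :
    (TL.map fun v => 1 - p v).prod * expectedCost c p (TH ++ TL)
      ≤ (TL.map fun v => 1 - p v).prod * expectedCost c p TH + expectedCost c p T := by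
  set G : Finset (Fin n) → ℝ := fun A => closed c (shortcut T A) with hGdef
  have hG : ∀ A, 0 ≤ G A := fun A => closed_nonneg hc _
  have hndL : TL.Nodup := (List.nodup_append.1 hnd).2.1
  have hpair : ∀ (B : Finset (Fin n)) (a u : Fin n), a ≠ u → a ∈ B → u ∈ B →
      c a u + c u a ≤ G B := fun B a u hau ha hu =>
    go_and_return_le_closed hc h3 hau (by simp [shortcut, ha, hT a]) (by simp [shortcut, hu, hT u])
  have hpt : ∀ A, closed c (shortcut (TH ++ TL) A)
      ≤ closed c (shortcut TH A) + subsetSum G TL A := by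
    intro A
    have hsplit : shortcut (TH ++ TL) A = shortcut TH A ++ TL.filter fun v => v ∈ A := by
      simp [shortcut]
    rw [hsplit]
    cases hh : shortcut TH A with
    | nil =>
      have hA : A ⊆ TL.toFinset := by
        intro v hv
        rcases List.mem_append.1 (hall v) with h | h
        · have : v ∈ shortcut TH A := by simp [shortcut, h, hv]
          simp [hh] at this
        · simpa using h
      cases hl : TL.filter (fun v => v ∈ A) with
      | nil => simpa [closed] using subsetSum_nonneg hG TL A
      | cons a l =>
        have hnl : (a :: l).Nodup := hl ▸ hndL.filter _
        have e1 := via_le_excursions h3 (hd a) l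
        have e2 := sum_pairs_le_subsetSum hG hndL hA hl
        have e4 : (l.map fun u => c a u + c u a).sum ≤ (l.map fun u => G {u, a}).sum := by
          refine List.sum_le_sum fun u hu => hpair _ _ _ ?_ (by simp) (by simp)
          rintro rfl
          exact (List.nodup_cons.1 hnl).1 hu
        simp only [List.nil_append, closed]
        linarith
    | cons a h =>
      have haH : a ∈ shortcut TH A := by simp [hh]
      simp only [shortcut, List.mem_filter, decide_eq_true_eq] at haH
      have haL : a ∉ TL := fun h => (List.nodup_append.1 hnd).2.2 a haH.1 a h rfl
      have e1 := closed_append_le h3 (hd a) h (TL.filter fun v => v ∈ A)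
      have e2 := sum_singletons_le_subsetSum hG hndL A
      have e4 : ((TL.filter fun v => v ∈ A).map fun u => c a u + c u a).sum
          ≤ ((TL.filter fun v => v ∈ A).map fun u => G (insert u (A \ TL.toFinset))).sum := by
        refine List.sum_le_sum fun u hu => hpair _ _ _ ?_ (by simp [haH.2, haL]) (by simp)
        rintro rfl
        exact haL (List.mem_of_mem_filter hu)
      linarith
  have hsum : expectedCost c p (TH ++ TL)
      ≤ expectedCost c p TH + ∑ A, activeProb p A * subsetSum G TL A := by
    simp only [expectedCost, tourCost_eq_closed, ← Finset.sum_add_distrib, ← mul_add]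
    exact Finset.sum_le_sum fun A _ =>
      mul_le_mul_of_nonneg_left (hpt A) (activeProb_nonneg h0 h1 A)
  have hprod : 0 ≤ (TL.map fun v => 1 - p v).prod := by
    refine List.prod_nonneg fun x hx => ?_
    obtain ⟨v, _, rfl⟩ := List.mem_map.1 hx
    linarith [h1 v]
  have hS := sum_activeProb_subsetSum_le h0 h1 hG TL
  have hGT : ∑ A, activeProb p A * G A = expectedCost c p T := by
    simp only [expectedCost, tourCost_eq_closed, hGdef]
  have := mul_le_mul_of_nonneg_left hsum hprod
  linarith

end Active

/-! ### Self-loops, repetitions and small instances -/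

section Basic

variable {n : ℕ}

/-- The cost function with all self-loops made free. -/
def offDiag (c : Fin n → Fin n → ℝ) (x y : Fin n) : ℝ := if x = y then 0 else c x y

theorem offDiag_self (c : Fin n → Fin n → ℝ) (x : Fin n) : offDiag c x x = 0 := by simp [offDiag]

theorem offDiag_nonneg {c : Fin n → Fin n → ℝ} (h0 : ∀ x y, 0 ≤ c x y) (x y : Fin n) :
    0 ≤ offDiag c x y := by
  unfold offDiag; split_ifs
  · exact le_rfl
  · exact h0 x y

theorem offDiag_le {c : Fin n → Fin n → ℝ} (h0 : ∀ x y, 0 ≤ c x y) (x y : Fin n) :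
    offDiag c x y ≤ c x y := by
  unfold offDiag; split_ifs
  · exact h0 x y
  · exact le_rfl

theorem offDiag_triangle {c : Fin n → Fin n → ℝ} (h0 : ∀ x y, 0 ≤ c x y)
    (h3 : ∀ x y z, c x z ≤ c x y + c y z) (x y z : Fin n) :
    offDiag c x z ≤ offDiag c x y + offDiag c y z := by
  by_cases hxz : x = z
  · subst hxz
    rw [offDiag_self]
    exact add_nonneg (offDiag_nonneg h0 _ _) (offDiag_nonneg h0 _ _)
  · by_cases hxy : x = y
    · subst hxy; simp [offDiag_self]
    · by_cases hyz : y = z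
      · subst hyz; simp [offDiag_self]
      · simpa [offDiag, hxy, hyz, hxz] using h3 x y z

theorem via_mono {X : Type*} {c c' : X → X → ℝ} (h : ∀ x y, c x y ≤ c' x y) (a : X) (l : List X)
    (b : X) : via c a l b ≤ via c' a l b := by
  induction l generalizing a with
  | nil => exact h a b
  | cons x l ih => exact add_le_add (h a x) (ih x)

theorem closed_mono {X : Type*} {c c' : X → X → ℝ} (h : ∀ x y, c x y ≤ c' x y) (l : List X) :
    closed c l ≤ closed c' l := by
  cases l with
  | nil => exact le_rfl
  | cons a l => exact via_mono h a l a

/-- Self-loops only matter for closed walks that visit a single vertex. -/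
theorem closed_offDiag {c : Fin n → Fin n → ℝ} {l : List (Fin n)} (hl : l.Nodup)
    (h1 : l.length ≠ 1) : closed c l = closed (offDiag c) l := by
  have key : ∀ (l : List (Fin n)) (a b : Fin n), (a :: (l ++ [b])).IsChain (· ≠ ·) →
      via c a l b = via (offDiag c) a l b := by
    intro l
    induction l with
    | nil => intro a b h; simp at h; simp [via, offDiag, h]
    | cons x l ih =>
      intro a b h
      simp only [List.cons_append, List.isChain_cons_cons] at h
      rw [via, via, ih x b h.2, offDiag, if_neg h.1]
  cases l with
  | nil => rfl
  | cons a l =>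
    refine key l a a ?_
    have hne : l ≠ [] := by rintro rfl; simp at h1
    have h2 : (a :: l).IsChain (· ≠ ·) := (show List.Pairwise (· ≠ ·) (a :: l) from hl).isChain
    rw [← List.cons_append, List.isChain_append]
    refine ⟨h2, by simp, ?_⟩
    intro x hx y hy
    simp only [List.head?_cons, Option.mem_def, Option.some.injEq] at hy
    subst hy
    rw [List.getLast?_cons_of_ne_nil hne] at hx
    have := List.mem_of_getLast? hx
    rintro rfl
    exact (List.nodup_cons.1 hl).1 this

/-- Every tour has to pay for the self-loops that a tour without repetitions pays for. -/
theorem closed_le_offDiag_add {c : Fin n → Fin n → ℝ} (h0 : ∀ x y, 0 ≤ c x y)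
    (h3 : ∀ x y z, c x z ≤ c x y + c y z) {l l' : List (Fin n)} (hl : l.Nodup)
    (hsub : ∀ v ∈ l, v ∈ l') : closed c l ≤ closed (offDiag c) l + closed c l' := by
  by_cases h1 : l.length = 1
  · obtain ⟨v, rfl⟩ := List.length_eq_one_iff.1 h1
    have := closed_sublist h0 h3 (List.singleton_sublist.2 (hsub v (by simp)))
    linarith [closed_nonneg (offDiag_nonneg h0) [v]]
  · rw [closed_offDiag hl h1]
    linarith [closed_nonneg h0 l']

theorem mem_shortcut {T : List (Fin n)} (hT : IsTour T) {A : Finset (Fin n)} {v : Fin n} :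
    v ∈ shortcut T A ↔ v ∈ A := by simp [shortcut, hT v]

theorem expectedCost_le_offDiag_add {c : Fin n → Fin n → ℝ} (hc : ∀ x y, 0 ≤ c x y)
    (h3 : ∀ x y z, c x z ≤ c x y + c y z) {p : Fin n → ℝ}
    (h0 : ∀ v, 0 ≤ p v) (h1 : ∀ v, p v ≤ 1) {T T' : List (Fin n)} (hnd : T.Nodup) (hT : IsTour T)
    (hT' : IsTour T') :
    expectedCost c p T ≤ expectedCost (offDiag c) p T + expectedCost c p T' := by
  simp only [expectedCost, tourCost_eq_closed, ← Finset.sum_add_distrib, ← mul_add]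
  refine Finset.sum_le_sum fun A _ => mul_le_mul_of_nonneg_left ?_ (activeProb_nonneg h0 h1 A)
  exact closed_le_offDiag_add hc h3 (hnd.filter _) fun v hv =>
    (mem_shortcut hT').2 ((mem_shortcut hT).1 hv)

theorem expectedCost_dedup_le {c : Fin n → Fin n → ℝ} (hc : ∀ x y, 0 ≤ c x y)
    (h3 : ∀ x y z, c x z ≤ c x y + c y z) {p : Fin n → ℝ}
    (h0 : ∀ v, 0 ≤ p v) (h1 : ∀ v, p v ≤ 1) (T : List (Fin n)) :
    expectedCost c p T.dedup ≤ expectedCost c p T :=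
  expectedCost_mono h0 h1 fun _ => closed_sublist hc h3 ((List.dedup_sublist T).filter _)

/-- Every tour without repetitions is within a factor of `n` of every other tour. -/
theorem expectedCost_le_card_mul {c : Fin n → Fin n → ℝ} (hc : ∀ x y, 0 ≤ c x y)
    (h3 : ∀ x y z, c x z ≤ c x y + c y z) {p : Fin n → ℝ}
    (h0 : ∀ v, 0 ≤ p v) (h1 : ∀ v, p v ≤ 1) {T T' : List (Fin n)} (hnd : T.Nodup) (hT : IsTour T)
    (hT' : IsTour T') :
    expectedCost c p T ≤ n * expectedCost c p T' := by
  simp only [expectedCost, tourCost_eq_closed, Finset.mul_sum]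
  refine Finset.sum_le_sum fun A _ => ?_
  rw [mul_left_comm]
  refine mul_le_mul_of_nonneg_left ?_ (activeProb_nonneg h0 h1 A)
  refine (closed_le_length_mul (B := closed c (shortcut T' A)) fun x hx y hy => ?_).trans ?_
  · exact edge_le_closed hc h3 ((mem_shortcut hT').2 ((mem_shortcut hT).1 hx))
      ((mem_shortcut hT').2 ((mem_shortcut hT).1 hy))
  · refine mul_le_mul_of_nonneg_right ?_ (closed_nonneg hc _)
    have : (shortcut T A).length ≤ n := by
      have h : (shortcut T A).Nodup := hnd.filter _
      simpa using h.length_le_card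
    exact_mod_cast this

end Basic

/-! ### Copies of the vertices -/

section Copies

variable {n : ℕ}

/-- The number of copies of the vertex `v`, each of which is active with probability `1 / (2n)`.
There are none if the activation probability of `v` is below `1 / (2n)`. -/
noncomputable def copies (p : Fin n → ℝ) (v : Fin n) : ℕ := ⌊2 * n * p v⌋₊

/-- The list of all copies, each given by its original vertex. -/
noncomputable def copyList (p : Fin n → ℝ) : List (Fin n) :=
  (List.finRange n).flatMap fun v => List.replicate (copies p v) v

/-- The activation probability of a single copy. -/
noncomputable def unitProb (n : ℕ) : ℝ := 1 / (2 * n)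

/-- The probability that at least one copy of `v` is active. -/
noncomputable def copyProb (p : Fin n → ℝ) (v : Fin n) : ℝ := 1 - (1 - unitProb n) ^ copies p v

/-- The original probabilities for the vertices without copies, and the probability that at least
one copy is active for the others. -/
noncomputable def roundedProb (p : Fin n → ℝ) (v : Fin n) : ℝ :=
  if copies p v = 0 then p v else copyProb p v

theorem unitProb_pos (hn : 0 < n) : 0 < unitProb n := by unfold unitProb; positivity

theorem mul_unitProb (hn : 0 < n) : (2 * n : ℕ) * unitProb n = 1 := by
  have : (n : ℝ) ≠ 0 := by positivity
  unfold unitProb; push_cast; field_simp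

theorem unitProb_le (hn : 0 < n) : unitProb n ≤ 1 / 2 := by
  have h : (1 : ℝ) ≤ n := by exact_mod_cast hn
  unfold unitProb
  exact one_div_le_one_div_of_le (by norm_num) (by linarith)

theorem half_le_pow (hn : 0 < n) : 1 / 2 ≤ (1 - unitProb n) ^ n := by
  have h := one_add_mul_le_pow (a := -unitProb n) (by linarith [unitProb_le hn]) n
  have h2 := mul_unitProb hn
  push_cast at h2
  rw [← sub_eq_add_neg] at h
  linarith

/-- A lower bound for the probability that one of `m` copies is active. -/
theorem pow_le_one_sub (hn : 0 < n) {m : ℕ} (hm : m ≤ 2 * n) :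
    (1 - unitProb n) ^ m ≤ 1 - m * unitProb n / 2 := by
  have h0 := unitProb_pos hn
  have h1 := unitProb_le hn
  have h2 := mul_unitProb hn
  have hm' : m * unitProb n ≤ 1 := by
    rw [← h2]; exact mul_le_mul_of_nonneg_right (by exact_mod_cast hm) h0.le
  have hB := one_add_mul_le_pow (a := unitProb n) (by linarith) m
  have hprod : (1 - unitProb n) ^ m * (1 + unitProb n) ^ m ≤ 1 := by
    rw [← mul_pow]; exact pow_le_one₀ (by nlinarith) (by nlinarith)
  have hp : 0 ≤ (1 - unitProb n) ^ m := pow_nonneg (by linarith) m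
  have hy : 0 ≤ m * unitProb n := by positivity
  have h3 : (1 - unitProb n) ^ m * (1 + m * unitProb n) ≤ 1 :=
    (mul_le_mul_of_nonneg_left hB hp).trans hprod
  have h4 : 1 ≤ (1 - m * unitProb n / 2) * (1 + m * unitProb n) := by nlinarith
  exact le_of_mul_le_mul_right (h3.trans h4) (by linarith)

theorem copies_le {p : Fin n → ℝ} (h1 : ∀ v, p v ≤ 1) (v : Fin n) : copies p v ≤ 2 * n := by
  refine Nat.floor_le_of_le ?_
  push_cast
  nlinarith [h1 v, Nat.cast_nonneg (α := ℝ) n]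

theorem copies_mul_le {p : Fin n → ℝ} (h0 : ∀ v, 0 ≤ p v) (v : Fin n) :
    copies p v * unitProb n ≤ p v := by
  have hn : 0 < n := v.pos
  have h : (copies p v : ℝ) ≤ 2 * n * p v := Nat.floor_le (by have := h0 v; positivity)
  have h2 := mul_unitProb hn
  push_cast at h2
  calc copies p v * unitProb n ≤ 2 * n * p v * unitProb n :=
        mul_le_mul_of_nonneg_right h (unitProb_pos hn).le
    _ = (2 * n * unitProb n) * p v := by ring
    _ = p v := by rw [h2, one_mul]

theorem lt_copies_mul (p : Fin n → ℝ) (v : Fin n) :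
    p v < (copies p v + 1) * unitProb n := by
  have hn : 0 < n := v.pos
  have h : 2 * n * p v < (copies p v : ℝ) + 1 := Nat.lt_floor_add_one _
  have h2 := mul_unitProb hn
  push_cast at h2
  calc p v = (2 * n * unitProb n) * p v := by rw [h2, one_mul]
    _ = 2 * n * p v * unitProb n := by ring
    _ < _ := mul_lt_mul_of_pos_right h (unitProb_pos hn)

theorem length_copyList (p : Fin n → ℝ) : (copyList p).length = ∑ v, copies p v := by
  simp [copyList, List.length_flatMap, Fin.sum_univ_def]

theorem length_copyList_le {p : Fin n → ℝ} (h1 : ∀ v, p v ≤ 1) :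
    (copyList p).length ≤ 2 * n ^ 2 := by
  rw [length_copyList]
  refine (Finset.sum_le_card_nsmul _ _ (2 * n) fun v _ => copies_le h1 v).trans ?_
  simp; nlinarith

theorem count_copyList (p : Fin n → ℝ) (v : Fin n) : (copyList p).count v = copies p v := by
  rw [copyList, List.count_flatMap, ← Fin.sum_univ_def, Finset.sum_eq_single v]
  · simp
  · intro u _ hu
    simp [List.count_replicate, hu]
  · simp

theorem copyProb_le {p : Fin n → ℝ} (h0 : ∀ v, 0 ≤ p v) (v : Fin n) : copyProb p v ≤ p v := by
  have hn : 0 < n := v.pos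
  have h := one_add_mul_le_pow (a := -unitProb n) (by linarith [unitProb_le hn]) (copies p v)
  rw [← sub_eq_add_neg] at h
  have := copies_mul_le h0 v
  unfold copyProb
  linarith

theorem copyProb_nonneg (p : Fin n → ℝ) (v : Fin n) : 0 ≤ copyProb p v := by
  have hn : 0 < n := v.pos
  have := pow_le_one₀ (n := copies p v) (by linarith [unitProb_le hn] : 0 ≤ 1 - unitProb n)
    (by linarith [unitProb_pos hn])
  unfold copyProb; linarith

theorem roundedProb_nonneg {p : Fin n → ℝ} (h0 : ∀ v, 0 ≤ p v) (v : Fin n) :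
    0 ≤ roundedProb p v := by
  unfold roundedProb; split_ifs
  · exact h0 v
  · exact copyProb_nonneg p v

theorem roundedProb_le {p : Fin n → ℝ} (h0 : ∀ v, 0 ≤ p v) (v : Fin n) :
    roundedProb p v ≤ p v := by
  unfold roundedProb; split_ifs
  · exact le_rfl
  · exact copyProb_le h0 v

/-- Rounding `2n * p v` down and replacing a sum of probabilities by the probability of a union each
lose a factor of at most `2`. -/
theorem le_four_mul_roundedProb {p : Fin n → ℝ} (h0 : ∀ v, 0 ≤ p v) (h1 : ∀ v, p v ≤ 1)
    (v : Fin n) : p v ≤ 4 * roundedProb p v := by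
  have hn : 0 < n := v.pos
  unfold roundedProb
  split_ifs with h
  · linarith [h0 v]
  · have h2 := pow_le_one_sub hn (copies_le h1 v)
    have h3 := lt_copies_mul p v
    have h4 : (1 : ℝ) ≤ copies p v := by exact_mod_cast Nat.one_le_iff_ne_zero.2 h
    have h5 := unitProb_pos hn
    unfold copyProb
    nlinarith

/-- If a set of vertices has few copies, then with constant probability none of its vertices is
active. -/
theorem prod_one_sub_roundedProb_ge {p : Fin n → ℝ} {L : List (Fin n)}
    (hL : L.Nodup) (hsum : (L.map (copies p)).sum ≤ 2 * n) (hn : 0 < n) :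
    1 / 8 ≤ (L.map fun v => 1 - roundedProb p v).prod := by
  have hq0 : 0 ≤ 1 - unitProb n := by linarith [unitProb_le hn]
  have hq1 : 1 - unitProb n ≤ 1 := by linarith [unitProb_pos hn]
  have hv : ∀ v, (1 - unitProb n) ^ (copies p v + 1) ≤ 1 - roundedProb p v := by
    intro v
    unfold roundedProb
    split_ifs with h
    · have := lt_copies_mul p v
      rw [h] at this ⊢
      simp at this ⊢
      linarith
    · unfold copyProb
      have := pow_le_pow_of_le_one hq0 hq1 (Nat.le_succ (copies p v))
      rw [Nat.succ_eq_add_one] at this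
      linarith
  have hprod : (1 - unitProb n) ^ ((L.map (copies p)).sum + L.length)
      ≤ (L.map fun v => 1 - roundedProb p v).prod := by
    clear hsum hL
    induction L with
    | nil => simp
    | cons v L ih =>
      simp only [List.map_cons, List.sum_cons, List.length_cons, List.prod_cons]
      rw [show copies p v + (L.map (copies p)).sum + (L.length + 1)
        = (copies p v + 1) + ((L.map (copies p)).sum + L.length) by ring, pow_add]
      exact mul_le_mul (hv v) ih (pow_nonneg hq0 _) ((pow_nonneg hq0 _).trans (hv v))
  refine le_trans ?_ hprod
  have hlen : L.length ≤ n := by simpa using hL.length_le_card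
  have h3 := pow_le_pow_of_le_one hq0 hq1 (show (L.map (copies p)).sum + L.length ≤ n * 3 by omega)
  have h4 := pow_le_pow_left₀ (by norm_num) (half_le_pow hn) 3
  rw [← pow_mul] at h4
  norm_num at h4
  linarith

/-- Rounding the probabilities and appending the vertices without copies to a tour of the other
vertices costs only a constant factor. -/
theorem expectedCost_append_le_of_rounded {c : Fin n → Fin n → ℝ} (hc : ∀ x y, 0 ≤ c x y)
    (h3 : ∀ x y z, c x z ≤ c x y + c y z) (hd : ∀ x, c x x = 0) {p : Fin n → ℝ}
    (h0 : ∀ v, 0 ≤ p v) (h1 : ∀ v, p v ≤ 1) (hn : 0 < n) {TH TL T : List (Fin n)}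
    (hnd : (TH ++ TL).Nodup) (hall : IsTour (TH ++ TL)) (hT : IsTour T) (hTn : T.Nodup)
    (hTL : (TL.map (copies p)).sum ≤ 2 * n) :
    expectedCost c p (TH ++ TL)
      ≤ 16 * (expectedCost c (roundedProb p) TH + 8 * expectedCost c p T) := by
  have r0 := roundedProb_nonneg h0
  have r1 : ∀ v, roundedProb p v ≤ 1 := fun v => (roundedProb_le h0 v).trans (h1 v)
  have e1 : expectedCost c p (TH ++ TL) ≤ 16 * expectedCost c (roundedProb p) (TH ++ TL) := by
    rw [expectedCost_eq_expect c _ hnd, expectedCost_eq_expect c _ hnd]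
    exact expect_closed_thinning hc _ r0 (roundedProb_le h0) h1 (le_four_mul_roundedProb h0 h1)
  have e2 := expectedCost_append_le hc h3 hd r0 r1 hnd hall hT
  have e3 : expectedCost c (roundedProb p) T ≤ expectedCost c p T := by
    rw [expectedCost_eq_expect c _ hTn, expectedCost_eq_expect c _ hTn]
    exact expect_weight_mono T id (fun v _ => r0 v) (fun v _ => roundedProb_le h0 v)
      (fun v _ => h1 v) fun _ _ h => closed_sublist hc h3 h
  have e4 := prod_one_sub_roundedProb_ge (List.nodup_append.1 hnd).2.1 hTL hn
  set κ := (TL.map fun v => 1 - roundedProb p v).prod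
  have e5 := expectedCost_nonneg hc r0 r1 T
  have e6 : κ * (expectedCost c (roundedProb p) (TH ++ TL) - expectedCost c (roundedProb p) TH)
      ≤ κ * (8 * expectedCost c p T) := by nlinarith
  have e7 := le_of_mul_le_mul_left e6 (by linarith)
  linarith

/-- The distance between two copies. -/
noncomputable def copyCost (c : Fin n → Fin n → ℝ) (p : Fin n → ℝ)
    (x y : Fin (copyList p).length) : ℝ := c ((copyList p).get x) ((copyList p).get y)

theorem length_filter_get {X : Type*} [DecidableEq X] (l : List X) (v : X) :
    ((List.finRange l.length).filter fun i => l.get i = v).length = l.count v := by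
  have h : l.count v = ((List.finRange l.length).map l.get).count v := by
    rw [List.map_get_finRange]
  rw [h, List.count, List.countP_map, List.countP_eq_length_filter]
  congr 1

/-- The optimum hop cost of the instance on the copies is bounded by the optimum expected cost:
in a tour of the original instance, every vertex is replaced by a block of all its copies. -/
theorem exists_hop_tour {c : Fin n → Fin n → ℝ} (hc : ∀ x y, 0 ≤ c x y)
    (h3 : ∀ x y z, c x z ≤ c x y + c y z) (hd : ∀ x, c x x = 0) {p : Fin n → ℝ}
    (h0 : ∀ v, 0 ≤ p v) (h1 : ∀ v, p v ≤ 1) (hN : 2 * n < (copyList p).length) {T : List (Fin n)}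
    (hT : IsTour T) (hTn : T.Nodup) :
    ∃ U : List (Fin (copyList p).length), U.Nodup ∧ IsTour U ∧
      unitProb n ^ 2 * hopCost (copyCost c p) (2 * n) U ≤ 4 * expectedCost c p T := by
  have hn : 0 < n := by
    by_contra h
    have : n = 0 := by omega
    subst this
    simp [length_copyList] at hN
  set f : Fin n → List (Fin (copyList p).length) := fun v =>
    (List.finRange (copyList p).length).filter fun i => (copyList p).get i = v with hf
  set U := T.flatMap f with hU
  have hUn : U.Nodup := by
    rw [hU, List.nodup_flatMap]
    refine ⟨fun v _ => (List.nodup_finRange _).filter _, ?_⟩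
    refine List.Pairwise.imp (R := (· ≠ ·)) (fun {a b} hab => ?_) hTn
    intro i hi hj
    simp only [hf, List.mem_filter, decide_eq_true_eq] at hi hj
    exact hab (hi.2.symm.trans hj.2)
  have hUt : IsTour U := fun i =>
    List.mem_flatMap.2 ⟨(copyList p).get i, hT _, by simp [hf]⟩
  refine ⟨U, hUn, hUt, ?_⟩
  have hlen : U.length = (copyList p).length := by
    rw [← List.toFinset_card_of_nodup hUn, Finset.eq_univ_iff_forall.2 fun i =>
      List.mem_toFinset.2 (hUt i)]
    simp
  have hq := unitProb_le hn
  have hq' := unitProb_pos hn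
  have hquarter : 1 / 4 ≤ (1 - unitProb n) ^ (2 * n) := by
    have := pow_le_pow_left₀ (by norm_num) (half_le_pow hn) 2
    rw [← pow_mul, mul_comm n 2] at this
    norm_num at this ⊢
    linarith
  have e1 := le_expect_closed_uniform (c := copyCost c p) (q := unitProb n) (fun _ _ => hc _ _)
    (fun _ => hd _) (by linarith) hq'.le hquarter (T := U) (by omega)
  have hmapf : ∀ v, (f v).map (fun x => ((copyList p).get x, unitProb n))
      = List.replicate (copies p v) (v, unitProb n) := by
    intro v
    rw [List.eq_replicate_iff]
    constructor
    · rw [List.length_map, hf, length_filter_get, count_copyList]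
    · intro e he
      obtain ⟨i, hi, rfl⟩ := List.mem_map.1 he
      simp only [hf, List.mem_filter, decide_eq_true_eq] at hi
      rw [hi.2]
  have hmap : U.map (fun x => ((copyList p).get x, unitProb n))
      = T.flatMap fun v => List.replicate (copies p v) (v, unitProb n) := by
    rw [hU, List.map_flatMap]; simp only [hmapf]
  have e2 : expect (U.map fun x => (x, unitProb n)) (closed (copyCost c p))
      = expect (U.map fun x => ((copyList p).get x, unitProb n)) (closed c) := by
    exact expect_closed_map c (copyList p).get U (unitProb n)
  rw [e2, hmap, expect_flatMap_replicate (closed_stutterInvariant hd)] at e1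
  have e3 : expect (T.map fun x => (x, 1 - (1 - unitProb n) ^ copies p x)) (closed c)
      ≤ expectedCost c p T := by
    rw [expectedCost_eq_expect c _ hTn]
    exact expect_weight_mono T id (fun v _ => copyProb_nonneg p v) (fun v _ => copyProb_le h0 v)
      (fun v _ => h1 v) fun _ _ h => closed_sublist hc h3 h
  linarith

/-- The expected cost of a hop tour without repetitions in which every copy is active with
probability `1 / (2n)`. -/
theorem expect_le_of_hop_tour {c : Fin n → Fin n → ℝ} (hc : ∀ x y, 0 ≤ c x y)
    (h3 : ∀ x y z, c x z ≤ c x y + c y z) (hd : ∀ x, c x x = 0) {p : Fin n → ℝ}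
    (h0 : ∀ v, 0 ≤ p v) (h1 : ∀ v, p v ≤ 1) (hN : 2 * n < (copyList p).length) {T : List (Fin n)}
    (hT : IsTour T) (hTn : T.Nodup) {β : ℝ} (hβ : 0 ≤ β) {U' U'' : List (Fin (copyList p).length)}
    (hU' : ∀ U : List (Fin (copyList p).length), U.Nodup → IsTour U →
      hopCost (copyCost c p) (2 * n) U' ≤ β * hopCost (copyCost c p) (2 * n) U)
    (hsub : U''.Sublist U') :
    expect (U''.map fun x => ((copyList p).get x, unitProb n)) (closed c)
      ≤ 16 * β * expectedCost c p T := by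
  have hn : 0 < n := by
    by_contra h
    have : n = 0 := by omega
    subst this
    simp [length_copyList] at hN
  obtain ⟨U, hUn, hUt, hU⟩ := exists_hop_tour hc h3 hd h0 h1 hN hT hTn
  have hq := unitProb_le hn
  have hq' := unitProb_pos hn
  have hhalf : (1 - unitProb n) ^ (2 * n) ≤ 1 / 2 := by
    have := pow_le_one_sub hn (le_refl (2 * n))
    rw [mul_unitProb hn] at this
    linarith
  have e1 := expect_closed_uniform_le (c := copyCost c p) (fun _ _ => hc _ _)
    (fun _ _ _ => h3 _ _ _) (fun _ => hd _) (by linarith) hq' (mul_unitProb hn) hhalf U'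
  have e2 : expect (U''.map fun x => (x, unitProb n)) (closed (copyCost c p))
      ≤ expect (U'.map fun x => (x, unitProb n)) (closed (copyCost c p)) := by
    refine expect_sublist (hsub.map _) ?_
      fun _ _ h => closed_sublist (c := copyCost c p) (fun _ _ => hc _ _) (fun _ _ _ => h3 _ _ _) h
    intro e he
    obtain ⟨i, _, rfl⟩ := List.mem_map.1 he
    exact ⟨hq'.le, by linarith⟩
  have e3 := hU' U hUn hUt
  have e4 := expect_closed_map c (copyList p).get U'' (unitProb n)
  rw [← e4]
  refine e2.trans (e1.trans ?_)
  have h4 : 0 ≤ 4 * unitProb n ^ 2 := by positivity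
  calc 4 * unitProb n ^ 2 * hopCost (copyCost c p) (2 * n) U'
      ≤ 4 * unitProb n ^ 2 * (β * hopCost (copyCost c p) (2 * n) U) :=
        mul_le_mul_of_nonneg_left e3 h4
    _ = 4 * β * (unitProb n ^ 2 * hopCost (copyCost c p) (2 * n) U) := by ring
    _ ≤ 4 * β * (4 * expectedCost c p T) := mul_le_mul_of_nonneg_left hU (by linarith)
    _ = _ := by ring

end Copies

/-! ### Scaling and rounding the costs -/

section Scaling

variable {N : ℕ}

/-- The costs, scaled such that the maximum becomes `N ^ 2`, and rounded up. -/
noncomputable def scaledCost (c : Fin N → Fin N → ℝ) (M : ℝ) (x y : Fin N) : ℕ :=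
  ⌈(N : ℝ) ^ 2 * c x y / M⌉₊

/-- The Hop-ATSP instance with scaled and rounded costs. -/
noncomputable def scaledInstance (c : Fin N → Fin N → ℝ)
    (h3 : ∀ x y z, c x z ≤ c x y + c y z) {M : ℝ} (hM : 0 < M) {k : ℕ} (hk : k < N) :
    HopInstance where
  n := N
  c x y := scaledCost c M x y
  k := k
  c_nonneg x y := Nat.cast_nonneg _
  c_triangle x y z := by
    have h : scaledCost c M x z ≤ scaledCost c M x y + scaledCost c M y z := by
      refine le_trans (Nat.ceil_mono ?_) (Nat.ceil_add_le _ _)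
      rw [← add_div, ← mul_add]
      exact div_le_div_of_nonneg_right (mul_le_mul_of_nonneg_left (h3 x y z) (by positivity)) hM.le
    exact_mod_cast h
  k_lt := hk

theorem tourCost_le_hopCost {c : Fin N → Fin N → ℝ} (h0 : ∀ x y, 0 ≤ c x y) {k : ℕ} (hk : 0 < k)
    (T : List (Fin N)) : tourCost c T ≤ hopCost c k T :=
  Finset.single_le_sum (f := fun Δ => shiftCost c T Δ) (fun _ _ => shiftCost_nonneg h0 _ _)
    (Finset.mem_Icc.2 ⟨le_rfl, hk⟩)

/-- A tour has to travel between any two vertices, so its hop cost is at least the largest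
distance. -/
theorem edge_le_hopCost {c : Fin N → Fin N → ℝ} (h0 : ∀ x y, 0 ≤ c x y)
    (h3 : ∀ x y z, c x z ≤ c x y + c y z) {k : ℕ} (hk : 0 < k) {T : List (Fin N)}
    (hT : IsTour T) (x y : Fin N) : c x y ≤ hopCost c k T := by
  refine le_trans ?_ (tourCost_le_hopCost h0 hk T)
  rw [tourCost_eq_closed]
  exact edge_le_closed h0 h3 (hT x) (hT y)

theorem HopInstance.le_opt (I : HopInstance) {a : ℝ}
    (h : ∀ T : List (Fin I.n), IsTour T → a ≤ hopCost I.c I.k T) : a ≤ I.opt := by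
  refine le_csInf ⟨_, List.finRange I.n, fun v => List.mem_finRange v, rfl⟩ ?_
  rintro _ ⟨T, hT, rfl⟩
  exact h T hT

theorem HopInstance.opt_le (I : HopInstance) {T : List (Fin I.n)} (hT : IsTour T) :
    I.opt ≤ hopCost I.c I.k T := by
  refine csInf_le ⟨0, ?_⟩ ⟨T, hT, rfl⟩
  rintro _ ⟨T, -, rfl⟩
  exact hopCost_nonneg I.c_nonneg _ _

theorem scaledInstance_wellScaled {c : Fin N → Fin N → ℝ}
    (h3 : ∀ x y z, c x z ≤ c x y + c y z) {M : ℝ} (hM : 0 < M) {k : ℕ} (hk : k < N) (hk0 : 0 < k)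
    (hle : ∀ x y, c x y ≤ M) (hmax : ∃ x y, c x y = M) :
    (scaledInstance c h3 hM hk).WellScaled := by
  constructor
  · intro x y
    refine ⟨scaledCost c M x y, ?_, rfl⟩
    have h : scaledCost c M x y ≤ N ^ 2 := by
      refine Nat.ceil_le.2 ?_
      rw [div_le_iff₀ hM]
      push_cast
      exact mul_le_mul_of_nonneg_left (hle x y) (by positivity)
    refine h.trans ?_
    change N ^ 2 ≤ 2 * N ^ 3
    have : 0 < N := by omega
    nlinarith [Nat.pow_le_pow_right this (show 2 ≤ 3 by norm_num)]
  · obtain ⟨x, y, hxy⟩ := hmax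
    refine HopInstance.le_opt _ fun T hT => ?_
    refine le_trans (le_of_eq ?_) (edge_le_hopCost (HopInstance.c_nonneg _)
      (HopInstance.c_triangle _) hk0 hT x y)
    change (N : ℝ) ^ 2 = (scaledCost c M x y : ℕ)
    rw [scaledCost, hxy, mul_div_assoc, div_self hM.ne', mul_one, ← Nat.cast_pow, Nat.ceil_natCast]

/-- Rounding does not change the hop cost of any tour by more than a factor of two, so an
approximate solution of the scaled instance yields one for the original costs. -/
theorem hopCost_le_of_scaled {c : Fin N → Fin N → ℝ} (h0 : ∀ x y, 0 ≤ c x y)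
    (h3 : ∀ x y z, c x z ≤ c x y + c y z) {M : ℝ} (hM : 0 < M) {k : ℕ} (hk : k < N) (hk0 : 0 < k)
    (hmax : ∃ x y, c x y = M) {α : ℝ} (hα : 0 ≤ α) {T U : List (Fin N)}
    (hT : hopCost (scaledInstance c h3 hM hk).c k T
      ≤ α * (scaledInstance c h3 hM hk).opt)
    (hUn : U.Nodup) (hU : IsTour U) : hopCost c k T ≤ 2 * α * hopCost c k U := by
  set I : Fin N → Fin N → ℝ := fun x y => (scaledCost c M x y : ℕ) with hI
  set opt := (scaledInstance c h3 hM hk).opt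
  have hT : hopCost I k T ≤ α * opt := hT
  set a : ℝ := (N : ℝ) ^ 2 / M with ha
  have hN : 0 < (N : ℝ) := by exact_mod_cast (by omega : 0 < N)
  have ha0 : 0 < a := by positivity
  have hlow : ∀ x y, a * c x y ≤ I x y := by
    intro x y
    simp only [hI]
    rw [scaledCost, ha, div_mul_eq_mul_div]
    exact Nat.le_ceil _
  have hup : ∀ x y, I x y ≤ a * c x y + 1 := by
    intro x y
    simp only [hI]
    rw [scaledCost, ha, div_mul_eq_mul_div]
    exact (Nat.ceil_lt_add_one (div_nonneg (mul_nonneg (by positivity) (h0 x y)) hM.le)).le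
  have e1 : a * hopCost c k T ≤ hopCost I k T := by
    simp only [hopCost, shiftCost, Finset.mul_sum]
    exact Finset.sum_le_sum fun _ _ => Finset.sum_le_sum fun _ _ => hlow _ _
  have e2 : hopCost I k U ≤ a * hopCost c k U + k * N := by
    have hlen : U.length ≤ N := by simpa using hUn.length_le_card
    have hs : ∀ Δ, shiftCost I U Δ ≤ a * shiftCost c U Δ + N := by
      intro Δ
      have : shiftCost I U Δ ≤ a * shiftCost c U Δ + U.length := by
        simp only [shiftCost, Finset.mul_sum]
        refine (Finset.sum_le_sum fun i _ => hup _ _).trans (le_of_eq ?_)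
        rw [Finset.sum_add_distrib, Finset.sum_const, Finset.card_univ, Fintype.card_fin,
          nsmul_eq_mul, mul_one]
      exact this.trans (by gcongr)
    simp only [hopCost, Finset.mul_sum]
    refine (Finset.sum_le_sum fun Δ _ => hs Δ).trans (le_of_eq ?_)
    rw [Finset.sum_add_distrib]
    simp
  have e3 : opt ≤ hopCost I k U := HopInstance.opt_le (scaledInstance c h3 hM hk) hU
  have e4 : M ≤ hopCost c k U := by
    obtain ⟨x, y, hxy⟩ := hmax
    exact hxy ▸ edge_le_hopCost h0 h3 hk0 hU x y
  have e5 : (k : ℝ) * N ≤ a * hopCost c k U := by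
    calc (k : ℝ) * N ≤ N * N := by gcongr
      _ = a * M := by rw [ha]; field_simp
      _ ≤ _ := mul_le_mul_of_nonneg_left e4 ha0.le
  have e6 : a * hopCost c k T ≤ a * (2 * α * hopCost c k U) := by
    calc a * hopCost c k T ≤ α * hopCost I k U :=
          e1.trans (hT.trans (mul_le_mul_of_nonneg_left e3 hα))
      _ ≤ α * (2 * (a * hopCost c k U)) := mul_le_mul_of_nonneg_left (by linarith) hα
      _ = _ := by ring
  exact le_of_mul_le_mul_left e6 ha0

end Scaling

/-! ### Choosing one copy of each vertex -/

section Merging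

variable {n : ℕ}

/-- The state after the first `j` of the `N` positions of the tour `x` have been processed by
merging copies of the same vertex. The position `i` carries the probability `w i`; among the
processed positions, only the representatives have a positive probability, where the vertex `v`
is represented by the position `rep v - 1`, or has not been seen yet if `rep v = 0`. The expected
cost is still at most `Φ`, and the probability that no copy of `v` is active is unchanged. -/
structure MergeInvariant (c : Fin n → Fin n → ℝ) (x : ℕ → Fin n) (q : ℝ) (m : Fin n → ℕ) (N : ℕ)
    (Φ : ℝ) (j : ℕ) (w : ℕ → ℝ) (rep : Fin n → ℕ) : Prop where
  prob : ∀ i < N, 0 ≤ w i ∧ w i ≤ 1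
  prod : ∀ v, ∏ i ∈ Finset.range N with x i = v, (1 - w i) = (1 - q) ^ m v
  cost : expect ((List.range N).map fun i => (x i, w i)) (closed c) ≤ Φ
  zero : ∀ i < j, w i ≠ 0 → rep (x i) = i + 1
  rep_spec : ∀ v, rep v ≠ 0 → rep v ≤ j ∧ x (rep v - 1) = v
  not_seen : ∀ v, rep v = 0 → ∀ i < j, x i ≠ v

variable {c : Fin n → Fin n → ℝ} {x : ℕ → Fin n} {q : ℝ} {m : Fin n → ℕ} {N : ℕ} {Φ : ℝ} {j : ℕ}
  {w : ℕ → ℝ} {rep : Fin n → ℕ}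

theorem MergeInvariant.init (hq0 : 0 ≤ q) (hq1 : q ≤ 1)
    (hm : ∀ v, ((List.range N).map x).count v = m v)
    (hΦ : expect ((List.range N).map fun i => (x i, q)) (closed c) ≤ Φ) (hw : ∀ i < N, w i = q)
    (hrep : ∀ v, rep v = 0) : MergeInvariant c x q m N Φ 0 w rep where
  prob i hi := by rw [hw i hi]; exact ⟨hq0, hq1⟩
  prod v := by
    rw [Finset.prod_congr rfl fun i hi => by
      rw [hw i (Finset.mem_range.1 (Finset.mem_filter.1 hi).1)]]
    rw [Finset.prod_const, ← hm v, List.count, List.countP_map, List.countP_eq_length_filter]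
    congr 1
  cost := by
    rw [List.map_congr_left fun i hi => by rw [hw i (List.mem_range.1 hi)]]
    exact hΦ
  zero i hi := absurd hi (Nat.not_lt_zero i)
  rep_spec v hv := absurd (hrep v) hv
  not_seen v _ i hi := absurd hi (Nat.not_lt_zero i)

/-- The first copy of a vertex becomes its representative. -/
theorem MergeInvariant.first (h : MergeInvariant c x q m N Φ j w rep)
    (hr : rep (x j) = 0) :
    MergeInvariant c x q m N Φ (j + 1) w (Function.update rep (x j) (j + 1)) where
  prob := h.prob
  prod := h.prod
  cost := h.cost
  zero i hi hw := by
    rcases Nat.lt_succ_iff_lt_or_eq.1 hi with hi | rfl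
    · have hne : x i ≠ x j := h.not_seen _ hr i hi
      rw [Function.update_of_ne hne]
      exact h.zero i hi hw
    · simp
  rep_spec v hv := by
    by_cases hvj : v = x j
    · subst hvj; simp
    · rw [Function.update_of_ne hvj] at hv ⊢
      exact ⟨(h.rep_spec v hv).1.trans (Nat.le_succ j), (h.rep_spec v hv).2⟩
  not_seen v hv i hi := by
    by_cases hvj : v = x j
    · subst hvj; simp at hv
    · rw [Function.update_of_ne hvj] at hv
      rcases Nat.lt_succ_iff_lt_or_eq.1 hi with hi | rfl
      · exact h.not_seen v hv i hi
      · exact fun h => hvj h.symm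

/-- Merging does not change the probability that no copy of a vertex is active. -/
theorem prod_update_merge {i : ℕ} (hi : i < N) (hj : j < N) (hij : i ≠ j) (hx : x i = x j)
    {s t : ℝ} (hst : (1 - s) * (1 - t) = (1 - w i) * (1 - w j)) (v : Fin n) :
    ∏ k ∈ Finset.range N with x k = v, (1 - Function.update (Function.update w i s) j t k)
      = ∏ k ∈ Finset.range N with x k = v, (1 - w k) := by
  by_cases hv : x j = v
  · have hmi : i ∈ (Finset.range N).filter fun k => x k = v := by simp [hi, hx, hv]
    have hmj : j ∈ ((Finset.range N).filter fun k => x k = v).erase i := by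
      simp [hj, hv, hij.symm]
    rw [← Finset.mul_prod_erase _ _ hmi, ← Finset.mul_prod_erase _ _ hmj,
      ← Finset.mul_prod_erase _ (fun k => 1 - w k) hmi,
      ← Finset.mul_prod_erase _ (fun k => 1 - w k) hmj, ← mul_assoc, ← mul_assoc]
    congr 1
    · simpa [Function.update_of_ne hij] using hst
    · refine Finset.prod_congr rfl fun k hk => ?_
      simp only [Finset.mem_erase] at hk
      rw [Function.update_of_ne hk.1, Function.update_of_ne hk.2.1]
  · refine Finset.prod_congr rfl fun k hk => ?_
    have hk := (Finset.mem_filter.1 hk).2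
    have h1 : k ≠ j := by rintro rfl; exact hv hk
    have h2 : k ≠ i := by rintro rfl; exact hv (hx ▸ hk)
    rw [Function.update_of_ne h1, Function.update_of_ne h2]

/-- A further copy of a vertex is merged into its representative. -/
theorem MergeInvariant.keep (h : MergeInvariant c x q m N Φ j w rep) (hj : j < N)
    (hr : rep (x j) ≠ 0) {i : ℕ} (hi : i = rep (x j) - 1) {s : ℝ} (hs : s = w i + w j - w i * w j)
    (hcost : expect ((List.range N).map fun k =>
      (x k, Function.update (Function.update w i s) j 0 k)) (closed c) ≤ Φ) :
    MergeInvariant c x q m N Φ (j + 1) (Function.update (Function.update w i s) j 0) rep := by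
  have hri := h.rep_spec _ hr
  have hij : i < j := by omega
  obtain ⟨a0, a1⟩ := h.prob i (by omega)
  obtain ⟨b0, b1⟩ := h.prob j hj
  refine ⟨fun k hk => ?_, fun v => ?_, hcost, fun k hk hw => ?_, fun v hv => ?_,
    fun v hv k hk => ?_⟩
  · by_cases hkj : k = j
    · subst hkj; simp
    · by_cases hki : k = i
      · subst hki
        rw [Function.update_of_ne hkj, Function.update_self, hs]
        constructor <;> nlinarith
      · rw [Function.update_of_ne hkj, Function.update_of_ne hki]; exact h.prob k hk
  · rw [prod_update_merge (by omega) hj hij.ne (hi ▸ hri.2) (by rw [hs]; ring), h.prod]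
  · rcases Nat.lt_succ_iff_lt_or_eq.1 hk with hk | rfl
    · by_cases hki : k = i
      · subst hki
        rw [show x k = x j from hi ▸ hri.2]
        omega
      · rw [Function.update_of_ne hk.ne, Function.update_of_ne hki] at hw
        exact h.zero k hk hw
    · simp at hw
  · exact ⟨(h.rep_spec v hv).1.trans (Nat.le_succ j), (h.rep_spec v hv).2⟩
  · rcases Nat.lt_succ_iff_lt_or_eq.1 hk with hk | rfl
    · exact h.not_seen v hv k hk
    · rintro rfl; exact hr hv

/-- A further copy of a vertex takes the place of its representative. -/
theorem MergeInvariant.replace (h : MergeInvariant c x q m N Φ j w rep) (hj : j < N)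
    (hr : rep (x j) ≠ 0) {i : ℕ} (hi : i = rep (x j) - 1) {s : ℝ} (hs : s = w i + w j - w i * w j)
    (hcost : expect ((List.range N).map fun k =>
      (x k, Function.update (Function.update w i 0) j s k)) (closed c) ≤ Φ) :
    MergeInvariant c x q m N Φ (j + 1) (Function.update (Function.update w i 0) j s)
      (Function.update rep (x j) (j + 1)) := by
  have hri := h.rep_spec _ hr
  have hij : i < j := by omega
  obtain ⟨a0, a1⟩ := h.prob i (by omega)
  obtain ⟨b0, b1⟩ := h.prob j hj
  refine ⟨fun k hk => ?_, fun v => ?_, hcost, fun k hk hw => ?_, fun v hv => ?_,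
    fun v hv k hk => ?_⟩
  · by_cases hkj : k = j
    · subst hkj
      rw [Function.update_self, hs]
      constructor <;> nlinarith
    · by_cases hki : k = i
      · subst hki; simp [hkj]
      · rw [Function.update_of_ne hkj, Function.update_of_ne hki]; exact h.prob k hk
  · rw [prod_update_merge (by omega) hj hij.ne (hi ▸ hri.2) (by rw [hs]; ring), h.prod]
  · rcases Nat.lt_succ_iff_lt_or_eq.1 hk with hk | rfl
    · by_cases hki : k = i
      · subst hki; simp [hij.ne] at hw
      · rw [Function.update_of_ne hk.ne, Function.update_of_ne hki] at hw
        have h1 := h.zero k hk hw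
        have h2 : x k ≠ x j := fun he => by rw [he] at h1; omega
        rw [Function.update_of_ne h2, h1]
    · simp
  · by_cases hvj : v = x j
    · subst hvj; simp
    · rw [Function.update_of_ne hvj] at hv ⊢
      exact ⟨(h.rep_spec v hv).1.trans (Nat.le_succ j), (h.rep_spec v hv).2⟩
  · by_cases hvj : v = x j
    · subst hvj; simp at hv
    · rw [Function.update_of_ne hvj] at hv
      rcases Nat.lt_succ_iff_lt_or_eq.1 hk with hk | rfl
      · exact h.not_seen v hv k hk
      · exact fun h => hvj h.symm

/-- The representatives in the order of their positions. -/
def heavyTour (x : ℕ → Fin n) (N : ℕ) (rep : Fin n → ℕ) : List (Fin n) :=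
  ((List.range N).filter fun i => rep (x i) = i + 1).map x

/-- The vertices without a representative. -/
def lightList (rep : Fin n → ℕ) : List (Fin n) := (List.finRange n).filter fun v => rep v = 0

theorem nodup_heavyTour_append (x : ℕ → Fin n) (N : ℕ) (rep : Fin n → ℕ) :
    (heavyTour x N rep ++ lightList rep).Nodup := by
  refine List.Nodup.append ?_ ((List.nodup_finRange n).filter _) ?_
  · refine List.Nodup.map_on ?_ (List.nodup_range.filter _)
    intro i hi j hj hij
    simp only [List.mem_filter, decide_eq_true_eq] at hi hj
    have := hi.2
    rw [hij, hj.2] at this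
    omega
  · intro v hv hv'
    simp only [heavyTour, List.mem_map, List.mem_filter, decide_eq_true_eq] at hv
    obtain ⟨i, ⟨_, hi⟩, rfl⟩ := hv
    simp only [lightList, List.mem_filter, decide_eq_true_eq] at hv'
    omega

theorem MergeInvariant.isTour (h : MergeInvariant c x q m N Φ N w rep) :
    IsTour (heavyTour x N rep ++ lightList rep) := by
  intro v
  by_cases hv : rep v = 0
  · exact List.mem_append_right _ (by simp [lightList, hv])
  · obtain ⟨h1, h2⟩ := h.rep_spec v hv
    refine List.mem_append_left _ (List.mem_map.2 ⟨rep v - 1, ?_, h2⟩)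
    simp only [List.mem_filter, List.mem_range, decide_eq_true_eq, h2]
    omega

/-- Vertices without a representative do not have any copies. -/
theorem MergeInvariant.copies_eq_zero (h : MergeInvariant c x q m N Φ N w rep) (hq0 : 0 < q)
    (hq1 : q < 1) {v : Fin n} (hv : rep v = 0) : m v = 0 := by
  have h1 := h.prod v
  rw [Finset.filter_false_of_mem fun i hi => h.not_seen v hv i (Finset.mem_range.1 hi),
    Finset.prod_empty] at h1
  by_contra hm
  have := pow_lt_one₀ (by linarith : 0 ≤ 1 - q) (by linarith) hm
  linarith

/-- After all positions have been processed, the representative of `v` is active with exactly the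
probability that one of the copies of `v` was active originally. -/
theorem MergeInvariant.weight (h : MergeInvariant c x q m N Φ N w rep) {i : ℕ} (hi : i < N)
    (hr : rep (x i) = i + 1) : w i = 1 - (1 - q) ^ m (x i) := by
  rw [← h.prod, Finset.prod_eq_single i]
  · ring
  · intro k hk hki
    simp only [Finset.mem_filter, Finset.mem_range] at hk
    by_contra hne
    have := h.zero k hk.1 (fun h0 => hne (by rw [h0]; ring))
    rw [hk.2, hr] at this
    omega
  · intro hni
    simp [hi] at hni

theorem MergeInvariant.expect_heavyTour_le (h : MergeInvariant c x q m N Φ N w rep) :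
    expect ((heavyTour x N rep).map fun v => (v, 1 - (1 - q) ^ m v)) (closed c) ≤ Φ := by
  refine le_trans (le_of_eq ?_) h.cost
  rw [expect_filter (List.range N) x w (fun i => rep (x i) = i + 1)]
  · rw [heavyTour, List.map_map]
    congr 1
    refine List.map_congr_left fun i hi => ?_
    simp only [List.mem_filter, List.mem_range, decide_eq_true_eq] at hi
    simp only [Function.comp_apply]
    rw [h.weight hi.1 hi.2]
  · intro i hi hni
    by_contra hw
    exact hni (h.zero i (List.mem_range.1 hi) hw)

end Merging

/-! ### The approximation ratio -/

section Ratio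

variable {n : ℕ}

/-- The tour that is obtained from a hop tour by choosing one copy of each vertex. -/
theorem expectedCost_merged_le {c : Fin n → Fin n → ℝ} (hc : ∀ x y, 0 ≤ c x y)
    (h3 : ∀ x y z, c x z ≤ c x y + c y z) (hd : ∀ x, c x x = 0) {p : Fin n → ℝ}
    (h0 : ∀ v, 0 ≤ p v) (h1 : ∀ v, p v ≤ 1) (hn : 0 < n) {x : ℕ → Fin n} {N : ℕ} {Φ : ℝ}
    {w : ℕ → ℝ} {rep : Fin n → ℕ}
    (hm : ∀ v, ((List.range N).map x).count v = copies p v)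
    (h : MergeInvariant c x (unitProb n) (copies p) N Φ N w rep) {T : List (Fin n)}
    (hT : IsTour T) (hTn : T.Nodup) :
    expectedCost c p (heavyTour x N rep ++ lightList rep) ≤ 16 * (Φ + 8 * expectedCost c p T) := by
  have hq := unitProb_le hn
  have hq' := unitProb_pos hn
  have hlight : ∀ v ∈ lightList rep, copies p v = 0 := by
    intro v hv
    simp only [lightList, List.mem_filter, decide_eq_true_eq] at hv
    exact h.copies_eq_zero hq' (by linarith) hv.2
  have hsum : ((lightList rep).map (copies p)).sum ≤ 2 * n := by
    rw [List.map_congr_left hlight]; simp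
  refine (expectedCost_append_le_of_rounded hc h3 hd h0 h1 hn (nodup_heavyTour_append x N rep)
    h.isTour hT hTn hsum).trans ?_
  have hH : (heavyTour x N rep).Nodup := (List.nodup_append.1 (nodup_heavyTour_append x N rep)).1
  have e : expectedCost c (roundedProb p) (heavyTour x N rep) ≤ Φ := by
    rw [expectedCost_eq_expect c _ hH]
    refine le_trans (le_of_eq ?_) h.expect_heavyTour_le
    congr 1
    refine List.map_congr_left fun v hv => ?_
    obtain ⟨i, hi, rfl⟩ := List.mem_map.1 hv
    simp only [List.mem_filter, List.mem_range, decide_eq_true_eq] at hi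
    have hc0 : copies p (x i) ≠ 0 := by
      rw [← hm, Ne, List.count_eq_zero, not_not]
      exact List.mem_map_of_mem (List.mem_range.2 hi.1)
    rw [roundedProb, if_neg hc0, copyProb]
  linarith

end Ratio

/-! ### Reasoning about programs -/

@[simp] theorem Mem.setNat_nat (s : Mem) (a i v b j : ℕ) :
    (s.setNat a i v).nat b j = if b = a ∧ j = i then v else s.nat b j := by
  by_cases hb : b = a
  · subst hb
    by_cases hj : j = i
    · subst hj; simp [Mem.setNat]
    · simp [Mem.setNat, hj]
  · simp [Mem.setNat, hb]

@[simp] theorem Mem.setNat_nat_of_ne (s : Mem) {a b : ℕ} (i v : ℕ) (h : b ≠ a) :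
    (s.setNat a i v).nat b = s.nat b := by
  funext j; simp [h]

@[simp] theorem Mem.setNat_real (s : Mem) (a i v : ℕ) : (s.setNat a i v).real = s.real := rfl

@[simp] theorem Mem.setNat_out (s : Mem) (a i v : ℕ) : (s.setNat a i v).out = s.out := rfl

@[simp] theorem Mem.setReal_real (s : Mem) (a i : ℕ) (v : ℝ) (b j : ℕ) :
    (s.setReal a i v).real b j = if b = a ∧ j = i then v else s.real b j := by
  by_cases hb : b = a
  · subst hb
    by_cases hj : j = i
    · subst hj; simp [Mem.setReal]
    · simp [Mem.setReal, hj]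
  · simp [Mem.setReal, hb]

@[simp] theorem Mem.setReal_nat (s : Mem) (a i : ℕ) (v : ℝ) : (s.setReal a i v).nat = s.nat := rfl

@[simp] theorem Mem.setReal_out (s : Mem) (a i : ℕ) (v : ℝ) : (s.setReal a i v).out = s.out := rfl

@[simp] theorem Mem.emit_out (s : Mem) (v : ℕ) : (s.emit v).out = s.out ++ [v] := rfl

/-- Whether the program may write to the natural-number array `b`. -/
def Program.writesNat : Program → ℕ → Bool
  | .skip, _ => false
  | .setNat a _ _, b => a == b
  | .setReal _ _ _, _ => false
  | .emit _, _ => false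
  | .seq c₁ c₂, b => c₁.writesNat b || c₂.writesNat b
  | .ite _ c₁ c₂, b => c₁.writesNat b || c₂.writesNat b
  | .loop _ c, b => c.writesNat b
  | .call _ _ _ _ _ dst, b => dst == b

/-- Whether the program may write to the real array `b`. -/
def Program.writesReal : Program → ℕ → Bool
  | .skip, _ => false
  | .setNat _ _ _, _ => false
  | .setReal a _ _, b => a == b
  | .emit _, _ => false
  | .seq c₁ c₂, b => c₁.writesReal b || c₂.writesReal b
  | .ite _ c₁ c₂, b => c₁.writesReal b || c₂.writesReal b
  | .loop _ c, b => c.writesReal b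
  | .call _ _ _ _ _ _, _ => false

/-- Whether the program may write to the output tape. -/
def Program.emits : Program → Bool
  | .skip => false
  | .setNat _ _ _ => false
  | .setReal _ _ _ => false
  | .emit _ => true
  | .seq c₁ c₂ => c₁.emits || c₂.emits
  | .ite _ c₁ c₂ => c₁.emits || c₂.emits
  | .loop _ c => c.emits
  | .call _ _ _ _ _ _ => false

/-- The parts of the memory that `c` does not mention as a target are the same in `s` and `s'`. -/
structure Frame (c : Program) (s s' : Mem) : Prop where
  nat : ∀ b, c.writesNat b = false → s'.nat b = s.nat b
  real : ∀ b, c.writesReal b = false → s'.real b = s.real b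
  out : c.emits = false → s'.out = s.out

theorem Frame.refl (c : Program) (s : Mem) : Frame c s s :=
  ⟨fun _ _ => rfl, fun _ _ => rfl, fun _ => rfl⟩

theorem Frame.trans {c : Program} {s₁ s₂ s₃ : Mem} (h : Frame c s₁ s₂) (h' : Frame c s₂ s₃) :
    Frame c s₁ s₃ :=
  ⟨fun b hb => (h'.nat b hb).trans (h.nat b hb), fun b hb => (h'.real b hb).trans (h.real b hb),
    fun hb => (h'.out hb).trans (h.out hb)⟩

theorem Frame.seq_left {c₁ : Program} (c₂ : Program) {s s' : Mem} (h : Frame c₁ s s') :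
    Frame (.seq c₁ c₂) s s' :=
  ⟨fun b hb => h.nat b (by simp [Program.writesNat] at hb; exact hb.1),
    fun b hb => h.real b (by simp [Program.writesReal] at hb; exact hb.1),
    fun hb => h.out (by simp [Program.emits] at hb; exact hb.1)⟩

theorem Frame.seq_right (c₁ : Program) {c₂ : Program} {s s' : Mem} (h : Frame c₂ s s') :
    Frame (.seq c₁ c₂) s s' :=
  ⟨fun b hb => h.nat b (by simp [Program.writesNat] at hb; exact hb.2),
    fun b hb => h.real b (by simp [Program.writesReal] at hb; exact hb.2),
    fun hb => h.out (by simp [Program.emits] at hb; exact hb.2)⟩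

theorem Frame.ite_left {b : BExp} {c₁ : Program} (c₂ : Program) {s s' : Mem} (h : Frame c₁ s s') :
    Frame (.ite b c₁ c₂) s s' :=
  ⟨fun b hb => h.nat b (by simp [Program.writesNat] at hb; exact hb.1),
    fun b hb => h.real b (by simp [Program.writesReal] at hb; exact hb.1),
    fun hb => h.out (by simp [Program.emits] at hb; exact hb.1)⟩

theorem Frame.ite_right {b : BExp} (c₁ : Program) {c₂ : Program} {s s' : Mem} (h : Frame c₂ s s') :
    Frame (.ite b c₁ c₂) s s' :=
  ⟨fun b hb => h.nat b (by simp [Program.writesNat] at hb; exact hb.2),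
    fun b hb => h.real b (by simp [Program.writesReal] at hb; exact hb.2),
    fun hb => h.out (by simp [Program.emits] at hb; exact hb.2)⟩

theorem Exec.frame {c : Program} {s s' : Mem} {τ : ℕ} (h : Exec c s s' τ) : Frame c s s' := by
  induction h with
  | skip s => exact Frame.refl _ s
  | setNat s a i e =>
    refine ⟨fun b hb => ?_, fun _ _ => rfl, fun _ => rfl⟩
    have hb : b ≠ a := by rintro rfl; simp [Program.writesNat] at hb
    funext j; simp [hb]
  | setReal s a i e =>
    refine ⟨fun _ _ => rfl, fun b hb => ?_, fun _ => rfl⟩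
    have hb : b ≠ a := by rintro rfl; simp [Program.writesReal] at hb
    funext j; simp [hb]
  | emit s e => exact ⟨fun _ _ => rfl, fun _ _ => rfl, fun hb => by simp [Program.emits] at hb⟩
  | seq _ _ ih₁ ih₂ => exact (ih₁.seq_left _).trans (ih₂.seq_right _)
  | ite_true _ _ ih => exact ih.ite_left _
  | ite_false _ _ ih => exact ih.ite_right _
  | loop_true _ _ _ ih₁ ih₂ => exact Frame.trans ⟨ih₁.nat, ih₁.real, ih₁.out⟩ ih₂
  | loop_false _ => exact Frame.refl _ _
  | @call c na nlen ra rlen dst s s' τ _ _ =>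
    refine ⟨fun b hb => ?_, fun _ _ => rfl, fun _ => rfl⟩
    have hb : b ≠ dst := by rintro rfl; simp [Program.writesNat] at hb
    simp [Mem.storeList, hb]

/-- The output is not longer than the running time. -/
theorem Exec.length_out_le {c : Program} {s s' : Mem} {τ : ℕ} (h : Exec c s s' τ) :
    s'.out.length ≤ s.out.length + τ := by
  induction h with
  | skip s => simp
  | setNat s a i e => simp
  | setReal s a i e => simp
  | emit s e => simp
  | seq _ _ ih₁ ih₂ => omega
  | ite_true _ _ ih => omega
  | ite_false _ _ ih => omega
  | loop_true _ _ _ ih₁ ih₂ => omega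
  | loop_false _ => omega
  | call _ _ => simp [Mem.storeList]

/-- Started in `s`, the program terminates within `τ` steps in a memory that satisfies `Q`. -/
def Runs (c : Program) (s : Mem) (τ : ℕ) (Q : Mem → Prop) : Prop :=
  ∃ s' τ', Exec c s s' τ' ∧ τ' ≤ τ ∧ Q s'

theorem Runs.mono {c : Program} {s : Mem} {τ τ' : ℕ} {Q Q' : Mem → Prop} (h : Runs c s τ Q)
    (hτ : τ ≤ τ') (hQ : ∀ s', Frame c s s' → Q s' → Q' s') : Runs c s τ' Q' := by
  obtain ⟨s', τ₁, he, hle, hq⟩ := h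
  exact ⟨s', τ₁, he, hle.trans hτ, hQ s' he.frame hq⟩

theorem Runs.seq {c₁ c₂ : Program} {s : Mem} {τ₁ τ₂ : ℕ} {R Q : Mem → Prop} (h₁ : Runs c₁ s τ₁ R)
    (h₂ : ∀ s', Frame c₁ s s' → R s' → Runs c₂ s' τ₂ Q) : Runs (.seq c₁ c₂) s (τ₁ + τ₂) Q := by
  obtain ⟨s₁, τ₁', e₁, l₁, r⟩ := h₁
  obtain ⟨s₂, τ₂', e₂, l₂, q⟩ := h₂ s₁ e₁.frame r
  exact ⟨s₂, _, e₁.seq e₂, add_le_add l₁ l₂, q⟩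

theorem Runs.ite {b : BExp} {c₁ c₂ : Program} {s : Mem} {τ : ℕ} {Q : Mem → Prop}
    (h₁ : b.Holds s → Runs c₁ s τ Q) (h₂ : ¬ b.Holds s → Runs c₂ s τ Q) :
    Runs (.ite b c₁ c₂) s (b.cost + 1 + τ) Q := by
  by_cases hb : b.Holds s
  · obtain ⟨s', τ', e, l, q⟩ := h₁ hb
    exact ⟨s', _, Exec.ite_true hb e, by omega, q⟩
  · obtain ⟨s', τ', e, l, q⟩ := h₂ hb
    exact ⟨s', _, Exec.ite_false hb e, by omega, q⟩

/-- A loop that is passed exactly `m` times. -/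
theorem Runs.loop {b : BExp} {c : Program} {s : Mem} {τ m : ℕ} (Inv : ℕ → Mem → Prop)
    (h0 : Inv 0 s)
    (hstep : ∀ i < m, ∀ s', Frame (.loop b c) s s' → Inv i s' →
      b.Holds s' ∧ Runs c s' τ (Inv (i + 1)))
    (hend : ∀ s', Frame (.loop b c) s s' → Inv m s' → ¬ b.Holds s') :
    Runs (.loop b c) s ((m + 1) * (b.cost + 1) + m * τ) (Inv m) := by
  have key : ∀ r i, i + r = m → ∀ s', Frame (.loop b c) s s' → Inv i s' →
      Runs (.loop b c) s' ((r + 1) * (b.cost + 1) + r * τ) (Inv m) := by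
    intro r
    induction r with
    | zero =>
      intro i hi s' hf hI
      obtain rfl : i = m := by omega
      exact ⟨s', _, Exec.loop_false (hend s' hf hI), by simp, hI⟩
    | succ r ih =>
      intro i hi s' hf hI
      obtain ⟨hb, s₁, τ₁, e₁, l₁, hI₁⟩ := hstep i (by omega) s' hf hI
      have hf₁ : Frame (.loop b c) s' s₁ := ⟨e₁.frame.nat, e₁.frame.real, e₁.frame.out⟩
      obtain ⟨s₂, τ₂, e₂, l₂, hI₂⟩ := ih (i + 1) (by omega) s₁ (hf.trans hf₁) hI₁
      refine ⟨s₂, _, Exec.loop_true hb e₁ e₂, ?_, hI₂⟩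
      calc b.cost + 1 + τ₁ + τ₂ ≤ b.cost + 1 + τ + ((r + 1) * (b.cost + 1) + r * τ) := by omega
        _ = _ := by ring
  exact key m 0 (by omega) s (Frame.refl _ _) h0

/-- The scalar variable stored in cell `0` of the natural-number array `a`. -/
abbrev NExp.var (a : ℕ) : NExp := .get a (.lit 0)

/-- The scalar variable stored in cell `0` of the real array `a`. -/
abbrev RExp.var (a : ℕ) : RExp := .get a (.lit 0)

/-- Assignment to a scalar variable. -/
abbrev Program.setNVar (a : ℕ) (e : NExp) : Program := .setNat a (.lit 0) e

/-- Assignment to a scalar real variable. -/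
abbrev Program.setRVar (a : ℕ) (e : RExp) : Program := .setReal a (.lit 0) e

/-- The loop in which the variable `a` runs from `0` to `e - 1`. -/
def Program.forLoop (a : ℕ) (e : NExp) (c : Program) : Program :=
  .seq (.setNVar a (.lit 0))
    (.loop (.natLt (.var a) e) (.seq c (.setNVar a (.add (.var a) (.lit 1)))))

/-- The time bound for a `forLoop` with `m` passes, each of which takes time `τ`, and a bound of
cost `k`. It also makes sense for polynomials in place of numbers. -/
def forTime {R : Type*} [CommSemiring R] (m k τ : R) : R := 3 + (m + 1) * (k + 4) + m * (τ + 6)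

theorem forTime_mono {m m' k k' τ τ' : ℕ} (hm : m ≤ m') (hk : k ≤ k') (hτ : τ ≤ τ') :
    forTime m k τ ≤ forTime m' k' τ' := by
  unfold forTime; gcongr

/-- The invariant `Inv i` holds after `i` passes. The body must neither write to the counter nor
change the value of the bound `e`. -/
theorem Runs.forLoop {a : ℕ} {e : NExp} {c : Program} {s : Mem} {τ m : ℕ}
    (Inv : ℕ → Mem → Prop) (ha : c.writesNat a = false)
    (he : ∀ s', Frame (.forLoop a e c) s s' → e.eval s' = m)
    (h0 : Inv 0 (s.setNat a 0 0))
    (hstep : ∀ i < m, ∀ s', Frame (.forLoop a e c) s s' → s'.nat a 0 = i → Inv i s' →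
      Runs c s' τ (fun s'' => Inv (i + 1) (s''.setNat a 0 (i + 1)))) :
    Runs (.forLoop a e c) s (forTime m e.cost τ) (Inv m) := by
  have hfr : ∀ {s₁}, Frame (.loop (.natLt (.var a) e)
      (.seq c (.setNVar a (.add (.var a) (.lit 1))))) (s.setNat a 0 0) s₁ →
      Frame (.forLoop a e c) s s₁ := fun h =>
    ((Exec.setNat s a (.lit 0) (.lit 0)).frame.seq_left _).trans (h.seq_right _)
  have h1 : Runs (.setNVar a (.lit 0)) s 3 (fun s' => s' = s.setNat a 0 0) :=
    ⟨_, _, Exec.setNat s a (.lit 0) (.lit 0), by simp [NExp.cost], rfl⟩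
  refine Runs.mono (h1.seq (τ₂ := (m + 1) * (e.cost + 4) + m * (τ + 6))
    (Q := fun s' => s'.nat a 0 = m ∧ Inv m s') ?_) (by unfold forTime; omega)
    fun _ _ h => h.2
  rintro s' - rfl
  have hcost : (BExp.natLt (.var a) e).cost + 1 = e.cost + 4 := by
    simp [BExp.cost, NExp.cost]; omega
  rw [← hcost]
  refine Runs.loop (fun i s' => s'.nat a 0 = i ∧ Inv i s') ⟨by simp, h0⟩ ?_ ?_
  · rintro i hi s' hf ⟨hi', hI⟩
    refine ⟨by simpa [BExp.Holds, NExp.eval, hi', he s' (hfr hf)] using hi, ?_⟩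
    refine (hstep i hi s' (hfr hf) hi' hI).seq (τ₂ := 6) fun s'' hf'' hI'' => ?_
    refine ⟨_, _, Exec.setNat s'' a (.lit 0) (.add (.var a) (.lit 1)), by simp [NExp.cost], ?_⟩
    have hv : (NExp.add (.var a) (.lit 1)).eval s'' = i + 1 := by
      simp [NExp.eval, hf''.nat a ha, hi']
    rw [hv]
    exact ⟨by simp [NExp.eval], hI''⟩
  · rintro s' hf ⟨hi', -⟩
    simp [BExp.Holds, NExp.eval, hi', he s' (hfr hf)]

/-- Programs without loops and subroutine calls. -/
def Program.isFlat : Program → Bool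
  | .seq c₁ c₂ => c₁.isFlat && c₂.isFlat
  | .ite _ c₁ c₂ => c₁.isFlat && c₂.isFlat
  | .loop _ _ => false
  | .call _ _ _ _ _ _ => false
  | _ => true

/-- An upper bound for the running time of a flat program. -/
def Program.flatCost : Program → ℕ
  | .skip => 1
  | .setNat _ i e => i.cost + e.cost + 1
  | .setReal _ i e => i.cost + e.cost + 1
  | .emit e => e.cost + 1
  | .seq c₁ c₂ => c₁.flatCost + c₂.flatCost
  | .ite b c₁ c₂ => b.cost + 1 + (c₁.flatCost + c₂.flatCost)
  | .loop _ _ => 0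
  | .call _ _ _ _ _ _ => 0

open scoped Classical in
/-- The effect of a flat program on the memory. -/
noncomputable def Program.run : Program → Mem → Mem
  | .skip, s => s
  | .setNat a i e, s => s.setNat a (i.eval s) (e.eval s)
  | .setReal a i e, s => s.setReal a (i.eval s) (e.eval s)
  | .emit e, s => s.emit (e.eval s)
  | .seq c₁ c₂, s => c₂.run (c₁.run s)
  | .ite b c₁ c₂, s => if b.Holds s then c₁.run s else c₂.run s
  | .loop _ _, s => s
  | .call _ _ _ _ _ _, s => s

/-- A flat program is executed symbolically. Its `flatCost` is a numeral, so it can be compared with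
round upper bounds such as `50` by `decide`. -/
theorem Runs.flat {c : Program} (hc : c.isFlat = true) {s : Mem} {Q : Mem → Prop}
    (hQ : Q (c.run s)) : Runs c s c.flatCost Q := by
  have key : ∀ (c : Program), c.isFlat = true → ∀ s, ∃ τ, Exec c s (c.run s) τ ∧
      τ ≤ c.flatCost := by
    intro c
    induction c with
    | skip => exact fun _ s => ⟨_, Exec.skip s, le_rfl⟩
    | setNat a i e => exact fun _ s => ⟨_, Exec.setNat s a i e, le_rfl⟩
    | setReal a i e => exact fun _ s => ⟨_, Exec.setReal s a i e, le_rfl⟩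
    | emit e => exact fun _ s => ⟨_, Exec.emit s e, le_rfl⟩
    | seq c₁ c₂ ih₁ ih₂ =>
      intro h s
      rw [Program.isFlat, Bool.and_eq_true] at h
      obtain ⟨τ₁, e₁, l₁⟩ := ih₁ h.1 s
      obtain ⟨τ₂, e₂, l₂⟩ := ih₂ h.2 (c₁.run s)
      exact ⟨_, e₁.seq e₂, add_le_add l₁ l₂⟩
    | ite b c₁ c₂ ih₁ ih₂ =>
      intro h s
      rw [Program.isFlat, Bool.and_eq_true] at h
      obtain ⟨τ₁, e₁, l₁⟩ := ih₁ h.1 s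
      obtain ⟨τ₂, e₂, l₂⟩ := ih₂ h.2 s
      rw [Program.run, Program.flatCost]
      split_ifs with hb
      · exact ⟨_, Exec.ite_true hb e₁, by omega⟩
      · exact ⟨_, Exec.ite_false hb e₂, by omega⟩
    | loop b c => intro h; simp [Program.isFlat] at h
    | call => intro h; simp [Program.isFlat] at h
  obtain ⟨τ, e, l⟩ := key c hc s
  exact ⟨_, τ, e, l, hQ⟩

/-! ### The program -/

/-- `2n`, the number of hops; the variable `0` contains `n`. -/
abbrev hopsExp : NExp := .mul (.lit 2) (.var 0)

/-- The cost of the edge from the vertex `e₁` to the vertex `e₂`. -/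
abbrev costExp (e₁ e₂ : NExp) : RExp := .get 0 (.add (.mul e₁ (.var 0)) e₂)

/-- Lists the copies of the vertices in the natural-number array `2` and counts them in the
variable `1`: the vertex `v` is appended once for every `j < 2n` with `j + 1 ≤ 2n * p v`. -/
def buildCopies : Program :=
  .forLoop 3 (.var 0) (.forLoop 4 hopsExp
    (.ite (.not (.realLt (.mul (.ofNat hopsExp) (.get 0 (.add (.mul (.var 0) (.var 0)) (.var 3))))
        (.ofNat (.add (.var 4) (.lit 1)))))
      (.seq (.setNat 2 (.var 1) (.var 3)) (.setNVar 1 (.add (.var 1) (.lit 1))))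
      .skip))

/-- Removes the costs of the self-loops. -/
def zeroDiag : Program :=
  .forLoop 3 (.var 0) (.setReal 0 (.add (.mul (.var 3) (.var 0)) (.var 3)) (.ofNat (.lit 0)))

/-- Computes the maximum distance of two copies in the real variable `1`. -/
def maxCost : Program :=
  .forLoop 3 (.var 1) (.forLoop 4 (.var 1)
    (.ite (.realLt (.var 1) (costExp (.get 2 (.var 3)) (.get 2 (.var 4))))
      (.setRVar 1 (costExp (.get 2 (.var 3)) (.get 2 (.var 4)))) .skip))

/-- Computes the scaled and rounded costs in the real array `2`. The machine cannot round, so the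
variable `5` counts up from `0` until the scaled cost is reached, which takes at most `N ^ 2` steps;
the test avoids the division by the maximum distance. -/
def roundCosts : Program :=
  .forLoop 3 (.var 1) (.forLoop 4 (.var 1)
    (.seq (.setNVar 5 (.lit 0))
      (.seq (.loop (.realLt (.mul (.ofNat (.var 5)) (.var 1))
          (.mul (.ofNat (.mul (.var 1) (.var 1))) (costExp (.get 2 (.var 3)) (.get 2 (.var 4)))))
          (.setNVar 5 (.add (.var 5) (.lit 1))))
        (.setReal 2 (.add (.mul (.var 3) (.var 1)) (.var 4)) (.ofNat (.var 5))))))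

/-- Solves the scaled instance with the given program, for which `N` and the number of hops are put
into the array `6`. The tour is stored in the array `7`, preceded by its length. -/
def solveScaled (P : Program) : Program :=
  .seq roundCosts
    (.seq (.setNat 6 (.lit 0) (.var 1))
      (.seq (.setNat 6 (.lit 1) hopsExp) (.call P 6 (.lit 2) 2 (.mul (.var 1) (.var 1)) 7)))

/-- Stores the tour that visits the copies in their given order in the array `7`. -/
def trivialTour : Program :=
  .seq (.setNVar 7 (.var 1)) (.forLoop 3 (.var 1) (.setNat 7 (.add (.var 3) (.lit 1)) (.var 3)))

/-- Removes repeated visits from the tour in the array `7`. The array `8` marks the copies that have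
been visited, and the variable `9` counts them. The vertices that are visited are stored in the
array `10`, the probabilities of the positions in the real array `3`. -/
def removeRepetitions : Program :=
  .forLoop 3 (.var 7) (.seq (.setNVar 15 (.get 7 (.add (.var 3) (.lit 1))))
    (.ite (.natEq (.get 8 (.var 15)) (.lit 0))
      (.seq (.setNat 8 (.var 15) (.lit 1))
        (.seq (.setNat 10 (.var 9) (.get 2 (.var 15)))
          (.seq (.setReal 3 (.var 9) (.div (.ofNat (.lit 1)) (.ofNat hopsExp)))
            (.setNVar 9 (.add (.var 9) (.lit 1))))))
      .skip))

/-- Computes the expected cost `pairSum` of the tour in the array `10` in the real variable `4`. For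
each position, the real variable `5` holds the probability that this position is active and none of
the following positions that have been passed is. The variable `14` runs cyclically. -/
def evalCost : Program :=
  .seq (.setRVar 4 (.ofNat (.lit 0)))
    (.forLoop 12 (.var 1)
      (.seq (.setRVar 5 (.get 3 (.var 12)))
        (.seq (.setNVar 14 (.var 12))
          (.forLoop 13 (.sub (.var 1) (.lit 1))
            (.seq (.setNVar 14 (.add (.var 14) (.lit 1)))
              (.seq (.ite (.natEq (.var 14) (.var 1)) (.setNVar 14 (.lit 0)) .skip)
                (.seq (.setRVar 4 (.add (.var 4) (.mul (.mul (.var 5) (.get 3 (.var 14)))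
                    (costExp (.get 10 (.var 12)) (.get 10 (.var 14))))))
                  (.setRVar 5 (.mul (.var 5) (.sub (.ofNat (.lit 1)) (.get 3 (.var 14))))))))))))

/-- Merges the copies of every vertex into one representative. The array `11` stores for every
vertex the successor of the position of its representative, and `0` if there is none. The expected
costs of the two ways to merge are compared in the real variables `6` and `4`. -/
def mergeCopies : Program :=
  .forLoop 3 (.var 1)
    (.ite (.natEq (.get 11 (.get 10 (.var 3))) (.lit 0))
      (.setNat 11 (.get 10 (.var 3)) (.add (.var 3) (.lit 1)))
      (.seq
        (.seq (.setNVar 15 (.sub (.get 11 (.get 10 (.var 3))) (.lit 1)))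
          (.seq (.setRVar 7 (.sub (.add (.get 3 (.var 15)) (.get 3 (.var 3)))
              (.mul (.get 3 (.var 15)) (.get 3 (.var 3)))))
            (.seq (.setReal 3 (.var 15) (.var 7)) (.setReal 3 (.var 3) (.ofNat (.lit 0))))))
        (.seq evalCost
          (.seq
            (.seq (.setRVar 6 (.var 4))
              (.seq (.setReal 3 (.var 15) (.ofNat (.lit 0))) (.setReal 3 (.var 3) (.var 7))))
            (.seq evalCost
              (.ite (.realLt (.var 6) (.var 4))
                (.seq (.setReal 3 (.var 15) (.var 7)) (.setReal 3 (.var 3) (.ofNat (.lit 0))))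
                (.setNat 11 (.get 10 (.var 3)) (.add (.var 3) (.lit 1)))))))))

/-- Writes the representatives to the output tape. -/
def emitHeavy : Program :=
  .forLoop 3 (.var 1)
    (.ite (.natEq (.get 11 (.get 10 (.var 3))) (.add (.var 3) (.lit 1)))
      (.emit (.get 10 (.var 3))) .skip)

/-- Writes the vertices without a representative to the output tape. -/
def emitLight : Program :=
  .forLoop 3 (.var 0) (.ite (.natEq (.get 11 (.var 3)) (.lit 0)) (.emit (.var 3)) .skip)

/-- Computes a tour of the vertices that have copies. -/
def heavyPhase (P : Program) : Program :=
  .seq zeroDiag (.seq maxCost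
    (.seq (.ite (.realLt (.ofNat (.lit 0)) (.var 1)) (solveScaled P) trivialTour)
      (.seq removeRepetitions (.seq mergeCopies emitHeavy))))

/-- The algorithm for Asymmetric A Priori TSP that uses an algorithm `P` for Hop-ATSP. The hop
instance is only set up if `n ≥ 64` and if there are more than `2n` copies. The first condition
makes `n` times the running time of `P` pay for scanning its output, the second one ensures that the
number of hops is less than the number of copies. -/
def reduction (P : Program) : Program :=
  .seq buildCopies
    (.seq (.ite (.and (.natLt (.lit 63) (.var 0)) (.natLt hopsExp (.var 1))) (heavyPhase P) .skip)
      emitLight)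

/-! ### Correctness of the parts -/

/-- The index of a matrix entry in row-major order determines the entry. -/
theorem index_inj {n u v u' v' : ℕ} (hv : v < n) (hv' : v' < n) :
    u * n + v = u' * n + v' ↔ u = u' ∧ v = v' := by
  constructor
  · intro h
    have hn : 0 < n := by omega
    have h1 : (u * n + v) / n = u := by
      rw [mul_comm, Nat.mul_add_div hn, Nat.div_eq_of_lt hv, add_zero]
    have h2 : (u' * n + v') / n = u' := by
      rw [mul_comm, Nat.mul_add_div hn, Nat.div_eq_of_lt hv', add_zero]
    have h3 : u = u' := by rw [← h1, ← h2, h]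
    subst h3
    exact ⟨rfl, by omega⟩
  · rintro ⟨rfl, rfl⟩; rfl

/-- The array `f` starts with the entries of the list `l`. -/
def IsArray (f : ℕ → ℕ) (l : List ℕ) : Prop := ∀ i < l.length, f i = l.getD i 0

theorem IsArray.append {f g : ℕ → ℕ} {l : List ℕ} {v : ℕ} (h : IsArray f l)
    (hg : ∀ j, g j = if j = l.length then v else f j) : IsArray g (l ++ [v]) := by
  intro i hi
  rw [hg]
  rcases Nat.lt_or_ge i l.length with h' | h'
  · rw [if_neg h'.ne, h i h', List.getD_append _ _ _ _ h']
  · have : i = l.length := by simp at hi; omega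
    subst this
    simp

section Parts

variable {n : ℕ}

theorem copyList_map_val (p : Fin n → ℝ) :
    (copyList p).map Fin.val = (List.range n).flatMap fun v =>
      List.replicate (if h : v < n then copies p ⟨v, h⟩ else 0) v := by
  rw [copyList, List.map_flatMap, ← List.map_coe_finRange_eq_range, List.flatMap_map]
  simp

theorem runs_buildCopies {p : Fin n → ℝ} {s : Mem} (hn : s.nat 0 0 = n)
    (h0 : ∀ v, 0 ≤ p v) (h1 : ∀ v, p v ≤ 1) (hp : ∀ v : Fin n, s.real 0 (n * n + v) = p v)
    (hN : s.nat 1 0 = 0) :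
    Runs buildCopies s (forTime n 50 (forTime (2 * n) 50 50)) fun s' =>
      s'.nat 1 0 = (copyList p).length ∧ IsArray (s'.nat 2) ((copyList p).map Fin.val) := by
  set mult : ℕ → ℕ := fun v => if h : v < n then copies p ⟨v, h⟩ else 0 with hmult
  set pre : ℕ → List ℕ := fun i => (List.range i).flatMap fun v => List.replicate (mult v) v
    with hpre
  set Inv : List ℕ → Mem → Prop := fun l s' => s'.nat 1 0 = l.length ∧ IsArray (s'.nat 2) l
    with hInv
  have main : Runs buildCopies s (forTime n (NExp.var 0).cost (forTime (2 * n) hopsExp.cost 50))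
      (Inv (pre n)) := by
    refine Runs.forLoop (fun i => Inv (pre i)) rfl (fun s' hf => ?_) ?_ ?_
    · rw [← hn, ← hf.nat 0 rfl]; rfl
    · exact ⟨by simp [hN, hpre], fun i hi => by simp [hpre] at hi⟩
    · intro i hi s₁ hf₁ hi₁ hI₁
      have hn₁ : s₁.nat 0 0 = n := by rw [hf₁.nat 0 rfl, hn]
      have hp₁ : ∀ v : Fin n, s₁.real 0 (n * n + v) = p v := by rw [hf₁.real 0 rfl]; exact hp
      have hmi : mult i = copies p ⟨i, hi⟩ := by simp [hmult, hi]
      have inner := Runs.forLoop (a := 4) (e := hopsExp) (s := s₁) (τ := 50) (m := 2 * n)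
        (c := .ite (.not (.realLt (.mul (.ofNat hopsExp)
          (.get 0 (.add (.mul (.var 0) (.var 0)) (.var 3)))) (.ofNat (.add (.var 4) (.lit 1)))))
          (.seq (.setNat 2 (.var 1) (.var 3)) (.setNVar 1 (.add (.var 1) (.lit 1)))) .skip)
        (fun j => Inv (pre i ++ List.replicate (min j (mult i)) i)) rfl
        (fun s' hf => by simp [NExp.eval, hf.nat 0 rfl, hn₁])
        (by simpa [hInv] using hI₁) ?_
      · refine inner.mono le_rfl fun s₂ hf₂ hI₂ => ?_
        have hmin : min (2 * n) (mult i) = mult i :=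
          min_eq_right (by rw [hmi]; exact copies_le h1 _)
        rw [hmin] at hI₂
        have : pre (i + 1) = pre i ++ List.replicate (mult i) i := by
          simp [hpre, List.range_succ]
        rw [this]
        simpa [hInv] using hI₂
      · intro j hj s₂ hf₂ hj₂ hI₂
        refine (Runs.flat rfl ?_).mono (by decide) fun _ _ h => h
        have hn₂ : s₂.nat 0 0 = n := by rw [hf₂.nat 0 rfl, hn₁]
        have hi₂ : s₂.nat 3 0 = i := by rw [hf₂.nat 3 rfl, hi₁]
        have hp₂ : s₂.real 0 (n * n + i) = p ⟨i, hi⟩ := by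
          rw [hf₂.real 0 rfl]; exact hp₁ ⟨i, hi⟩
        have htest : (2 * (n : ℝ) * p ⟨i, hi⟩ < (j : ℝ) + 1) ↔ mult i ≤ j := by
          have := Nat.floor_lt (n := j + 1) (show 0 ≤ 2 * (n : ℝ) * p ⟨i, hi⟩ by
            have := h0 ⟨i, hi⟩; positivity)
          rw [hmi, copies, ← Nat.lt_succ_iff, Nat.succ_eq_add_one, this]
          push_cast; rfl
        simp only [Program.run, BExp.Holds, RExp.eval, NExp.eval, hn₂, hi₂, hj₂, hp₂]
        push_cast
        simp only [htest]
        split_ifs with hlt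
        swap
        · have e : min (j + 1) (mult i) = min j (mult i) + 1 := by omega
          rw [e, List.replicate_succ', ← List.append_assoc]
          refine ⟨by have := hI₂.1; simp at this ⊢; omega, ?_⟩
          refine hI₂.2.append fun k => ?_
          simp [hI₂.1]
        · have e : min (j + 1) (mult i) = min j (mult i) := by omega
          rw [e]
          simpa [hInv] using hI₂
  refine main.mono (forTime_mono le_rfl (by decide) (forTime_mono le_rfl (by decide) le_rfl))
    fun s' _ h => ?_
  have e : pre n = (copyList p).map Fin.val := (copyList_map_val p).symm
  rw [e] at h
  exact ⟨by simpa using h.1, h.2⟩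

/-- The variable `0` contains `n`, and the real array `0` starts with the cost matrix `c`. -/
def HasCosts (s : Mem) (c : Fin n → Fin n → ℝ) : Prop :=
  s.nat 0 0 = n ∧ ∀ u v : Fin n, s.real 0 (u * n + v) = c u v

theorem runs_zeroDiag {c : Fin n → Fin n → ℝ} {s : Mem} (hc : HasCosts s c) :
    Runs zeroDiag s (forTime n 50 50) fun s' => HasCosts s' (offDiag c) := by
  have main : Runs zeroDiag s (forTime n (NExp.var 0).cost 50) fun s' =>
      ∀ u v : Fin n, s'.real 0 (u * n + v) = if u = v ∧ (u : ℕ) < n then 0 else c u v := by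
    refine Runs.forLoop (fun i s' => ∀ u v : Fin n, s'.real 0 (u * n + v)
      = if u = v ∧ (u : ℕ) < i then 0 else c u v) rfl (fun s' hf => ?_) ?_ ?_
    · rw [← hc.1, ← hf.nat 0 rfl]; rfl
    · intro u v; simpa using hc.2 u v
    · intro i hi s₁ hf₁ hi₁ hI₁
      refine (Runs.flat rfl ?_).mono (by decide) fun _ _ h => h
      have hn₁ : s₁.nat 0 0 = n := by rw [hf₁.nat 0 rfl, hc.1]
      intro u v
      simp only [Program.run, NExp.eval, RExp.eval, hn₁, hi₁, Mem.setReal_real, Mem.setNat_real,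
        index_inj v.2 hi, hI₁, Fin.ext_iff]
      by_cases huv : (u : ℕ) = v
      · by_cases hui : (u : ℕ) = i
        · simp [← huv, hui]
        · have : (u : ℕ) < i + 1 ↔ (u : ℕ) < i := by omega
          simp [hui, this]
      · have : ¬ ((u : ℕ) = i ∧ (v : ℕ) = i) := by omega
        simp [this, huv]
  refine main.mono (forTime_mono le_rfl (by decide) le_rfl) fun s' hf h => ⟨?_, fun u v => ?_⟩
  · rw [hf.nat 0 rfl, hc.1]
  · rw [h u v]; simp [offDiag]

theorem HasCosts.eval {c : Fin n → Fin n → ℝ} {s : Mem} (hc : HasCosts s c) {e₁ e₂ : NExp}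
    {u v : Fin n} (hu : e₁.eval s = u) (hv : e₂.eval s = v) :
    (costExp e₁ e₂).eval s = c u v := by
  simp [RExp.eval, NExp.eval, hu, hv, hc.1, hc.2]

theorem HasCosts.of_frame {c : Fin n → Fin n → ℝ} {s s' : Mem} (hc : HasCosts s c) {P : Program}
    (hf : Frame P s s') (h1 : P.writesNat 0 = false) (h2 : P.writesReal 0 = false) :
    HasCosts s' c := ⟨by rw [hf.nat 0 h1]; exact hc.1, by rw [hf.real 0 h2]; exact hc.2⟩

/-- The array `2` starts with the list of all copies, and the variable `1` contains their number. -/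
def HasCopies (s : Mem) (p : Fin n → ℝ) : Prop :=
  s.nat 1 0 = (copyList p).length ∧ IsArray (s.nat 2) ((copyList p).map Fin.val)

theorem HasCopies.of_frame {p : Fin n → ℝ} {s s' : Mem} (hc : HasCopies s p) {P : Program}
    (hf : Frame P s s') (h1 : P.writesNat 1 = false) (h2 : P.writesNat 2 = false) :
    HasCopies s' p := ⟨by rw [hf.nat 1 h1]; exact hc.1, by rw [hf.nat 2 h2]; exact hc.2⟩

theorem HasCopies.get {p : Fin n → ℝ} {s : Mem} (hc : HasCopies s p)
    (x : Fin (copyList p).length) : s.nat 2 x = (copyList p).get x := by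
  rw [hc.2 x (by simp)]
  simp

theorem HasCopies.eval {c : Fin n → Fin n → ℝ} {p : Fin n → ℝ} {s : Mem} (hp : HasCopies s p)
    (hc : HasCosts s c) {a b : ℕ} {x y : Fin (copyList p).length} (hx : s.nat a 0 = x)
    (hy : s.nat b 0 = y) :
    (costExp (.get 2 (.var a)) (.get 2 (.var b))).eval s = copyCost c p x y :=
  hc.eval (by simp [NExp.eval, hx, hp.get x]) (by simp [NExp.eval, hy, hp.get y])

theorem runs_maxCost {c : Fin n → Fin n → ℝ} {p : Fin n → ℝ} {s : Mem} (hc : HasCosts s c)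
    (hp : HasCopies s p) (h0 : s.real 1 0 = 0) :
    Runs maxCost s (forTime (copyList p).length 50 (forTime (copyList p).length 50 50)) fun s' =>
      (∀ x y, copyCost c p x y ≤ s'.real 1 0) ∧
        (s'.real 1 0 = 0 ∨ ∃ x y, copyCost c p x y = s'.real 1 0) := by
  set N := (copyList p).length with hN
  set Inv : ℕ → ℕ → Mem → Prop := fun i j s' =>
    (∀ x y : Fin N, ((x : ℕ) < i ∨ (x : ℕ) = i ∧ (y : ℕ) < j) → copyCost c p x y ≤ s'.real 1 0) ∧
      (s'.real 1 0 = 0 ∨ ∃ x y, copyCost c p x y = s'.real 1 0) with hInv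
  have main : Runs maxCost s (forTime N (NExp.var 1).cost (forTime N (NExp.var 1).cost 50))
      (Inv N 0) := by
    refine Runs.forLoop (fun i => Inv i 0) rfl (fun s' hf => ?_) ?_ ?_
    · rw [hN, ← hp.1, ← hf.nat 1 rfl]; rfl
    · exact ⟨fun x y h => by omega, Or.inl (by simpa using h0)⟩
    · intro i hi s₁ hf₁ hi₁ hI₁
      have hc₁ := hc.of_frame hf₁ rfl rfl
      have hp₁ := hp.of_frame hf₁ rfl rfl
      refine (Runs.forLoop (τ := 50) (m := N) (Inv i) rfl (fun s' hf => ?_) ?_ ?_).mono le_rfl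
        fun s₂ hf₂ hI₂ => ?_
      · rw [hN, ← hp₁.1, ← hf.nat 1 rfl]; rfl
      · exact hI₁
      · intro j hj s₂ hf₂ hj₂ hI₂
        refine (Runs.flat rfl ?_).mono (by decide) fun _ _ h => h
        have hc₂ := hc₁.of_frame hf₂ rfl rfl
        have hp₂ := hp₁.of_frame hf₂ rfl rfl
        have hi₂ : s₂.nat 3 0 = i := by rw [hf₂.nat 3 rfl, hi₁]
        have hv := hp₂.eval hc₂ (x := ⟨i, hi⟩) (y := ⟨j, hj⟩) hi₂ hj₂
        simp only [Program.run, BExp.Holds, hv]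
        have hM : (RExp.var 1).eval s₂ = s₂.real 1 0 := by simp [RExp.eval, NExp.eval]
        rw [hM]
        split_ifs with hlt
        · refine ⟨fun x y hxy => ?_, Or.inr ⟨⟨i, hi⟩, ⟨j, hj⟩, by simp [NExp.eval]⟩⟩
          simp only [NExp.eval, Mem.setNat_real, Mem.setReal_real, and_self, if_true]
          by_cases hxy' : (x : ℕ) = i ∧ (y : ℕ) = j
          · have hx : x = ⟨i, hi⟩ := Fin.ext hxy'.1
            have hy : y = ⟨j, hj⟩ := Fin.ext hxy'.2
            rw [hx, hy]
          · exact (hI₂.1 x y (by omega)).trans hlt.le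
        · refine ⟨fun x y hxy => ?_, hI₂.2⟩
          simp only [Mem.setNat_real]
          by_cases hxy' : (x : ℕ) = i ∧ (y : ℕ) = j
          · have hx : x = ⟨i, hi⟩ := Fin.ext hxy'.1
            have hy : y = ⟨j, hj⟩ := Fin.ext hxy'.2
            rw [hx, hy]
            exact not_lt.1 hlt
          · exact hI₂.1 x y (by omega)
      · exact ⟨fun x y h => hI₂.1 x y (by have := y.2; omega), hI₂.2⟩
  refine main.mono (forTime_mono le_rfl (by decide) (forTime_mono le_rfl (by decide) le_rfl))
    fun s' _ h => ⟨fun x y => h.1 x y (Or.inl x.2), h.2⟩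

theorem runs_roundCosts {c : Fin n → Fin n → ℝ} {p : Fin n → ℝ} {s : Mem} (hc : HasCosts s c)
    (hp : HasCopies s p) (hM : 0 < s.real 1 0) (hle : ∀ x y, copyCost c p x y ≤ s.real 1 0) :
    Runs roundCosts s (forTime (copyList p).length 50 (forTime (copyList p).length 50
      (100 + 100 * (copyList p).length ^ 2))) fun s' =>
      ∀ x y : Fin (copyList p).length, s'.real 2 (x * (copyList p).length + y)
        = scaledCost (copyCost c p) (s.real 1 0) x y := by
  set N := (copyList p).length with hN
  set M := s.real 1 0 with hMdef
  set Inv : ℕ → ℕ → Mem → Prop := fun i j s' =>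
    ∀ x y : Fin N, ((x : ℕ) < i ∨ (x : ℕ) = i ∧ (y : ℕ) < j) →
      s'.real 2 (x * N + y) = scaledCost (copyCost c p) M x y with hInv
  have main : Runs roundCosts s (forTime N (NExp.var 1).cost (forTime N (NExp.var 1).cost
      (100 + 100 * N ^ 2))) (Inv N 0) := by
    refine Runs.forLoop (fun i => Inv i 0) rfl (fun s' hf => ?_) ?_ ?_
    · rw [hN, ← hp.1, ← hf.nat 1 rfl]; rfl
    · intro x y h; omega
    · intro i hi s₁ hf₁ hi₁ hI₁
      have hc₁ := hc.of_frame hf₁ rfl rfl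
      have hp₁ := hp.of_frame hf₁ rfl rfl
      have hM₁ : s₁.real 1 0 = M := by rw [hf₁.real 1 rfl]
      refine (Runs.forLoop (τ := 100 + 100 * N ^ 2) (m := N) (Inv i) rfl (fun s' hf => ?_) ?_
        ?_).mono le_rfl fun s₂ hf₂ hI₂ => ?_
      · rw [hN, ← hp₁.1, ← hf.nat 1 rfl]; rfl
      · exact hI₁
      · intro j hj s₂ hf₂ hj₂ hI₂
        have hc₂ := hc₁.of_frame hf₂ rfl rfl
        have hp₂ := hp₁.of_frame hf₂ rfl rfl
        have hM₂ : s₂.real 1 0 = M := by rw [hf₂.real 1 rfl, hM₁]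
        have hi₂ : s₂.nat 3 0 = i := by rw [hf₂.nat 3 rfl, hi₁]
        set x : Fin N := ⟨i, hi⟩
        set y : Fin N := ⟨j, hj⟩
        set g := scaledCost (copyCost c p) M x y with hg
        have hgN : g ≤ N ^ 2 := by
          refine Nat.ceil_le.2 ?_
          rw [div_le_iff₀ hM]
          push_cast
          exact mul_le_mul_of_nonneg_left (hle x y) (by positivity)
        have step₁ : Runs (.setNVar 5 (.lit 0)) s₂ 10 fun s' => s'.nat 5 0 = 0 :=
          (Runs.flat rfl (by simp [Program.run, NExp.eval])).mono (by decide) fun _ _ h => h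
        refine (step₁.seq fun s₃ hf₃ h₃ => ?_).mono
          (show 10 + (((g + 1) * (28 + 1) + g * 10) + 40) ≤ _ by nlinarith) fun _ _ h => h
        have hc₃ := hc₂.of_frame hf₃ rfl rfl
        have hp₃ := hp₂.of_frame hf₃ rfl rfl
        have hM₃ : s₃.real 1 0 = M := by rw [hf₃.real 1 rfl, hM₂]
        have hi₃ : s₃.nat 3 0 = x := by rw [hf₃.nat 3 rfl, hi₂]
        have hj₃ : s₃.nat 4 0 = y := by rw [hf₃.nat 4 rfl, hj₂]
        have htest : ∀ s', Frame (.loop (.realLt (.mul (.ofNat (.var 5)) (.var 1))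
            (.mul (.ofNat (.mul (.var 1) (.var 1))) (costExp (.get 2 (.var 3)) (.get 2 (.var 4)))))
            (.setNVar 5 (.add (.var 5) (.lit 1)))) s₃ s' →
            (BExp.Holds s' (.realLt (.mul (.ofNat (.var 5)) (.var 1))
            (.mul (.ofNat (.mul (.var 1) (.var 1))) (costExp (.get 2 (.var 3)) (.get 2 (.var 4)))))
            ↔ s'.nat 5 0 < g) := by
          intro s' hf
          have hv := (hp₃.of_frame hf rfl rfl).eval (hc₃.of_frame hf rfl rfl)
            (by rw [hf.nat 3 rfl, hi₃]) (by rw [hf.nat 4 rfl, hj₃])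
          have e1 : s'.real 1 0 = M := by rw [hf.real 1 rfl, hM₃]
          have e2 : s'.nat 1 0 = N := by rw [hf.nat 1 rfl, hp₃.1]
          simp only [BExp.Holds, RExp.eval, NExp.eval, e1, e2] at hv ⊢
          rw [hv, hg, scaledCost, Nat.lt_ceil, lt_div_iff₀ hM]
          push_cast
          rw [← sq]
        have step₂ := Runs.loop (s := s₃) (τ := 10) (m := g)
          (b := .realLt (.mul (.ofNat (.var 5)) (.var 1))
            (.mul (.ofNat (.mul (.var 1) (.var 1))) (costExp (.get 2 (.var 3)) (.get 2 (.var 4)))))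
          (c := .setNVar 5 (.add (.var 5) (.lit 1)))
          (fun k s' => s'.nat 5 0 = k) h₃
          (fun k hk s' hf hk' => ⟨(htest s' hf).2 (by rw [hk']; exact hk),
            (Runs.flat rfl (by simp [Program.run, NExp.eval, hk'])).mono (by decide)
              fun _ _ h => h⟩)
          (fun s' hf hk' => by rw [htest s' hf, hk']; exact lt_irrefl _)
        refine (step₂.mono (by gcongr; decide) fun _ _ h => h).seq fun s₄ hf₄ h₄ => ?_
        refine (Runs.flat rfl ?_).mono (by decide) fun _ _ h => h
        have e1 : s₄.nat 1 0 = N := by rw [hf₄.nat 1 rfl, hp₃.1]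
        have e3 : s₄.nat 3 0 = i := by rw [hf₄.nat 3 rfl, hi₃]
        have e4 : s₄.nat 4 0 = j := by rw [hf₄.nat 4 rfl, hj₃]
        have e2 : s₄.real 2 = s₂.real 2 := by rw [hf₄.real 2 rfl, hf₃.real 2 rfl]
        intro x' y' hxy
        simp only [Program.run, NExp.eval, RExp.eval, e1, e3, e4, h₄, Mem.setNat_real,
          Mem.setReal_real, index_inj y'.2 hj, true_and]
        split_ifs with hxy'
        · rw [show x' = x from Fin.ext hxy'.1, show y' = y from Fin.ext hxy'.2]
        · rw [e2]; exact hI₂ x' y' (by omega)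
      · exact fun x y h => hI₂ x y (by have := y.2; omega)
  exact main.mono (forTime_mono le_rfl (by decide) (forTime_mono le_rfl (by decide) le_rfl))
    fun s' _ h x y => h x y (Or.inl x.2)

/-- The array `7` stores the closed walk `T`, preceded by its length. -/
def HasTour {N : ℕ} (s : Mem) (T : List (Fin N)) : Prop :=
  s.nat 7 0 = T.length ∧ ∀ (i : ℕ) (h : i < T.length), s.nat 7 (i + 1) = T[i]

theorem runs_trivialTour {N : ℕ} {s : Mem} (hN : s.nat 1 0 = N) :
    Runs trivialTour s (50 + forTime N 50 50) fun s' => HasTour s' (List.finRange N) := by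
  have h1 : Runs (.setNVar 7 (.var 1)) s 50 fun s' => s'.nat 7 0 = N :=
    (Runs.flat rfl (by simp [Program.run, NExp.eval, hN])).mono (by decide) fun _ _ h => h
  refine h1.seq fun s₁ hf₁ h₁ => ?_
  have hN₁ : s₁.nat 1 0 = N := by rw [hf₁.nat 1 rfl, hN]
  have h2 := Runs.forLoop (a := 3) (e := .var 1) (c := .setNat 7 (.add (.var 3) (.lit 1)) (.var 3))
    (s := s₁) (m := N) (τ := 50)
    (fun i s' => s'.nat 7 0 = N ∧ ∀ k < i, s'.nat 7 (k + 1) = k) rfl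
    (fun s' hf => by rw [← hN₁, ← hf.nat 1 rfl]; rfl) (by simpa using h₁)
    (fun i hi s' hf hi' hI => (Runs.flat rfl (by
      simp only [Program.run, NExp.eval, hi', Mem.setNat_nat]
      refine ⟨by simpa using hI.1, fun k hk => ?_⟩
      by_cases hki : k = i
      · simp [hki]
      · simpa [hki] using hI.2 k (by omega))).mono (by decide) fun _ _ h => h)
  refine h2.mono (forTime_mono le_rfl (by decide) le_rfl) fun s' _ h => ⟨by simpa using h.1, ?_⟩
  intro i hi
  rw [List.length_finRange] at hi
  rw [h.2 i hi]
  simp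

/-- The scaled instance is passed to the subroutine correctly, and the tour that it returns is
good for the unrounded costs, too. -/
theorem runs_solveScaled {P : Program} {α : ℕ → ℝ} {t : ℕ → ℕ}
    (hP : ApproximatesWellScaledHop P α t) {c : Fin n → Fin n → ℝ} (h0 : ∀ x y, 0 ≤ c x y)
    (h3 : ∀ x y z, c x z ≤ c x y + c y z) {p : Fin n → ℝ} {s : Mem} (hα : ∀ m, 1 ≤ α m)
    (hc : HasCosts s c) (hp : HasCopies s p) (hM : 0 < s.real 1 0)
    (hle : ∀ x y, copyCost c p x y ≤ s.real 1 0) (hmax : ∃ x y, copyCost c p x y = s.real 1 0)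
    (hn : 0 < n) (hN : 2 * n < (copyList p).length) :
    Runs (solveScaled P) s (forTime (copyList p).length 50 (forTime (copyList p).length 50
      (100 + 100 * (copyList p).length ^ 2)) + (20 + (20 +
        (50 + (copyList p).length ^ 2 + 2 * t (copyList p).length)))) fun s' =>
      ∃ T : List (Fin (copyList p).length), HasTour s' T ∧ IsTour T ∧
        T.length ≤ t (copyList p).length ∧
        ∀ U : List (Fin (copyList p).length), U.Nodup → IsTour U →
          hopCost (copyCost c p) (2 * n) T
            ≤ 2 * α (copyList p).length * hopCost (copyCost c p) (2 * n) U := by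
  set N := (copyList p).length with hNdef
  have hcc3 : ∀ x y z, copyCost c p x z ≤ copyCost c p x y + copyCost c p y z :=
    fun _ _ _ => h3 _ _ _
  set I := scaledInstance (copyCost c p) hcc3 hM hN with hI
  refine (runs_roundCosts hc hp hM hle).seq fun s₁ hf₁ h₁ => ?_
  have hp₁ := hp.of_frame hf₁ rfl rfl
  have hc₁ := hc.of_frame hf₁ rfl rfl
  have st2 : Runs (.setNat 6 (.lit 0) (.var 1)) s₁ 20 fun s' => s'.nat 6 0 = N :=
    (Runs.flat rfl (by simp [Program.run, NExp.eval, hp₁.1, hNdef])).mono (by decide)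
      fun _ _ h => h
  refine st2.seq fun s₂ hf₂ h₂ => ?_
  have st3 : Runs (.setNat 6 (.lit 1) hopsExp) s₂ 20
      fun s' => s'.nat 6 0 = N ∧ s'.nat 6 1 = 2 * n :=
    (Runs.flat rfl (by simp [Program.run, NExp.eval, h₂, hf₂.nat 0 rfl, hc₁.1])).mono (by decide)
      fun _ _ h => h
  refine st3.seq fun s₃ hf₃ h₃ => ?_
  obtain ⟨T, ⟨s', τ', hex, hτ, hout⟩, hT, hcost⟩ : ∃ T : List (Fin N),
      (∃ s' τ', Exec P I.input s' τ' ∧ τ' ≤ t N ∧ s'.out = T.map Fin.val) ∧ IsTour T ∧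
        hopCost I.c (2 * n) T ≤ α N * I.opt :=
    hP I (scaledInstance_wellScaled hcc3 hM hN (by omega) hle hmax)
  have hN₃ : s₃.nat 1 0 = N := by
    rw [hf₃.nat 1 rfl, hf₂.nat 1 rfl, hp₁.1]
  have hr₃ : ∀ x y : Fin N,
      s₃.real 2 (x * N + y) = scaledCost (copyCost c p) (s.real 1 0) x y := by
    rw [hf₃.real 2 rfl, hf₂.real 2 rfl]; exact h₁
  have hframe : s₃.frame 6 ((NExp.lit 2).eval s₃) 2
      ((NExp.mul (.var 1) (.var 1)).eval s₃) = I.input := by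
    have e1 : (List.range 2).map (s₃.nat 6) = [N, 2 * n] := by
      simp [List.range_succ, h₃.1, h₃.2]
    have e2 : (List.range (N * N)).map (s₃.real 2) = costList I.c := by
      refine List.ext_getElem (by simp [costList]; rfl) fun i hi₁ hi₂ => ?_
      simp only [List.length_map, List.length_range] at hi₁
      have hNpos : 0 < N := by omega
      have hdm := hr₃ ⟨i / N, Nat.div_lt_of_lt_mul hi₁⟩ ⟨i % N, Nat.mod_lt _ hNpos⟩
      simp only [Nat.div_add_mod'] at hdm
      simp only [List.getElem_map, List.getElem_range, hdm, costList, List.getElem_ofFn]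
      rfl
    simp only [Mem.frame, NExp.eval, hN₃, HopInstance.input, e1, e2]
    rfl
  refine ⟨_, _, Exec.call (by rw [hframe]; exact hex), ?_, T, ⟨?_, ?_⟩, hT, ?_, ?_⟩
  · have hl : s'.out.length ≤ t N := by
      have := hex.length_out_le
      simp only [HopInstance.input, Mem.input, List.length_nil, zero_add] at this
      exact this.trans hτ
    simp only [NExp.cost, NExp.eval, hN₃]
    change _ ≤ 50 + N ^ 2 + 2 * t N
    rw [sq]
    omega
  · have : s'.out.length = T.length := by rw [hout, List.length_map]
    simpa [Mem.storeList] using this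
  · intro i hi
    simp only [Mem.storeList, Function.update_self]
    rw [hout, if_neg (by omega), Nat.add_sub_cancel]
    rw [List.getD_eq_getElem _ _ (by simpa using hi), List.getElem_map]
  · have := hex.length_out_le
    simp only [HopInstance.input, Mem.input, List.length_nil, zero_add] at this
    rw [hout, List.length_map] at this
    exact this.trans hτ
  · intro U hUn hU
    exact hopCost_le_of_scaled (fun _ _ => h0 _ _) hcc3 hM hN (by omega) hmax
      (zero_le_one.trans (hα N)) hcost hUn hU

/-- The time bound is linear in the length of the given tour with an explicit constant, since this
length is only bounded by the running time of the subroutine. -/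
theorem runs_removeRepetitions {p : Fin n → ℝ} {s : Mem} {T : List (Fin (copyList p).length)}
    (hn : s.nat 0 0 = n) (hp : HasCopies s p) (hT : HasTour s T) (h8 : ∀ i, s.nat 8 i = 0)
    (h9 : s.nat 9 0 = 0) :
    Runs removeRepetitions s (forTime T.length 2 41) fun s' =>
      ∃ U : List (Fin (copyList p).length), U.Nodup ∧ U.Sublist T ∧ (∀ y, y ∈ U ↔ y ∈ T) ∧
        IsArray (s'.nat 10) (U.map fun y => ((copyList p).get y : ℕ)) ∧
        ∀ k < U.length, s'.real 3 k = unitProb n := by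
  set Inv : ℕ → Mem → Prop := fun i s' => ∃ U : List (Fin (copyList p).length), U.Nodup ∧
    U.Sublist (T.take i) ∧ (∀ y, y ∈ U ↔ y ∈ T.take i) ∧
    IsArray (s'.nat 10) (U.map fun y => ((copyList p).get y : ℕ)) ∧
    (∀ k < U.length, s'.real 3 k = unitProb n) ∧ s'.nat 9 0 = U.length ∧
    ∀ y : Fin (copyList p).length, s'.nat 8 y = 0 ↔ y ∉ U with hInv
  have main : Runs removeRepetitions s (forTime T.length (NExp.var 7).cost 41) (Inv T.length) := by
    refine Runs.forLoop Inv rfl (fun s' hf => ?_) ?_ ?_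
    · rw [← hT.1, ← hf.nat 7 rfl]; rfl
    · exact ⟨[], by simp, by simp, by simp, fun i hi => by simp at hi, by simp, by simp [h9],
        by simp [h8]⟩
    · rintro i hi s₁ hf₁ hi₁ ⟨U, hUn, hUs, hUm, h10, hr, h9', h8'⟩
      have hn₁ : s₁.nat 0 0 = n := by rw [hf₁.nat 0 rfl, hn]
      have hp₁ := hp.of_frame hf₁ rfl rfl
      set y := T[i] with hy
      have h7 : s₁.nat 7 (i + 1) = y := by
        rw [hf₁.nat 7 rfl, hT.2 i hi]
      have htake : T.take (i + 1) = T.take i ++ [y] := by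
        rw [List.take_add_one]; simp [hi, hy]
      have hq : (1 : ℝ) / ((2 * n : ℕ) : ℝ) = unitProb n := by
        rw [unitProb]; push_cast; rfl
      refine (Runs.flat rfl ?_).mono (by decide) fun _ _ h => h
      simp only [Program.run, BExp.Holds, NExp.eval, RExp.eval, hi₁, h7, Mem.setNat_nat,
        and_self, if_true, and_true, hn₁, h9', Mem.setReal_nat]
      norm_num only [if_false, false_and]
      by_cases hyU : y ∈ U
      · rw [if_neg (mt (h8' y).1 (by simpa using hyU))]
        refine ⟨U, hUn, ?_, ?_, ?_, ?_, ?_, ?_⟩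
        · rw [htake]; exact hUs.trans (List.sublist_append_left _ _)
        · intro z
          rw [hUm, htake, List.mem_append, List.mem_singleton]
          constructor
          · exact Or.inl
          · rintro (h | rfl)
            · exact h
            · exact (hUm _).1 hyU
        · simpa using h10
        · simpa using hr
        · simpa using h9'
        · simpa using h8'
      · rw [if_pos ((h8' y).2 hyU)]
        refine ⟨U ++ [y], ?_, ?_, ?_, ?_, ?_, ?_, ?_⟩
        · rw [List.nodup_append]
          exact ⟨hUn, by simp, fun a ha b hb => by
            rw [List.mem_singleton] at hb; rintro rfl; exact hyU (hb ▸ ha)⟩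
        · rw [htake]; exact hUs.append (List.Sublist.refl _)
        · intro z; rw [htake, List.mem_append, List.mem_append, hUm]
        · rw [List.map_append]
          refine h10.append fun k => ?_
          simp [hp₁.get]
        · intro k hk
          rw [List.length_append, List.length_singleton] at hk
          simp only [Mem.setNat_real, Mem.setReal_real, true_and]
          by_cases hkU : k = U.length
          · rw [if_pos hkU]; simpa [hn₁] using hq
          · rw [if_neg hkU]; exact hr k (by omega)
        · simp
        · intro z
          by_cases hzy : z = y
          · simp [hzy]
          · have : (z : ℕ) ≠ y := fun h => hzy (Fin.ext h)
            simp [hzy, this, h8']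
  refine main.mono le_rfl fun s' _ h => ?_
  obtain ⟨U, hUn, hUs, hUm, h10, hr, -⟩ := h
  rw [List.take_length] at hUs hUm
  exact ⟨U, hUn, hUs, hUm, h10, hr⟩

/-- The memory holds the tour `x` of length `N` with the probabilities `w`. -/
structure HasWeightedTour (s : Mem) (x : ℕ → Fin n) (w : ℕ → ℝ) (N : ℕ) : Prop where
  size : s.nat 1 0 = N
  vertex : ∀ i < N, s.nat 10 i = x i
  weight : ∀ i < N, s.real 3 i = w i

theorem HasWeightedTour.of_frame {x : ℕ → Fin n} {w : ℕ → ℝ} {N : ℕ} {s s' : Mem}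
    (h : HasWeightedTour s x w N) {P : Program} (hf : Frame P s s') (h1 : P.writesNat 1 = false)
    (h2 : P.writesNat 10 = false) (h3 : P.writesReal 3 = false) : HasWeightedTour s' x w N :=
  ⟨by rw [hf.nat 1 h1]; exact h.size, by rw [hf.nat 10 h2]; exact h.vertex,
    by rw [hf.real 3 h3]; exact h.weight⟩

theorem runs_evalCost {c : Fin n → Fin n → ℝ} {x : ℕ → Fin n} {w : ℕ → ℝ} {N : ℕ} {s : Mem}
    (hc : HasCosts s c) (hw : HasWeightedTour s x w N) :
    Runs evalCost s (50 + forTime N 50 (50 + (50 + forTime N 50 100))) fun s' =>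
      s'.real 4 0 = pairSum c x w N := by
  set term : ℕ → ℕ → ℝ := fun i d => (w i * ∏ l ∈ Finset.range d, (1 - w ((i + 1 + l) % N)))
    * w ((i + 1 + d) % N) * c (x i) (x ((i + 1 + d) % N)) with hterm
  have st1 : Runs (.setRVar 4 (.ofNat (.lit 0))) s 50 fun s' => s'.real 4 0 = 0 :=
    (Runs.flat rfl (by simp [Program.run, NExp.eval, RExp.eval])).mono (by decide) fun _ _ h => h
  refine st1.seq fun s₁ hf₁ h₁ => ?_
  have hc₁ := hc.of_frame hf₁ rfl rfl
  have hw₁ := hw.of_frame hf₁ rfl rfl rfl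
  have main := Runs.forLoop (a := 12) (e := .var 1) (s := s₁) (m := N)
    (τ := 50 + (50 + forTime N 50 100))
    (c := .seq (.setRVar 5 (.get 3 (.var 12)))
        (.seq (.setNVar 14 (.var 12))
          (.forLoop 13 (.sub (.var 1) (.lit 1))
            (.seq (.setNVar 14 (.add (.var 14) (.lit 1)))
              (.seq (.ite (.natEq (.var 14) (.var 1)) (.setNVar 14 (.lit 0)) .skip)
                (.seq (.setRVar 4 (.add (.var 4) (.mul (.mul (.var 5) (.get 3 (.var 14)))
                    (costExp (.get 10 (.var 12)) (.get 10 (.var 14))))))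
                  (.setRVar 5 (.mul (.var 5) (.sub (.ofNat (.lit 1)) (.get 3 (.var 14)))))))))))
    (fun i s' => s'.real 4 0 = ∑ k ∈ Finset.range i, ∑ d ∈ Finset.range (N - 1), term k d) rfl
    (fun s' hf => by rw [← hw₁.size, ← hf.nat 1 rfl]; rfl) (by simpa using h₁) ?_
  · exact main.mono (forTime_mono le_rfl (by decide) le_rfl) fun s' _ h => h
  intro i hi s₂ hf₂ hi₂ hI₂
  have hc₂ := hc₁.of_frame hf₂ rfl rfl
  have hw₂ := hw₁.of_frame hf₂ rfl rfl rfl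
  have st3 : Runs (.setRVar 5 (.get 3 (.var 12))) s₂ 50 fun s' => s'.real 5 0 = w i :=
    (Runs.flat rfl (by simp [Program.run, NExp.eval, RExp.eval, hi₂, hw₂.weight i hi])).mono
      (by decide) fun _ _ h => h
  refine st3.seq fun s₃ hf₃ h₃ => ?_
  have hi₃ : s₃.nat 12 0 = i := by rw [hf₃.nat 12 rfl, hi₂]
  have st4 : Runs (.setNVar 14 (.var 12)) s₃ 50 fun s' => s'.nat 14 0 = i :=
    (Runs.flat rfl (by simp [Program.run, NExp.eval, hi₃])).mono (by decide) fun _ _ h => h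
  refine st4.seq fun s₄ hf₄ h₄ => ?_
  have hi₄ : s₄.nat 12 0 = i := by rw [hf₄.nat 12 rfl, hi₃]
  have hc₄ := (hc₂.of_frame hf₃ rfl rfl).of_frame hf₄ rfl rfl
  have hw₄ := (hw₂.of_frame hf₃ rfl rfl rfl).of_frame hf₄ rfl rfl rfl
  have h4₄ : s₄.real 4 0 = ∑ k ∈ Finset.range i, ∑ d ∈ Finset.range (N - 1), term k d := by
    rw [hf₄.real 4 rfl, hf₃.real 4 rfl, hI₂]
  have h5₄ : s₄.real 5 0 = w i := by rw [hf₄.real 5 rfl, h₃]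
  have inner := Runs.forLoop (a := 13) (e := .sub (.var 1) (.lit 1)) (s := s₄) (m := N - 1)
    (τ := 100)
    (c := .seq (.setNVar 14 (.add (.var 14) (.lit 1)))
        (.seq (.ite (.natEq (.var 14) (.var 1)) (.setNVar 14 (.lit 0)) .skip)
          (.seq (.setRVar 4 (.add (.var 4) (.mul (.mul (.var 5) (.get 3 (.var 14)))
              (costExp (.get 10 (.var 12)) (.get 10 (.var 14))))))
            (.setRVar 5 (.mul (.var 5) (.sub (.ofNat (.lit 1)) (.get 3 (.var 14))))))))
    (fun d s' => s'.real 4 0 = (∑ k ∈ Finset.range i, ∑ d ∈ Finset.range (N - 1), term k d)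
        + ∑ d' ∈ Finset.range d, term i d' ∧
      s'.real 5 0 = w i * ∏ l ∈ Finset.range d, (1 - w ((i + 1 + l) % N)) ∧
      s'.nat 14 0 = (i + d) % N) rfl
    (fun s' hf => by
      have : s'.nat 1 0 = N := by rw [hf.nat 1 rfl, hw₄.size]
      simp [NExp.eval, this])
    (by simp [h4₄, h5₄, h₄, Nat.mod_eq_of_lt hi]) ?_
  · refine inner.mono (forTime_mono (Nat.sub_le _ _) (by decide) le_rfl) fun s' _ h => ?_
    simp only [Mem.setNat_real, Finset.sum_range_succ]
    exact h.1
  rintro d hd s₅ hf₅ hd₅ ⟨e4, e5, e14⟩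
  have hc₅ := hc₄.of_frame hf₅ rfl rfl
  have hw₅ := hw₄.of_frame hf₅ rfl rfl rfl
  have hi₅ : s₅.nat 12 0 = i := by rw [hf₅.nat 12 rfl, hi₄]
  have hNpos : 0 < N := by omega
  set k := (i + 1 + d) % N with hk
  have hkN : k < N := Nat.mod_lt _ hNpos
  have st6 : Runs (.setNVar 14 (.add (.var 14) (.lit 1))) s₅ 30
      fun s' => s'.nat 14 0 = (i + d) % N + 1 :=
    (Runs.flat rfl (by simp [Program.run, NExp.eval, e14])).mono (by decide) fun _ _ h => h
  refine (st6.seq (τ₂ := 30 + 40) fun s₆ hf₆ h₆ => ?_).mono (by decide) fun _ _ h => h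
  have hw₆ := hw₅.of_frame hf₆ rfl rfl rfl
  have st7 : Runs (.ite (.natEq (.var 14) (.var 1)) (.setNVar 14 (.lit 0)) .skip) s₆ 30
      fun s' => s'.nat 14 0 = k := by
    refine (Runs.flat rfl ?_).mono (by decide) fun _ _ h => h
    have hm : k = if (i + d) % N + 1 = N then 0 else (i + d) % N + 1 := by
      rw [hk, show i + 1 + d = (i + d) + 1 by ring, Nat.add_mod]
      have := Nat.mod_lt (i + d) hNpos
      split_ifs with h
      · rcases Nat.lt_or_ge 1 N with h1 | h1
        · rw [Nat.mod_eq_of_lt h1, h, Nat.mod_self]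
        · have : N = 1 := by omega
          subst this; simp [Nat.mod_one]
      · rw [Nat.mod_eq_of_lt (show 1 < N by omega), Nat.mod_eq_of_lt (by omega)]
    simp only [Program.run, NExp.eval, BExp.Holds, h₆, hw₆.size]
    rw [hm]
    split_ifs <;> simp [h₆]
  refine st7.seq fun s₇ hf₇ h₇ => (Runs.flat rfl ?_).mono (by decide) fun _ _ h => h
  have hw₇ := hw₆.of_frame hf₇ rfl rfl rfl
  have hc₇ := (hc₅.of_frame hf₆ rfl rfl).of_frame hf₇ rfl rfl
  have hi₇ : s₇.nat 12 0 = i := by rw [hf₇.nat 12 rfl, hf₆.nat 12 rfl, hi₅]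
  have g4 : s₇.real 4 0 = s₅.real 4 0 := by rw [hf₇.real 4 rfl, hf₆.real 4 rfl]
  have g5 : s₇.real 5 0 = s₅.real 5 0 := by rw [hf₇.real 5 rfl, hf₆.real 5 rfl]
  have hv := hc₇.eval (e₁ := .get 10 (.var 12)) (e₂ := .get 10 (.var 14)) (u := x i) (v := x k)
    (by simp [NExp.eval, hi₇, hw₇.vertex i hi]) (by simp [NExp.eval, h₇, hw₇.vertex k hkN])
  simp only [RExp.eval, NExp.eval, h₇] at hv
  simp only [Program.run, RExp.eval, NExp.eval, Mem.setNat_real, Mem.setReal_nat, Mem.setReal_real,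
    hv, h₇, hw₇.weight k hkN, g4, g5, e4, e5]
  refine ⟨?_, ?_, ?_⟩
  · norm_num only [and_self, if_true, if_false, false_and]
    rw [Finset.sum_range_succ, ← add_assoc]
  · norm_num only [and_self, if_true, if_false, false_and, Nat.cast_one]
    rw [Finset.prod_range_succ, mul_assoc]
  · rw [Mem.setNat_nat_of_ne _ _ _ (by decide)]
    simp only [Mem.setReal_nat, h₇, hk]
    rw [show i + 1 + d = i + (d + 1) by ring]

/-- The two expected costs that are compared are those of `expect_merge_le`, so the bound `Φ` is
maintained by the better choice. -/
theorem runs_mergeCopies {c : Fin n → Fin n → ℝ} (h0 : ∀ x y, 0 ≤ c x y)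
    (h3 : ∀ x y z, c x z ≤ c x y + c y z) (hd : ∀ x, c x x = 0) {x : ℕ → Fin n} {q : ℝ}
    {m : Fin n → ℕ} {N : ℕ} {Φ : ℝ} {s : Mem} (hc : HasCosts s c)
    {w : ℕ → ℝ} (hw : HasWeightedTour s x w N)
    (hinit : MergeInvariant c x q m N Φ 0 w fun v => s.nat 11 v) :
    Runs mergeCopies s (forTime N 50 (50 + (100 + ((50 + forTime N 50 (50 + (50
      + forTime N 50 100))) + (100 + ((50 + forTime N 50 (50 + (50 + forTime N 50 100)))
        + 100)))))) fun s' =>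
      ∃ w', MergeInvariant c x q m N Φ N w' fun v => s'.nat 11 v := by
  set E := 50 + forTime N 50 (50 + (50 + forTime N 50 100)) with hE
  set Inv : ℕ → Mem → Prop := fun j s' => ∃ w', HasWeightedTour s' x w' N ∧
    MergeInvariant c x q m N Φ j w' fun v => s'.nat 11 v with hInv
  have main : Runs mergeCopies s (forTime N (NExp.var 1).cost
      (50 + (100 + (E + (100 + (E + 100)))))) (Inv N) := by
    refine Runs.forLoop Inv rfl (fun s' hf => ?_) ?_ ?_
    · rw [← hw.size, ← hf.nat 1 rfl]; rfl
    · exact ⟨w, ⟨by simpa using hw.size, by simpa using hw.vertex, by simpa using hw.weight⟩,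
        by simpa using hinit⟩
    rintro j hj s₁ hf₁ hj₁ ⟨w₁, hw₁, hI₁⟩
    have hc₁ : HasCosts s₁ c := by
      refine hc.of_frame hf₁ rfl rfl
    have hrep : (NExp.get 11 (.get 10 (.var 3))).eval s₁ = s₁.nat 11 (x j) := by
      simp [NExp.eval, hj₁, hw₁.vertex j hj]
    -- the vertices other than `x j` keep their representatives
    have hupd : (fun v : Fin n => if (v : ℕ) = x j then j + 1 else s₁.nat 11 v)
        = Function.update (fun v : Fin n => s₁.nat 11 v) (x j) (j + 1) := by
      funext v
      by_cases hv : v = x j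
      · simp [hv]
      · have : (v : ℕ) ≠ x j := fun h => hv (Fin.ext h)
        simp [hv, this]
    refine (Runs.ite (τ := 100 + (E + (100 + (E + 100)))) (fun hb => ?_) fun hb => ?_).mono
      (Nat.add_le_add_right (by decide) _) fun _ _ h => h
    · have hr0 : s₁.nat 11 (x j) = 0 := hrep.symm.trans hb
      refine (Runs.flat rfl ?_).mono
        ((show Program.flatCost _ ≤ 100 by decide).trans (Nat.le_add_right _ _)) fun _ _ h => h
      refine ⟨w₁, ⟨?_, ?_, ?_⟩, ?_⟩
      · simpa [Program.run] using hw₁.size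
      · simpa [Program.run] using hw₁.vertex
      · simpa [Program.run] using hw₁.weight
      · have := hI₁.first hr0
        rw [← hupd] at this
        simpa [Program.run, NExp.eval, hj₁, hw₁.vertex j hj] using this
    · have hr0 : s₁.nat 11 (x j) ≠ 0 := fun h => hb (hrep.trans h)
      set i := s₁.nat 11 (x j) - 1 with hi
      have hspec := hI₁.rep_spec (x j) hr0
      have hiN : i < N := by have := hspec.1; omega
      have hij : i ≠ j := by have := hspec.1; omega
      set σ := w₁ i + w₁ j - w₁ i * w₁ j with hσ
      set wa := Function.update (Function.update w₁ i σ) j 0 with hwa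
      set wb := Function.update (Function.update w₁ i 0) j σ with hwb
      have st1 : Runs (.seq (.setNVar 15 (.sub (.get 11 (.get 10 (.var 3))) (.lit 1)))
          (.seq (.setRVar 7 (.sub (.add (.get 3 (.var 15)) (.get 3 (.var 3)))
              (.mul (.get 3 (.var 15)) (.get 3 (.var 3)))))
            (.seq (.setReal 3 (.var 15) (.var 7)) (.setReal 3 (.var 3) (.ofNat (.lit 0)))))) s₁ 100
          fun s' => s'.nat 15 0 = i ∧ s'.real 7 0 = σ ∧ ∀ k < N, s'.real 3 k = wa k := by
        refine (Runs.flat rfl ?_).mono (by decide) fun _ _ h => h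
        simp only [Program.run, NExp.eval, RExp.eval]
        simp [hj₁, hw₁.vertex j hj, ← hi, hw₁.weight i hiN, hw₁.weight j hj, ← hσ]
        intro k hk
        rw [hwa, Function.update_apply, Function.update_apply, hw₁.weight k hk]
      refine st1.seq fun s₂ hf₂ h₂ => ?_
      have hc₂ := hc₁.of_frame hf₂ rfl rfl
      have hw₂ : HasWeightedTour s₂ x wa N := ⟨by rw [hf₂.nat 1 rfl, hw₁.size],
        by rw [hf₂.nat 10 rfl]; exact hw₁.vertex, h₂.2.2⟩
      refine (runs_evalCost hc₂ hw₂).seq fun s₃ hf₃ h₃ => ?_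
      have hc₃ := hc₂.of_frame hf₃ rfl rfl
      have hw₃ := hw₂.of_frame hf₃ rfl rfl rfl
      have hj₃ : s₃.nat 3 0 = j := by rw [hf₃.nat 3 rfl, hf₂.nat 3 rfl, hj₁]
      have hi₃ : s₃.nat 15 0 = i := by rw [hf₃.nat 15 rfl, h₂.1]
      have hσ₃ : s₃.real 7 0 = σ := by rw [hf₃.real 7 rfl, h₂.2.1]
      have st4 : Runs (.seq (.setRVar 6 (.var 4))
          (.seq (.setReal 3 (.var 15) (.ofNat (.lit 0))) (.setReal 3 (.var 3) (.var 7)))) s₃ 100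
          fun s' => s'.real 6 0 = pairSum c x wa N ∧ ∀ k < N, s'.real 3 k = wb k := by
        refine (Runs.flat rfl ?_).mono (by decide) fun _ _ h => h
        simp only [Program.run, NExp.eval, RExp.eval]
        simp [hj₃, hi₃, hσ₃, h₃]
        intro k hk
        rw [hwb, Function.update_apply, Function.update_apply, hw₃.weight k hk, hwa]
        split_ifs with h1 h2
        · rfl
        · rfl
        · rw [Function.update_of_ne h1, Function.update_of_ne h2]
      refine st4.seq fun s₄ hf₄ h₄ => ?_
      have hc₄ := hc₃.of_frame hf₄ rfl rfl
      have hw₄ : HasWeightedTour s₄ x wb N := ⟨by rw [hf₄.nat 1 rfl, hw₃.size],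
        by rw [hf₄.nat 10 rfl]; exact hw₃.vertex, h₄.2⟩
      refine (runs_evalCost hc₄ hw₄).seq fun s₅ hf₅ h₅ => ?_
      have hw₅ := hw₄.of_frame hf₅ rfl rfl rfl
      have hj₅ : s₅.nat 3 0 = j := by rw [hf₅.nat 3 rfl, hf₄.nat 3 rfl, hj₃]
      have hi₅ : s₅.nat 15 0 = i := by rw [hf₅.nat 15 rfl, hf₄.nat 15 rfl, hi₃]
      have hσ₅ : s₅.real 7 0 = σ := by rw [hf₅.real 7 rfl, hf₄.real 7 rfl, hσ₃]
      have h6₅ : s₅.real 6 0 = pairSum c x wa N := by rw [hf₅.real 6 rfl, h₄.1]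
      have h11₅ : s₅.nat 11 = s₁.nat 11 := by
        rw [hf₅.nat 11 rfl, hf₄.nat 11 rfl, hf₃.nat 11 rfl, hf₂.nat 11 rfl]
      have hmin := expect_merge_le (x := x) hiN hj hij hI₁.prob
        (F := closed c) fun _ _ h => closed_sublist h0 h3 h
      rw [← hσ, ← hwa, ← hwb, expect_closed_eq_pairSum hd,
        expect_closed_eq_pairSum hd x wb] at hmin
      have hcost := hmin.trans hI₁.cost
      refine (Runs.flat rfl ?_).mono (by decide) fun _ _ h => h
      simp only [Program.run, BExp.Holds, RExp.eval, NExp.eval, h6₅, h₅, hj₅, hi₅, hσ₅]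
      split_ifs with hlt
      · refine ⟨wa, ⟨?_, ?_, ?_⟩, ?_⟩
        · simpa using hw₅.size
        · simpa using hw₅.vertex
        · intro k hk
          simp [hj₅]
          rw [hw₅.weight k hk, hwa, hwb, Function.update_apply, Function.update_apply,
            Function.update_apply, Function.update_apply]
          split_ifs <;> rfl
        · have := hI₁.keep hj hr0 hi hσ (by
            rw [expect_closed_eq_pairSum hd]
            rw [min_eq_left hlt.le] at hcost
            exact hcost)
          simpa [h11₅] using this
      · refine ⟨wb, ⟨?_, ?_, ?_⟩, ?_⟩
        · simpa using hw₅.size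
        · simpa using hw₅.vertex
        · simpa using hw₅.weight
        · have := hI₁.replace hj hr0 hi hσ (by
            rw [expect_closed_eq_pairSum hd]
            rw [min_eq_right (not_lt.1 hlt)] at hcost
            exact hcost)
          rw [← hupd] at this
          simpa [h11₅, hw₅.vertex j hj] using this
  exact main.mono (forTime_mono le_rfl (by decide) le_rfl) fun s' _ h => by
    obtain ⟨w', -, h⟩ := h
    exact ⟨w', h⟩

theorem runs_emitHeavy {x : ℕ → Fin n} {N : ℕ} {s : Mem} (hN : s.nat 1 0 = N)
    (hx : ∀ i < N, s.nat 10 i = x i) :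
    Runs emitHeavy s (forTime N 50 50) fun s' =>
      s'.out = s.out ++ (heavyTour x N fun v => s.nat 11 v).map Fin.val := by
  have main : Runs emitHeavy s (forTime N (NExp.var 1).cost 50) fun s' =>
      s'.out = s.out ++ (heavyTour x N fun v => s.nat 11 v).map Fin.val := by
    refine Runs.forLoop (fun i s' => s'.out = s.out ++ (heavyTour x i fun v => s.nat 11 v).map
      Fin.val) rfl (fun s' hf => ?_) ?_ ?_
    · rw [← hN, ← hf.nat 1 rfl]; rfl
    · simp [heavyTour]
    · intro i hi s₁ hf₁ hi₁ hI₁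
      refine (Runs.flat rfl ?_).mono (by decide) fun _ _ h => h
      have e10 : s₁.nat 10 i = x i := by rw [hf₁.nat 10 rfl, hx i hi]
      have e11 : s₁.nat 11 = s.nat 11 := hf₁.nat 11 rfl
      have hsucc : (heavyTour x (i + 1) fun v => s.nat 11 v)
          = (heavyTour x i fun v => s.nat 11 v)
            ++ if s.nat 11 (x i) = i + 1 then [x i] else [] := by
        rw [heavyTour, List.range_succ, List.filter_append, List.map_append, heavyTour]
        congr 1
        split_ifs with h <;> simp [h]
      simp only [Program.run, BExp.Holds, NExp.eval, hi₁, e10, e11]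
      rw [hsucc]
      split_ifs with h
      · simp [hI₁]
      · simp [hI₁]
  exact main.mono (forTime_mono le_rfl (by decide) le_rfl) fun _ _ h => h

theorem runs_emitLight {s : Mem} (hn : s.nat 0 0 = n) :
    Runs emitLight s (forTime n 50 50) fun s' =>
      s'.out = s.out ++ (lightList fun v : Fin n => s.nat 11 v).map Fin.val := by
  have main : Runs emitLight s (forTime n (NExp.var 0).cost 50) fun s' =>
      s'.out = s.out ++ (List.range n).filter fun v => s.nat 11 v = 0 := by
    refine Runs.forLoop (fun i s' => s'.out = s.out
      ++ (List.range i).filter fun v => s.nat 11 v = 0) rfl (fun s' hf => ?_) ?_ ?_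
    · rw [← hn, ← hf.nat 0 rfl]; rfl
    · simp
    · intro i hi s₁ hf₁ hi₁ hI₁
      refine (Runs.flat rfl ?_).mono (by decide) fun _ _ h => h
      have e11 : s₁.nat 11 = s.nat 11 := hf₁.nat 11 rfl
      simp only [Program.run, BExp.Holds, NExp.eval, hi₁, e11]
      rw [List.range_succ, List.filter_append, ← List.append_assoc]
      split_ifs with h
      · simp [hI₁, h]
      · simp [hI₁, h]
  refine main.mono (forTime_mono le_rfl (by decide) le_rfl) fun _ _ h => ?_
  rw [h, lightList, ← List.map_coe_finRange_eq_range, List.filter_map]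
  rfl

end Parts

/-! ### The reduction -/

/-- A bound for the running time of `evalCost`. -/
def evalTime {R : Type*} [CommSemiring R] (N : R) : R :=
  50 + forTime N 50 (50 + (50 + forTime N 50 100))

/-- A bound for the running time of `heavyPhase P` in the case of `n` vertices and `N` copies, if
the subroutine takes time `τ`. -/
def heavyTime {R : Type*} [CommSemiring R] (n N τ : R) : R :=
  forTime n 50 50 + (forTime N 50 (forTime N 50 50) + ((6 + (forTime N 50 (forTime N 50
    (100 + 100 * N ^ 2)) + (20 + (20 + (50 + N ^ 2 + 2 * τ))) + (50 + forTime N 50 50)))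
    + (forTime (N + τ) 2 41 + (forTime N 50 (50 + (100 + (evalTime N + (100 + (evalTime N + 100)))))
      + forTime N 50 50))))

/-- A bound for the running time of `reduction P`. -/
def reductionTime {R : Type*} [CommSemiring R] (n N τ : R) : R :=
  forTime n 50 (forTime (2 * n) 50 50) + (13 + heavyTime n N τ + forTime n 50 50)

/-- The contribution of the subroutine: two steps for the call and the copying of its output, and
`53` steps for each visit of the tour that it returns. -/
theorem reductionTime_eq_add (n N τ : ℕ) :
    reductionTime n N τ = reductionTime n N 0 + 55 * τ := by
  simp only [reductionTime, heavyTime, forTime]; ring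

theorem reductionTime_mono {n N N' τ : ℕ} (h : N ≤ N') :
    reductionTime n N τ ≤ reductionTime n N' τ := by
  unfold reductionTime heavyTime evalTime forTime; gcongr

theorem map_getD_range {X : Type*} (l : List X) (d : X) :
    (List.range l.length).map (fun i => l.getD i d) = l := by
  refine List.ext_getElem (by simp) fun i h₁ h₂ => ?_
  simp only [List.getElem_map, List.getElem_range, List.getD_eq_getElem _ _ h₂]

variable {n : ℕ}

/-- A tour of the copies whose hop cost is within a constant factor of `α N` times the optimum is
computed, also in the degenerate case in which all copies have distance `0`. -/
theorem runs_hopTour {P : Program} {α : ℕ → ℝ} {t : ℕ → ℕ}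
    (hP : ApproximatesWellScaledHop P α t) {c : Fin n → Fin n → ℝ} (h0 : ∀ x y, 0 ≤ c x y)
    (h3 : ∀ x y z, c x z ≤ c x y + c y z) {p : Fin n → ℝ} {s : Mem} (hα : ∀ m, 1 ≤ α m)
    (hc : HasCosts s c) (hp : HasCopies s p) (hle : ∀ x y, copyCost c p x y ≤ s.real 1 0)
    (hmax : s.real 1 0 = 0 ∨ ∃ x y, copyCost c p x y = s.real 1 0) {N : ℕ}
    (hNdef : N = (copyList p).length) (hn : 0 < n) (hN : 2 * n < N) :
    Runs (.ite (.realLt (.ofNat (.lit 0)) (.var 1)) (solveScaled P) trivialTour) s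
      (6 + (forTime N 50 (forTime N 50 (100 + 100 * N ^ 2)) + (20 + (20 + (50 + N ^ 2 + 2 * t N)))
        + (50 + forTime N 50 50))) fun s' =>
      ∃ T : List (Fin (copyList p).length), HasTour s' T ∧ IsTour T ∧ T.length ≤ N + t N ∧
        ∀ U : List (Fin (copyList p).length), U.Nodup → IsTour U →
          hopCost (copyCost c p) (2 * n) T
            ≤ 2 * α N * hopCost (copyCost c p) (2 * n) U := by
  subst hNdef
  refine Runs.ite (fun hb => ?_) fun hb => ?_
  · have hM : 0 < s.real 1 0 := by simpa [BExp.Holds, RExp.eval, NExp.eval] using hb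
    refine (runs_solveScaled hP h0 h3 hα hc hp hM hle (hmax.resolve_left hM.ne') hn hN).mono
      (Nat.le_add_right _ _) ?_
    rintro s' - ⟨T, h₁, h₂, h₃, h₄⟩
    exact ⟨T, h₁, h₂, h₃.trans (Nat.le_add_left _ _), h₄⟩
  · have hM : s.real 1 0 ≤ 0 := by simpa [BExp.Holds, RExp.eval, NExp.eval] using hb
    have hz : copyCost c p = fun _ _ => 0 := by
      funext x y
      exact le_antisymm ((hle x y).trans hM) (h0 _ _)
    refine (runs_trivialTour hp.1).mono (Nat.le_add_left _ _) fun s' _ h =>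
      ⟨_, h, List.mem_finRange, by simp, fun U _ _ => ?_⟩
    simp [hz, hopCost, shiftCost]

/-- The constants: the tour of the copies is within a factor of `32 α` of the optimum, due to
rounding and to the comparison of expected cost and hop cost, and `512 α + 128 = 16 (32 α + 8)`,
where `8` is for the vertices without copies and `16` for the rounded probabilities. -/
theorem runs_heavyPhase {P : Program} {α : ℕ → ℝ} {t : ℕ → ℕ}
    (hP : ApproximatesWellScaledHop P α t) (hα : ∀ m, 1 ≤ α m) {c : Fin n → Fin n → ℝ}
    (h0 : ∀ x y, 0 ≤ c x y) (h3 : ∀ x y z, c x z ≤ c x y + c y z) {p : Fin n → ℝ}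
    (hp0 : ∀ v, 0 ≤ p v) (hp1 : ∀ v, p v ≤ 1) {s : Mem} (hc : HasCosts s c) (hp : HasCopies s p)
    {N : ℕ} (hNdef : N = (copyList p).length) (hn : 0 < n) (hN : 2 * n < N)
    (hr1 : s.real 1 0 = 0) (h8 : ∀ i, s.nat 8 i = 0) (h9 : s.nat 9 0 = 0)
    (h11 : ∀ i, s.nat 11 i = 0) :
    Runs (heavyPhase P) s (heavyTime n N (t N)) fun s' => ∃ T : List (Fin n),
      s'.out = s.out ++ T.map Fin.val ∧
      (T ++ lightList fun v => s'.nat 11 v).Nodup ∧ IsTour (T ++ lightList fun v => s'.nat 11 v) ∧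
      ∀ T' : List (Fin n), IsTour T' → T'.Nodup →
        expectedCost (offDiag c) p (T ++ lightList fun v => s'.nat 11 v)
          ≤ (512 * α N + 128) * expectedCost (offDiag c) p T' := by
  have d0 := offDiag_nonneg h0
  have d3 := offDiag_triangle h0 h3
  have dd := offDiag_self c
  refine (runs_zeroDiag hc).seq fun s₁ hf₁ hc₁ => ?_
  have hp₁ := hp.of_frame hf₁ rfl rfl
  refine ((runs_maxCost hc₁ hp₁ (by rw [hf₁.real 1 rfl, hr1])).mono (by rw [hNdef])
    fun _ _ h => h).seq fun s₂ hf₂ h₂ => ?_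
  have hc₂ := hc₁.of_frame hf₂ rfl rfl
  have hp₂ := hp₁.of_frame hf₂ rfl rfl
  refine (runs_hopTour hP d0 d3 hα hc₂ hp₂ h₂.1 h₂.2 hNdef hn hN).seq fun s₃ hf₃ h₃ => ?_
  obtain ⟨T, hT, hTt, hTlen, hTcost⟩ := h₃
  have hc₃ := hc₂.of_frame hf₃ rfl rfl
  have hp₃ := hp₂.of_frame hf₃ rfl rfl
  refine ((runs_removeRepetitions hc₃.1 hp₃ hT (fun i => ?_) ?_).mono
    (forTime_mono hTlen le_rfl le_rfl) fun _ _ h => h).seq fun s₄ hf₄ h₄ => ?_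
  · rw [hf₃.nat 8 rfl, hf₂.nat 8 rfl, hf₁.nat 8 rfl, h8]
  · rw [hf₃.nat 9 rfl, hf₂.nat 9 rfl, hf₁.nat 9 rfl, h9]
  obtain ⟨U, hUn, hUs, hUm, h10, hr3⟩ := h₄
  have hc₄ := hc₃.of_frame hf₄ rfl rfl
  have hp₄ := hp₃.of_frame hf₄ rfl rfl
  have hUperm : U.Perm (List.finRange _) := (List.perm_ext_iff_of_nodup hUn
    (List.nodup_finRange _)).2 fun y => by simp [(hUm y).2 (hTt y)]
  have hUlen : U.length = N := by rw [hUperm.length_eq, List.length_finRange, hNdef]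
  set L := U.map (copyList p).get with hL
  have hLlen : L.length = N := by rw [hL, List.length_map, hUlen]
  set x : ℕ → Fin n := fun i => L.getD i ⟨0, hn⟩ with hx
  have hxL : (List.range N).map x = L := by rw [← hLlen]; exact map_getD_range _ _
  have hcount : ∀ v, ((List.range N).map x).count v = copies p v := by
    intro v
    rw [hxL, ← count_copyList, (hUperm.map (copyList p).get).count_eq, List.map_get_finRange]
  have hw₄ : HasWeightedTour s₄ x (fun _ => unitProb n) N := by
    refine ⟨by rw [hp₄.1, hNdef], fun i hi => ?_, fun i hi => hr3 i (by omega)⟩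
    have hi' : i < U.length := by omega
    rw [h10 i (by simpa using hi'), hx]
    simp [hL, hi']
  have hq := unitProb_le hn
  have hq' := unitProb_pos hn
  have hinit : MergeInvariant (offDiag c) x (unitProb n) (copies p) N _ 0 (fun _ => unitProb n)
      fun v => s₄.nat 11 v :=
    MergeInvariant.init hq'.le (by linarith) hcount le_rfl (fun _ _ => rfl) fun v => by
      rw [hf₄.nat 11 rfl, hf₃.nat 11 rfl, hf₂.nat 11 rfl, hf₁.nat 11 rfl, h11]
  refine (runs_mergeCopies d0 d3 dd hc₄ hw₄ hinit).seq fun s₅ hf₅ h₅ => ?_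
  obtain ⟨w', hI⟩ := h₅
  have hx₅ : ∀ i < N, s₅.nat 10 i = x i := by rw [hf₅.nat 10 rfl]; exact hw₄.vertex
  refine (runs_emitHeavy (by rw [hf₅.nat 1 rfl, hw₄.size]) hx₅).mono le_rfl fun s₆ hf₆ h₆ => ?_
  have e11 : s₆.nat 11 = s₅.nat 11 := hf₆.nat 11 rfl
  refine ⟨heavyTour x N fun v => s₅.nat 11 v, ?_, ?_⟩
  · rw [h₆, hf₅.out rfl, hf₄.out rfl, hf₃.out rfl, hf₂.out rfl, hf₁.out rfl]
  rw [e11]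
  refine ⟨nodup_heavyTour_append _ _ _, hI.isTour, fun T' hT' hTn' => ?_⟩
  refine (expectedCost_merged_le d0 d3 dd hp0 hp1 hn hcount hI hT' hTn').trans ?_
  have hα0 : 0 ≤ 2 * α N := by linarith [hα N]
  have e := expect_le_of_hop_tour d0 d3 dd hp0 hp1 (hNdef ▸ hN) hT' hTn' hα0 hTcost hUs
  have e' : (List.range N).map (fun i => (x i, unitProb n))
      = U.map fun y => ((copyList p).get y, unitProb n) := by
    calc _ = ((List.range N).map x).map fun v => (v, unitProb n) := by rw [List.map_map]; rfl
      _ = _ := by rw [hxL, hL, List.map_map]; rfl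
  rw [e']
  linarith

theorem input_hasCosts (J : APrioriInstance) : HasCosts J.input J.c := by
  refine ⟨by simp [APrioriInstance.input, Mem.input], fun u v => ?_⟩
  have hlt : (u : ℕ) * J.n + v < J.n * J.n := by
    have := Nat.mul_le_mul_right J.n (Nat.succ_le_of_lt u.2)
    have h2 := v.2
    rw [Nat.succ_mul] at this
    omega
  have h1 : ((u : ℕ) * J.n + v) / J.n = u := by
    rw [mul_comm, Nat.mul_add_div v.pos, Nat.div_eq_of_lt v.2, add_zero]
  have h2 : ((u : ℕ) * J.n + v) % J.n = v := by
    rw [mul_comm, Nat.mul_add_mod, Nat.mod_eq_of_lt v.2]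
  have hl : (u : ℕ) * J.n + v < (costList J.c).length := by simpa [costList] using hlt
  simp only [APrioriInstance.input, Mem.input, if_true]
  rw [List.getD_append _ _ _ _ hl, List.getD_eq_getElem _ _ hl]
  simp only [costList, List.getElem_ofFn]
  congr 1
  · exact Fin.ext h1
  · exact Fin.ext h2

theorem input_prob (J : APrioriInstance) (v : Fin J.n) :
    J.input.real 0 (J.n * J.n + v) = J.p v := by
  have hl : (costList J.c).length = J.n * J.n := by simp [costList]
  simp only [APrioriInstance.input, Mem.input, if_true]
  rw [List.getD_append_right _ _ _ _ (by omega), hl, Nat.add_sub_cancel_left,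
    List.getD_eq_getElem _ _ (by simp)]
  simp

theorem APrioriInstance.le_mul_opt (J : APrioriInstance) {a β : ℝ} (hβ : 0 < β)
    (h : ∀ T : List (Fin J.n), IsTour T → a ≤ β * expectedCost J.c J.p T) : a ≤ β * J.opt := by
  rw [← div_le_iff₀' hβ]
  refine le_csInf ⟨_, List.finRange J.n, List.mem_finRange, rfl⟩ ?_
  rintro _ ⟨T, hT, rfl⟩
  rw [div_le_iff₀' hβ]
  exact h T hT

theorem expectedCost_offDiag_le {c : Fin n → Fin n → ℝ} (hc : ∀ x y, 0 ≤ c x y) {p : Fin n → ℝ}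
    (h0 : ∀ v, 0 ≤ p v) (h1 : ∀ v, p v ≤ 1) (T : List (Fin n)) :
    expectedCost (offDiag c) p T ≤ expectedCost c p T := by
  simp only [expectedCost, tourCost_eq_closed]
  exact Finset.sum_le_sum fun A _ => mul_le_mul_of_nonneg_left (closed_mono (offDiag_le hc) _)
    (activeProb_nonneg h0 h1 A)

/-- It suffices to approximate the optimum for the costs without self-loops. -/
theorem APrioriInstance.expectedCost_le_of_offDiag (J : APrioriInstance) {T : List (Fin J.n)}
    (hTn : T.Nodup) (hT : IsTour T) {β : ℝ} (hβ : 0 ≤ β)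
    (h : ∀ T' : List (Fin J.n), IsTour T' → T'.Nodup →
      expectedCost (offDiag J.c) J.p T ≤ β * expectedCost (offDiag J.c) J.p T') :
    expectedCost J.c J.p T ≤ (β + 1) * J.opt := by
  refine J.le_mul_opt (by linarith) fun T' hT' => ?_
  have d0 := offDiag_nonneg J.c_nonneg
  have d3 := offDiag_triangle J.c_nonneg J.c_triangle
  have e1 := expectedCost_le_offDiag_add J.c_nonneg J.c_triangle J.p_nonneg J.p_le_one hTn hT hT'
  have e2 := h T'.dedup (fun v => List.mem_dedup.2 (hT' v)) (List.nodup_dedup T')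
  have e3 := expectedCost_dedup_le d0 d3 J.p_nonneg J.p_le_one T'
  have e4 := expectedCost_offDiag_le J.c_nonneg J.p_nonneg J.p_le_one T'
  have e5 := mul_le_mul_of_nonneg_left (e3.trans e4) hβ
  linarith

/-- If there are few vertices or few copies, then every tour without repetitions is good. -/
theorem APrioriInstance.expectedCost_le_of_few (J : APrioriInstance) {T : List (Fin J.n)}
    (hTn : T.Nodup) (hT : IsTour T) (h : J.n ≤ 63 ∨ (copyList J.p).length ≤ 2 * J.n) :
    expectedCost J.c J.p T ≤ 129 * J.opt := by
  have d0 := offDiag_nonneg J.c_nonneg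
  have d3 := offDiag_triangle J.c_nonneg J.c_triangle
  refine (J.expectedCost_le_of_offDiag hTn hT (β := 128) (by norm_num) fun T' hT' hTn' => ?_).trans
    (by norm_num)
  have e0 := expectedCost_nonneg d0 J.p_nonneg J.p_le_one T'
  by_cases hn : J.n ≤ 63
  · refine (expectedCost_le_card_mul d0 d3 J.p_nonneg J.p_le_one hTn hT hT').trans ?_
    refine mul_le_mul_of_nonneg_right ?_ e0
    have : (J.n : ℝ) ≤ 63 := by exact_mod_cast hn
    linarith
  · have hsum : (T.map (copies J.p)).sum ≤ 2 * J.n := by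
      have hperm : T.Perm (List.finRange J.n) := (List.perm_ext_iff_of_nodup hTn
        (List.nodup_finRange _)).2 fun v => by simp [hT v]
      rw [(hperm.map _).sum_eq, ← Fin.sum_univ_def, ← length_copyList]
      exact h.resolve_left hn
    have e := expectedCost_append_le_of_rounded d0 d3 (offDiag_self J.c) J.p_nonneg J.p_le_one
      (by omega) (TH := []) (TL := T) (by simpa using hTn) (by simpa using hT) hT' hTn' hsum
    have e' : expectedCost (offDiag J.c) (roundedProb J.p) [] = 0 := by
      simp [expectedCost, tourCost_eq_closed, shortcut, closed]
    rw [e', List.nil_append] at e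
    linarith

theorem runs_reduction {P : Program} {α : ℕ → ℝ} {t : ℕ → ℕ}
    (hP : ApproximatesWellScaledHop P α t) (hα : ∀ m, 1 ≤ α m) (hαm : Monotone α)
    (J : APrioriInstance) :
    Runs (reduction P) J.input (reductionTime J.n (copyList J.p).length
        (if 63 < J.n ∧ 2 * J.n < (copyList J.p).length then t (copyList J.p).length else 0))
      fun s' => ∃ T : List (Fin J.n), s'.out = T.map Fin.val ∧ IsTour T ∧
        expectedCost J.c J.p T ≤ 641 * α (5 * J.n ^ 2) * J.opt := by
  set N := (copyList J.p).length with hNdef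
  have hc := input_hasCosts J
  have hα5 := hα (5 * J.n ^ 2)
  have hopt : 0 ≤ J.opt := Real.sInf_nonneg (by
    rintro _ ⟨T, -, rfl⟩; exact expectedCost_nonneg J.c_nonneg J.p_nonneg J.p_le_one T)
  refine (runs_buildCopies (p := J.p) hc.1 J.p_nonneg J.p_le_one (input_prob J)
    (by simp [APrioriInstance.input, Mem.input])).seq fun s₁ hf₁ (hp₁ : HasCopies s₁ J.p) => ?_
  have hc₁ := hc.of_frame hf₁ rfl rfl
  have hout₁ : s₁.out = [] := hf₁.out rfl
  have hz : ∀ a, a ≠ 0 → ∀ i, J.input.nat a i = 0 := fun a ha i => by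
    simp [APrioriInstance.input, Mem.input, ha]
  have htest : (BExp.and (.natLt (.lit 63) (.var 0)) (.natLt hopsExp (.var 1))).Holds s₁
      ↔ 63 < J.n ∧ 2 * J.n < N := by
    simp only [BExp.Holds, NExp.eval, hc₁.1, hp₁.1, hNdef]
  by_cases hcase : 63 < J.n ∧ 2 * J.n < N
  · rw [if_pos hcase]
    have hh := runs_heavyPhase hP hα J.c_nonneg J.c_triangle J.p_nonneg J.p_le_one hc₁ hp₁ hNdef
      (by omega) hcase.2 (by rw [hf₁.real 1 rfl]; simp [APrioriInstance.input, Mem.input])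
      (by rw [hf₁.nat 8 rfl]; exact hz 8 (by decide))
      (by rw [hf₁.nat 9 rfl]; exact hz 9 (by decide) 0)
      (by rw [hf₁.nat 11 rfl]; exact hz 11 (by decide))
    refine (Runs.ite (fun _ => hh) fun h => absurd (htest.2 hcase) h).seq fun s₂ hf₂ h₂ => ?_
    obtain ⟨TH, hout, hnd, hT, hcost⟩ := h₂
    have hn₂ : s₂.nat 0 0 = J.n := by rw [hf₂.nat 0 rfl, hc₁.1]
    refine (runs_emitLight hn₂).mono le_rfl fun s₃ _ h₃ => ⟨_, ?_, hT, ?_⟩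
    · rw [h₃, hout, hout₁, List.nil_append, List.map_append]
    · have hαN : α N ≤ α (5 * J.n ^ 2) :=
        hαm ((length_copyList_le J.p_le_one).trans (by omega))
      refine (J.expectedCost_le_of_offDiag hnd hT (by linarith [hα N]) hcost).trans ?_
      exact mul_le_mul_of_nonneg_right (by linarith) hopt
  · rw [if_neg hcase]
    have hskip : Runs .skip s₁ (heavyTime J.n N 0) fun s' => s' = s₁ :=
      ⟨_, _, Exec.skip s₁, by unfold heavyTime forTime; omega, rfl⟩
    refine (Runs.ite (fun h => absurd (htest.1 h) hcase) fun _ => hskip).seq ?_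
    rintro _ - rfl
    -- no vertex has a representative, so the vertices are written in their natural order
    refine (runs_emitLight hc₁.1).mono le_rfl fun s₃ _ h₃ => ⟨List.finRange J.n, ?_,
      List.mem_finRange, ?_⟩
    · rw [h₃, hout₁, List.nil_append, lightList, List.filter_eq_self.2]
      intro v _
      rw [hf₁.nat 11 rfl, hz 11 (by decide)]
      rfl
    · refine (J.expectedCost_le_of_few (List.nodup_finRange _) List.mem_finRange
        (by omega)).trans ?_
      exact mul_le_mul_of_nonneg_right (by linarith) hopt

end HopReduction

theorem mainTheorem4 :
    ∃ (C : ℝ) (q₁ q₂ : Polynomial ℕ),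
      ∀ (α : ℕ → ℝ) (t : ℕ → ℕ), Monotone α → Monotone t → (∀ n, 1 ≤ α n) →
        ∀ P : HopReduction.Program, HopReduction.ApproximatesWellScaledHop P α t →
          ∃ Q : HopReduction.Program,
            HopReduction.ApproximatesAPriori Q
              (fun n => C * α (5 * n ^ 2))
              (fun n => n * t (q₁.eval n) + q₂.eval n) := by
  refine ⟨641, 2 * Polynomial.X ^ 2,
    HopReduction.reductionTime Polynomial.X (2 * Polynomial.X ^ 2) 0, ?_⟩
  intro α t hαm ht hα P hP
  refine ⟨HopReduction.reduction P, fun J => ?_⟩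
  obtain ⟨s', τ', hex, hτ, T, hout, hT, hcost⟩ := HopReduction.runs_reduction hP hα hαm J
  refine ⟨T, ⟨s', τ', hex, hτ.trans ?_, hout⟩, hT, hcost⟩
  have hN := HopReduction.length_copyList_le J.p_le_one
  have e1 : (2 * Polynomial.X ^ 2 : Polynomial ℕ).eval J.n = 2 * J.n ^ 2 := by simp
  -- the time bound is a polynomial expression, evaluated at the indeterminate
  have e2 : (HopReduction.reductionTime Polynomial.X (2 * Polynomial.X ^ 2) 0
      : Polynomial ℕ).eval J.n = HopReduction.reductionTime J.n (2 * J.n ^ 2) 0 := by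
    simp [HopReduction.reductionTime, HopReduction.heavyTime, HopReduction.evalTime,
      HopReduction.forTime]
  rw [HopReduction.reductionTime_eq_add, add_comm]
  simp only [e1, e2]
  refine add_le_add ?_ (HopReduction.reductionTime_mono hN)
  split_ifs with h
  -- the subroutine is only called if `55 ≤ n`
  · exact Nat.mul_le_mul (by omega) (ht hN)
  · simp
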